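/- Let $\lambda_0\in(1,\infty)$, $\beta_0=2\sqrt{\lambda_0^2-1}$, $\alpha_0=\lambda_0\beta_0$, and let $$\hat u_0(x,t)=-1+\frac{2(\lambda_0^2-1)\cos(\alpha_0t)+i\alpha_0\sin(\alpha_0t)}{\lambda_0\cosh(\beta_0x)-\cos(\alpha_0t)},\qquad (x,t)\in\mathbb R^2,$$ be the Kuznetsov–Ma breather. For a function $u=u(x,t)$ and $\lambda\in\mathbb C$ consider the Lax system $$\varphi_x=\begin{pmatrix}\lambda&u\\-\bar u&-\lambda\end{pmatrix}\varphi,\qquad \varphi_t=i\begin{pmatrix}\lambda^2+\frac12(|u|^2-1)&\lambda u+\frac12u_x\\-\lambda\bar u+\frac12\bar u_x&-\lambda^2-\frac12(|u|^2-1)\end{pmatrix}\varphi,$$ whose first equation is the Zakharov–Shabat (ZS) spectral problem; it is equivalent to $(\mathcal L-\lambda)\varphi=0$ with $$\mathcal L=\begin{pmatrix}\partial_x&-u\\-\bar u&-\partial_x\end{pmatrix}.$$ For $u=\hat u_0$ and fixed $t\in\mathbb R$, regard $\mathcal L=\mathcal L(t)$ as an unbounded operator in $L^2(\mathbb R;\mathbb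 C^2)$ with domain $H^1(\mathbb R;\mathbb C^2)$. Put $$p_0=\sqrt{\lambda_0+\tfrac12\beta_0}\,e^{\frac12(\beta_0x+i\alpha_0t)}-\sqrt{\lambda_0-\tfrac12\beta_0}\,e^{-\frac12(\beta_0x+i\alpha_0t)},$$ $$q_0=-\sqrt{\lambda_0-\tfrac12\beta_0}\,e^{\frac12(\beta_0x+i\alpha_0t)}+\sqrt{\lambda_0+\tfrac12\beta_0}\,e^{-\frac12(\beta_0x+i\alpha_0t)},$$ $$\hat p_0=-\frac{2\lambda_0\,\bar q_0}{|p_0|^2+|q_0|^2},\qquad \hat q_0=\frac{2\lambda_0\,\bar p_0}{|p_0|^2+|q_0|^2}.$$ Then, for $u=\hat u_0$: 0. For every $t\in\mathbb R$, the spectrum of $\mathcal L(t)$ in $L^2(\mathbb R;\mathbb C^2)$ is $\Sigma_{\rm KMB}=i\mathbb R\cup[-1,1]\cup\{\lambda_0,-\lambda_0\}$. 1. For each $\lambda\in i\mathbb R\cup(-1,1)$, the space of solutions of the Lax system that are bounded in $x$ for every $t$ has dimension two and, for every fixed $t$, so has the space of bounded solutions of the ZS spectral problem on $\mathbb R$.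 2. For $\lambda=1$ and for $\lambda=-1$, both of these spaces have dimension one. 3. $(\hat p_0,\hat q_0)^T$ and $(\bar{\hat q}_0,-\bar{\hat p}_0)^T$ solve the Lax system for $\lambda=\lambda_0$ and $\lambda=-\lambda_0$, respectively. For every $t$, they belong to $L^2(\mathbb R;\mathbb C^2)$ and are eigenfunctions of $\mathcal L(t)$ for the eigenvalues $\lambda_0$ and $-\lambda_0$, and both eigenvalues are algebraically simple, that is, $\dim\bigcup_{k\ge1}\ker(\mathcal L(t)\mp\lambda_0)^k=1$. Moreover $\varphi_0^*=(\bar{\hat q}_0,\bar{\hat p}_0)^T$ is an eigenfunction of the Hilbert space adjoint $\mathcal L(t)^*$ for $\lambda_0$ and, with $\varphi_0=(\hat p_0,\hat q_0)^T$, $$\langle\varphi_0^*,\varphi_0\rangle_{L^2}=-\frac{2\lambda_0}{\beta_0}\neq0 .$$ -/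

import Mathlib

open MeasureTheory
open scoped Matrix

noncomputable section

namespace KMB

/-! ### Spectral notions for an unbounded operator -/

section Operators

variable {X : Type*} [NormedAddCommGroup X] [NormedSpace ℂ X]

/-- The resolvent set: those `z` for which `A - z : D(A) → X` is a bijection with an everywhere
defined bounded inverse `R`. -/
def resolventSet (A : X →ₗ.[ℂ] X) : Set ℂ :=
  {z | ∃ R : X →L[ℂ] X,
    (∀ f : X, ∃ h : R f ∈ A.domain, A ⟨R f, h⟩ - z • R f = f) ∧
    (∀ y : A.domain, R (A y - z • (y : X)) = y)}

/-- The spectrum: the complement of the resolvent set. -/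
def spectrum (A : X →ₗ.[ℂ] X) : Set ℂ := (resolventSet A)ᶜ

/-- `f` is an eigenvector of `A` for the eigenvalue `z`. -/
def IsEigenvector (A : X →ₗ.[ℂ] X) (z : ℂ) (f : X) : Prop :=
  f ≠ 0 ∧ ∃ h : f ∈ A.domain, A ⟨f, h⟩ = z • f

/-- The kernel of `(A - z) ^ k` on its natural domain: `f ∈ ker (A - z) ^ (k + 1)` iff `f ∈ D(A)` and
`(A - z) f ∈ ker (A - z) ^ k`. -/
def powKer (A : X →ₗ.[ℂ] X) (z : ℂ) : ℕ → Submodule ℂ X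
  | 0 => ⊥
  | k + 1 => ((powKer A z k).comap (A.toFun - z • A.domain.subtype)).map A.domain.subtype

/-- The algebraic multiplicity: the dimension of the space of all generalized eigenvectors. -/
def algMult (A : X →ₗ.[ℂ] X) (z : ℂ) : ℕ :=
  Module.finrank ℂ (⨆ k, powKer A z k : Submodule ℂ X)

end Operators

/-! ### The Zakharov–Shabat operator in `L²(ℝ; ℂ²)` -/

/-- The Hilbert space `L²(ℝ; ℂ²)`. -/
abbrev L2 : Type := Lp (EuclideanSpace ℂ (Fin 2)) 2 (volume : Measure ℝ)

/-- `f ∈ H¹(ℝ; ℂ²)` with derivative `g ∈ L²(ℝ; ℂ²)`: the class `f` has a locally absolutely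
continuous representative `F`, with `F' = g` almost everywhere. -/
def HasL2Deriv (f g : L2) : Prop :=
  ∃ F : ℝ → EuclideanSpace ℂ (Fin 2), f =ᵐ[volume] F ∧
    ∀ a b : ℝ, F b - F a = ∫ x in a..b, g x

theorem L2.intervalIntegrable (g : L2) (a b : ℝ) : IntervalIntegrable g volume a b :=
  intervalIntegrable_iff.mpr
    ((((Lp.memLp g).locallyIntegrable (by norm_num)).integrableOn_isCompact
      isCompact_uIcc).mono_set Set.uIoc_subset_uIcc)

theorem HasL2Deriv.add {f g f' g' : L2} (h : HasL2Deriv f g) (h' : HasL2Deriv f' g') :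
    HasL2Deriv (f + f') (g + g') := by
  obtain ⟨F, hF, hF'⟩ := h
  obtain ⟨G, hG, hG'⟩ := h'
  refine ⟨F + G, ?_, fun a b => ?_⟩
  · filter_upwards [Lp.coeFn_add f f', hF, hG] with x h1 h2 h3
    rw [h1, Pi.add_apply, Pi.add_apply, h2, h3]
  · have e : ∫ x in a..b, (g + g' : L2) x = ∫ x in a..b, (g x + g' x) :=
      intervalIntegral.integral_congr_ae (by
        filter_upwards [Lp.coeFn_add g g'] with x hx _ using by rw [hx, Pi.add_apply])
    rw [e, intervalIntegral.integral_add (L2.intervalIntegrable g a b)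
      (L2.intervalIntegrable g' a b), ← hF' a b, ← hG' a b]
    simp only [Pi.add_apply]
    abel

theorem HasL2Deriv.smul {f g : L2} (c : ℂ) (h : HasL2Deriv f g) :
    HasL2Deriv (c • f) (c • g) := by
  obtain ⟨F, hF, hF'⟩ := h
  refine ⟨c • F, ?_, fun a b => ?_⟩
  · filter_upwards [Lp.coeFn_smul c f, hF] with x h1 h2
    rw [h1, Pi.smul_apply, Pi.smul_apply, h2]
  · have e : ∫ x in a..b, (c • g : L2) x = ∫ x in a..b, c • g x :=
      intervalIntegral.integral_congr_ae (by
        filter_upwards [Lp.coeFn_smul c g] with x hx _ using by rw [hx, Pi.smul_apply])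
    rw [e, intervalIntegral.integral_smul, ← hF' a b]
    simp only [Pi.smul_apply, smul_sub]

/-- The derivative of the zero class is zero. -/
theorem HasL2Deriv.eq_zero {g : L2} (h : HasL2Deriv 0 g) : g = 0 := by
  obtain ⟨F, hF, hF'⟩ := h
  have hc : Continuous F := by
    have e : F = fun b => F 0 + ∫ x in (0 : ℝ)..b, g x := by
      funext b
      rw [← hF' 0 b]
      abel
    rw [e]
    exact continuous_const.add
      (intervalIntegral.continuous_primitive (L2.intervalIntegrable g) 0)
  have h0 : F = fun _ => 0 := by
    refine (Continuous.ae_eq_iff_eq volume hc continuous_const).mp ?_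
    filter_upwards [hF, Lp.coeFn_zero (EuclideanSpace ℂ (Fin 2)) 2 (volume : Measure ℝ)]
      with x h1 h2
    rw [← h1, h2]
    rfl
  have hi : ∀ b : ℝ, ∫ x in (0 : ℝ)..b, g x = 0 := fun b => by
    rw [← hF' 0 b, h0]
    simp
  refine Lp.ext ?_
  filter_upwards [LocallyIntegrable.ae_hasDerivAt_integral
      ((Lp.memLp g).locallyIntegrable (by norm_num)),
    Lp.coeFn_zero (EuclideanSpace ℂ (Fin 2)) 2 (volume : Measure ℝ)] with x h1 h2
  have h3 := h1 0
  simp only [hi] at h3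
  rw [h2]
  exact h3.unique (hasDerivAt_const x _)

/-- The graph of the Zakharov–Shabat operator with potential `u`: the pairs `(f, h)` in
`L² × L²` with `f ∈ H¹` and
`h = (∂ₓ f₁ - u f₂, - ū f₁ - ∂ₓ f₂)` almost everywhere. -/
def zsGraph (u : ℝ → ℂ) : Submodule ℂ (L2 × L2) where
  carrier := {fh | ∃ g : L2, HasL2Deriv fh.1 g ∧ ∀ᵐ x : ℝ,
    fh.2 x = !₂[g x 0 - u x * fh.1 x 1, -(star (u x)) * fh.1 x 0 - g x 1]}
  zero_mem' := by
    have z := Lp.coeFn_zero (EuclideanSpace ℂ (Fin 2)) 2 (volume : Measure ℝ)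
    refine ⟨0, ⟨0, z, by
      intro a b
      have e : ∫ x in a..b, (0 : L2) x = ∫ x in a..b, (0 : EuclideanSpace ℂ (Fin 2)) :=
        intervalIntegral.integral_congr_ae (by filter_upwards [z] with x hx _ using by rw [hx, Pi.zero_apply])
      rw [e]
      simp⟩, ?_⟩
    filter_upwards [z] with x hx
    ext i
    rw [hx]
    fin_cases i <;> simp
  add_mem' := by
    rintro ⟨f, h⟩ ⟨f', h'⟩ ⟨g, hg, hh⟩ ⟨g', hg', hh'⟩
    refine ⟨g + g', hg.add hg', ?_⟩
    filter_upwards [Lp.coeFn_add f f', Lp.coeFn_add g g', Lp.coeFn_add h h', hh, hh']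
      with x h1 h2 h3 h4 h5
    simp only [Prod.mk_add_mk]
    rw [h1, h2, h3]
    simp only [Pi.add_apply]
    rw [h4, h5]
    ext i
    fin_cases i <;> simp <;> ring
  smul_mem' := by
    rintro c ⟨f, h⟩ ⟨g, hg, hh⟩
    refine ⟨c • g, hg.smul c, ?_⟩
    filter_upwards [Lp.coeFn_smul c f, Lp.coeFn_smul c g, Lp.coeFn_smul c h, hh]
      with x h1 h2 h3 h4
    simp only [Prod.smul_mk]
    rw [h1, h2, h3]
    simp only [Pi.smul_apply]
    rw [h4]
    ext i
    fin_cases i <;> simp <;> ring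

/-- The Zakharov–Shabat operator `(∂ₓ, -u; -ū, -∂ₓ)` as an unbounded operator in `L²(ℝ; ℂ²)`.
Its domain is the set of `f ∈ H¹` whose image is in `L²`; for bounded measurable `u` it is all of
`H¹` (`mem_zsOperator_domain_iff`). -/
def zsOperator (u : ℝ → ℂ) : L2 →ₗ.[ℂ] L2 := (zsGraph u).toLinearPMap

theorem zsGraph_functional (u : ℝ → ℂ) :
    ∀ p ∈ zsGraph u, p.1 = 0 → p.2 = 0 := by
  rintro ⟨f, h⟩ ⟨g, hg, hh⟩ (hf : f = 0)
  subst hf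
  have hg0 := hg.eq_zero
  subst hg0
  have z := Lp.coeFn_zero (EuclideanSpace ℂ (Fin 2)) 2 (volume : Measure ℝ)
  refine Lp.ext ?_
  filter_upwards [z, hh] with x h1 h2
  rw [h2]
  ext i
  rw [h1]
  fin_cases i <;> simp

theorem zsOperator_graph (u : ℝ → ℂ) : (zsOperator u).graph = zsGraph u :=
  Submodule.toLinearPMap_graph_eq _ (fun p hp h0 => zsGraph_functional u p hp h0)

theorem mem_zsOperator_domain_iff {u : ℝ → ℂ} (hu : Measurable u) {C : ℝ}
    (hC : ∀ x, ‖u x‖ ≤ C) (f : L2) :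
    f ∈ (zsOperator u).domain ↔ ∃ g, HasL2Deriv f g := by
  have hdom : f ∈ (zsOperator u).domain ↔ ∃ h, (f, h) ∈ zsGraph u := by
    change f ∈ (zsGraph u).map (LinearMap.fst ℂ L2 L2) ↔ _
    simp
  rw [hdom]
  constructor
  · rintro ⟨h, g, hg, -⟩
    exact ⟨g, hg⟩
  · rintro ⟨g, hg⟩
    have hf0 := (Lp.memLp f).eval_piLp 0
    have hf1 := (Lp.memLp f).eval_piLp 1
    have hg0 := (Lp.memLp g).eval_piLp 0
    have hg1 := (Lp.memLp g).eval_piLp 1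
    have m1 : MemLp (fun x => u x * f x 1) 2 volume :=
      hf1.of_le_mul (c := C) (hu.aestronglyMeasurable.mul hf1.1)
        (Filter.Eventually.of_forall fun x => by
          rw [norm_mul]; exact mul_le_mul_of_nonneg_right (hC x) (norm_nonneg _))
    have m0 : MemLp (fun x => -(star (u x)) * f x 0) 2 volume :=
      hf0.of_le_mul (c := C) (((continuous_star.measurable.comp hu).neg).aestronglyMeasurable.mul hf0.1)
        (Filter.Eventually.of_forall fun x => by
          rw [norm_mul, norm_neg, norm_star]
          exact mul_le_mul_of_nonneg_right (hC x) (norm_nonneg _))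
    have m : MemLp (fun x => (!₂[g x 0 - u x * f x 1, -(star (u x)) * f x 0 - g x 1] :
        EuclideanSpace ℂ (Fin 2))) 2 volume := by
      refine MemLp.of_eval_piLp fun i => ?_
      fin_cases i
      · exact hg0.sub m1
      · exact m0.sub hg1
    exact ⟨m.toLp _, g, hg, m.coeFn_toLp⟩

/-! ### The Lax system -/

/-- The matrix of the Zakharov–Shabat spectral problem, with `u` the value of the potential. -/
def laxU (u z : ℂ) : Matrix (Fin 2) (Fin 2) ℂ :=
  !![z, u; -star u, -z]

/-- The matrix of the time evolution, with `u` and `ux` the values of the potential and of its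
`x`-derivative. -/
def laxV (u ux z : ℂ) : Matrix (Fin 2) (Fin 2) ℂ :=
  Complex.I • !![z ^ 2 + (1 / 2) * ((‖u‖ : ℂ) ^ 2 - 1), z * u + (1 / 2) * ux;
    -z * star u + (1 / 2) * star ux, -z ^ 2 - (1 / 2) * ((‖u‖ : ℂ) ^ 2 - 1)]

/-- `φ` solves the spectral problem `φ' = U(u, z) φ` on `ℝ`. -/
def IsZSSolution (u : ℝ → ℂ) (z : ℂ) (φ : ℝ → Fin 2 → ℂ) : Prop :=
  ∀ x, HasDerivAt φ (laxU (u x) z *ᵥ φ x) x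

/-- `φ = φ(x, t)` solves the Lax system `φₓ = U(u, z) φ`, `φₜ = V(u, z) φ` on `ℝ × ℝ`. -/
def IsLaxSolution (u : ℝ → ℝ → ℂ) (z : ℂ) (φ : ℝ → ℝ → Fin 2 → ℂ) : Prop :=
  (∀ t, IsZSSolution (fun x => u x t) z (fun x => φ x t)) ∧
  ∀ x t, HasDerivAt (fun s => φ x s)
    (laxV (u x t) (deriv (fun y => u y t) x) z *ᵥ φ x t) t

theorem IsZSSolution.add {u : ℝ → ℂ} {z : ℂ} {φ ψ : ℝ → Fin 2 → ℂ} (h : IsZSSolution u z φ)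
    (h' : IsZSSolution u z ψ) : IsZSSolution u z (φ + ψ) := fun x => by
  have e := (h x).add (h' x)
  rw [← Matrix.mulVec_add] at e
  exact e

theorem IsZSSolution.smul {u : ℝ → ℂ} {z : ℂ} {φ : ℝ → Fin 2 → ℂ} (c : ℂ)
    (h : IsZSSolution u z φ) : IsZSSolution u z (c • φ) := fun x => by
  have e := (h x).const_smul c
  rw [← Matrix.mulVec_smul] at e
  exact e

theorem IsZSSolution.zero (u : ℝ → ℂ) (z : ℂ) : IsZSSolution u z 0 := fun x => by
  rw [Pi.zero_apply, Matrix.mulVec_zero]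
  exact hasDerivAt_const x (0 : Fin 2 → ℂ)

/-- The space of bounded solutions on `ℝ` of the spectral problem. -/
def boundedZSSolutions (u : ℝ → ℂ) (z : ℂ) : Submodule ℂ (ℝ → Fin 2 → ℂ) where
  carrier := {φ | IsZSSolution u z φ ∧ ∃ C : ℝ, ∀ x, ‖φ x‖ ≤ C}
  zero_mem' := ⟨.zero u z, 0, by simp⟩
  add_mem' := by
    rintro φ ψ ⟨h, C, hC⟩ ⟨h', C', hC'⟩
    exact ⟨h.add h', C + C', fun x => (norm_add_le _ _).trans (add_le_add (hC x) (hC' x))⟩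
  smul_mem' := by
    rintro c φ ⟨h, C, hC⟩
    refine ⟨h.smul c, ‖c‖ * C, fun x => ?_⟩
    rw [Pi.smul_apply, norm_smul]
    exact mul_le_mul_of_nonneg_left (hC x) (norm_nonneg c)

/-- The space of solutions of the Lax system that are bounded in `x` for each `t`. -/
def boundedLaxSolutions (u : ℝ → ℝ → ℂ) (z : ℂ) : Submodule ℂ (ℝ → ℝ → Fin 2 → ℂ) where
  carrier := {φ | IsLaxSolution u z φ ∧ ∀ t, ∃ C : ℝ, ∀ x, ‖φ x t‖ ≤ C}
  zero_mem' := ⟨⟨fun t => .zero _ z, fun x t => by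
    rw [Pi.zero_apply, Pi.zero_apply, Matrix.mulVec_zero]
    exact hasDerivAt_const t (0 : Fin 2 → ℂ)⟩, fun t => ⟨0, by simp⟩⟩
  add_mem' := by
    rintro φ ψ ⟨⟨h, k⟩, b⟩ ⟨⟨h', k'⟩, b'⟩
    refine ⟨⟨fun t => (h t).add (h' t), fun x t => ?_⟩, fun t => ?_⟩
    · have e := (k x t).add (k' x t)
      rw [← Matrix.mulVec_add] at e
      exact e
    · obtain ⟨C, hC⟩ := b t
      obtain ⟨C', hC'⟩ := b' t
      exact ⟨C + C', fun x => (norm_add_le _ _).trans (add_le_add (hC x) (hC' x))⟩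
  smul_mem' := by
    rintro c φ ⟨⟨h, k⟩, b⟩
    refine ⟨⟨fun t => (h t).smul c, fun x t => ?_⟩, fun t => ?_⟩
    · have e := (k x t).const_smul c
      rw [← Matrix.mulVec_smul] at e
      exact e
    · obtain ⟨C, hC⟩ := b t
      refine ⟨‖c‖ * C, fun x => ?_⟩
      rw [Pi.smul_apply, Pi.smul_apply, norm_smul]
      exact mul_le_mul_of_nonneg_left (hC x) (norm_nonneg c)

/-! ### The Kuznetsov–Ma breather with parameter `l > 1` and its eigenfunctions -/

/-- `β₀ = 2 √(λ₀² - 1)`. -/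
def beta (l : ℝ) : ℝ := 2 * √(l ^ 2 - 1)

/-- `α₀ = λ₀ β₀`. -/
def alpha (l : ℝ) : ℝ := l * beta l

/-- The Kuznetsov–Ma breather `û₀(x, t)`. -/
def kmb (l x t : ℝ) : ℂ :=
  -1 + ((2 * (l ^ 2 - 1) * Real.cos (alpha l * t) : ℝ) +
      Complex.I * (alpha l * Real.sin (alpha l * t) : ℝ)) /
    ((l * Real.cosh (beta l * x) - Real.cos (alpha l * t) : ℝ) : ℂ)

/-- `p₀(x, t)`. -/
def p₀ (l x t : ℝ) : ℂ :=
  (√(l + beta l / 2) : ℝ) * Complex.exp ((1 / 2) * (beta l * x + Complex.I * alpha l * t)) -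
  (√(l - beta l / 2) : ℝ) * Complex.exp (-(1 / 2) * (beta l * x + Complex.I * alpha l * t))

/-- `q₀(x, t)`. -/
def q₀ (l x t : ℝ) : ℂ :=
  -(√(l - beta l / 2) : ℝ) * Complex.exp ((1 / 2) * (beta l * x + Complex.I * alpha l * t)) +
  (√(l + beta l / 2) : ℝ) * Complex.exp (-(1 / 2) * (beta l * x + Complex.I * alpha l * t))

/-- `p̂₀ = - 2 λ₀ q̄₀ / (|p₀|² + |q₀|²)`. -/
def pHat (l x t : ℝ) : ℂ :=
  ((2 * l / (‖p₀ l x t‖ ^ 2 + ‖q₀ l x t‖ ^ 2) : ℝ) : ℂ) * -star (q₀ l x t)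

/-- `q̂₀ = 2 λ₀ p̄₀ / (|p₀|² + |q₀|²)`. -/
def qHat (l x t : ℝ) : ℂ :=
  ((2 * l / (‖p₀ l x t‖ ^ 2 + ‖q₀ l x t‖ ^ 2) : ℝ) : ℂ) * star (p₀ l x t)

/-- The eigenfunction `(p̂₀, q̂₀)` for `λ₀`. -/
def eigenPlus (l x t : ℝ) : Fin 2 → ℂ := ![pHat l x t, qHat l x t]

/-- The eigenfunction `(conj q̂₀, - conj p̂₀)` for `-λ₀`. -/
def eigenMinus (l x t : ℝ) : Fin 2 → ℂ := ![star (qHat l x t), -star (pHat l x t)]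

/-- The eigenfunction `(conj q̂₀, conj p̂₀)` of the adjoint problem for `λ₀`. -/
def eigenAdjoint (l x t : ℝ) : Fin 2 → ℂ := ![star (qHat l x t), star (pHat l x t)]

/-- The Zakharov–Shabat operator in `L²(ℝ; ℂ²)` at the breather, at time `t`. -/
def kmbOperator (l t : ℝ) : L2 →ₗ.[ℂ] L2 := zsOperator (fun x => kmb l x t)

end KMB

end

noncomputable section

namespace KMB

open Set Filter Topology

/-! The breather is a one-fold Darboux transform of the constant potential `1`, and everything away
from `± λ₀` is transported from that trivial background. Write `U(u, z) = z σ + Q(u)` with `σ =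
diag(1, -1)` and `Q(u) = (0, u; -ū, 0)`. There is an explicit Hermitian reflection `S`, with entries
`refl₁`, `refl₂` and `S² = 1` (`refl_sq`), such that `û₀ = 1 + 2 λ₀ S₁₂`, `S_x = Q(û₀) S - S Q(1)`
and `S_t = i λ₀ S_x S`. These relations say that `z - λ₀ S` maps solutions for the potential `1` to
solutions for `û₀`. Since `(z - λ₀ S)(z + λ₀ S) = z² - λ₀²` and `S` has entries of modulus at most
one, this map and its inverse are uniformly bounded when `z ≠ ± λ₀`, so they preserve both
boundedness and square integrability.

For the potential `1` the time matrix is `i z U`, so solutions are `exp(ξ U) v` with `ξ = x + i z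
t`, and `U² = k²` with `k² = z² - 1`. If `z ∈ iℝ ∪ (-1, 1)`, then `k` is imaginary and nonzero and
every solution is bounded; if `z = ± 1`, then `U² = 0` and `v + ξ U v` is bounded only for `v ∈ ker
U`. This gives the two dimension counts (`finrank_bounded`).

A bounded solution, multiplied by a slowly varying cut-off, shows that `z` is in the spectrum
(`mem_spectrum_of_bounded`). If instead `Re k ≠ 0`, the constant problem decouples into `y' = ± k y
+ h`, which is uniquely and boundedly solvable in `L²`; dressing the result yields the resolvent
(`kmb_mem_resolventSet`).

At `z = λ₀` the Darboux matrix annihilates the seed solution `(p₀, q₀)`. The orthogonal vector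
`(-q̄₀, p̄₀)`, divided by `|p₀|² + |q₀|²`, is a multiple of the new eigenfunction, and the symmetry
`φ ↦ (φ̄₂, -φ̄₁)` carries it to `-λ₀`. Two square integrable solutions have a Wronskian that is both
constant and integrable, hence zero, so the eigenvalues are geometrically simple. Because `L* = -σ L
σ`, the functions `σ φ` are adjoint eigenfunctions; the pairing of such a function with the
eigenfunction has an explicit primitive and equals `-2 λ₀ / β₀`. As it does not vanish, no Jordan
chain exists. -/

/-- `F` is locally absolutely continuous with the locally integrable derivative `f`. -/
def IsPrim (F f : ℝ → ℂ) : Prop :=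
  LocallyIntegrable f volume ∧ ∀ a b : ℝ, F b - F a = ∫ x in a..b, f x

theorem _root_.MeasureTheory.LocallyIntegrable.intervalIntegrable' {E : Type*}
    [NormedAddCommGroup E] {f : ℝ → E} (hf : LocallyIntegrable f volume) (a b : ℝ) :
    IntervalIntegrable f volume a b :=
  intervalIntegrable_iff.mpr ((hf.integrableOn_isCompact isCompact_uIcc).mono_set uIoc_subset_uIcc)

/-! ### Calculus of locally absolutely continuous functions -/

namespace IsPrim

variable {F G f g : ℝ → ℂ}

theorem eq_add (h : IsPrim F f) : F = fun b => F 0 + ∫ x in (0 : ℝ)..b, f x := by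
  funext b
  rw [← h.2 0 b]
  abel

theorem continuous (h : IsPrim F f) : Continuous F := by
  rw [h.eq_add]
  exact continuous_const.add (intervalIntegral.continuous_primitive h.1.intervalIntegrable' 0)

theorem ae_hasDerivAt (h : IsPrim F f) : ∀ᵐ x, HasDerivAt F (f x) x := by
  filter_upwards [LocallyIntegrable.ae_hasDerivAt_integral h.1] with x hx
  rw [h.eq_add]
  exact (hx 0).const_add _

theorem hasDerivAt (h : IsPrim F f) (hf : Continuous f) (x : ℝ) : HasDerivAt F (f x) x := by
  rw [h.eq_add]
  exact (intervalIntegral.integral_hasDerivAt_right (hf.intervalIntegrable _ _)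
    (hf.stronglyMeasurableAtFilter _ _) hf.continuousAt).const_add _

theorem of_hasDerivAt (h : ∀ x, HasDerivAt F (f x) x) (hf : Continuous f) : IsPrim F f :=
  ⟨hf.locallyIntegrable, fun a b =>
    (intervalIntegral.integral_eq_sub_of_hasDerivAt (fun x _ => h x)
      (hf.intervalIntegrable a b)).symm⟩

theorem congr_ae (h : IsPrim F f) (hfg : f =ᵐ[volume] g) : IsPrim F g :=
  ⟨h.1.congr hfg, fun a b => by
    rw [h.2 a b]
    exact intervalIntegral.integral_congr_ae (hfg.mono fun x hx _ => hx)⟩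

theorem add (h : IsPrim F f) (h' : IsPrim G g) :
    IsPrim (fun x => F x + G x) (fun x => f x + g x) :=
  ⟨h.1.add h'.1, fun a b => by
    rw [intervalIntegral.integral_add (h.1.intervalIntegrable' a b) (h'.1.intervalIntegrable' a b),
      ← h.2, ← h'.2]
    ring⟩

theorem const_mul (c : ℂ) (h : IsPrim F f) : IsPrim (fun x => c * F x) (fun x => c * f x) :=
  ⟨h.1.smul c, fun a b => by
    rw [intervalIntegral.integral_const_mul, ← h.2]
    ring⟩

theorem comp_neg (h : IsPrim F f) : IsPrim (fun x => F (-x)) (fun x => -f (-x)) :=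
  ⟨by
    refine LocallyIntegrable.neg ((locallyIntegrable_map_homeomorph (Homeomorph.neg ℝ)).1 ?_)
    have e : Measure.map (Homeomorph.neg ℝ) (volume : Measure ℝ) = volume :=
      (Measure.measurePreserving_neg (volume : Measure ℝ)).map_eq
    rw [e]
    exact h.1, fun a b => by
    rw [intervalIntegral.integral_neg, intervalIntegral.integral_comp_neg, ← h.2]
    ring⟩

theorem _root_.AbsolutelyContinuousOnInterval.ofReal {u : ℝ → ℝ} {a b : ℝ}
    (h : AbsolutelyContinuousOnInterval u a b) :
    AbsolutelyContinuousOnInterval (fun x => (u x : ℂ)) a b := by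
  unfold AbsolutelyContinuousOnInterval at h ⊢
  simpa only [Complex.isometry_ofReal.dist_eq] using h

/-- The real and imaginary parts of `f` are treated separately, each as the integrand of a real
primitive; the constant `F a` is then restored. -/
theorem absolutelyContinuous (h : IsPrim F f) (a b : ℝ) :
    AbsolutelyContinuousOnInterval F a b := by
  have hi := h.1.intervalIntegrable' a b
  have hre : IntervalIntegrable (fun x => (f x).re) volume a b :=
    ⟨hi.1.re, hi.2.re⟩
  have him : IntervalIntegrable (fun x => (f x).im) volume a b :=
    ⟨hi.1.im, hi.2.im⟩
  have e : F = fun x => (((∫ v in a..x, (f v).re : ℝ) : ℂ) +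
      Complex.I * ((∫ v in a..x, (f v).im : ℝ) : ℂ)) - (-F a) := by
    funext x
    have hx := h.1.intervalIntegrable' a x
    have e1 : ∫ v in a..x, f v = ∫ v in a..x, (((f v).re : ℂ) + Complex.I * ((f v).im : ℂ)) := by
      refine intervalIntegral.integral_congr fun v _ => ?_
      rw [mul_comm, Complex.re_add_im]
    have e2 : IntervalIntegrable (fun v => ((f v).re : ℂ)) volume a x :=
      ⟨hx.1.re.ofReal, hx.2.re.ofReal⟩
    have e3 : IntervalIntegrable (fun v => ((f v).im : ℂ)) volume a x :=
      ⟨hx.1.im.ofReal, hx.2.im.ofReal⟩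
    rw [intervalIntegral.integral_add e2 (e3.const_mul _), intervalIntegral.integral_const_mul,
      intervalIntegral.integral_ofReal, intervalIntegral.integral_ofReal, ← h.2 a x] at e1
    rw [← e1]
    ring
  have hc : AbsolutelyContinuousOnInterval (fun _ : ℝ => -F a) a b :=
    contDiffOn_const.absolutelyContinuousOnInterval
  rw [e]
  exact ((hre.absolutelyContinuousOnInterval_intervalIntegral left_mem_uIcc).ofReal.add
    ((him.absolutelyContinuousOnInterval_intervalIntegral left_mem_uIcc).ofReal.const_smul
      Complex.I)).sub hc

/-- Subtracting the integral of `f` leaves an absolutely continuous function whose derivative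
vanishes almost everywhere, hence a constant. This is how the product rule and conjugation, known
pointwise almost everywhere, become integrated identities. -/
theorem of_absolutelyContinuous (h : ∀ a b, AbsolutelyContinuousOnInterval F a b)
    (hd : ∀ᵐ x, HasDerivAt F (f x) x) (hf : LocallyIntegrable f volume) : IsPrim F f := by
  refine ⟨hf, fun a b => ?_⟩
  have hP : IsPrim (fun x => ∫ v in a..x, f v) f := ⟨hf, fun c d =>
    intervalIntegral.integral_interval_sub_left (hf.intervalIntegrable' _ _)
      (hf.intervalIntegrable' _ _)⟩
  obtain ⟨C, hC⟩ := ((h a b).sub (hP.absolutelyContinuous a b)).const_of_ae_hasDerivAt_zero (by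
    filter_upwards [hd, hP.ae_hasDerivAt] with x h1 h2 _
    simpa using h1.sub h2)
  have h1 := hC a left_mem_uIcc
  have h2 := hC b right_mem_uIcc
  simp only [Pi.sub_apply, intervalIntegral.integral_same, sub_zero] at h1 h2
  rw [h1, ← h2]
  ring

theorem mul (h : IsPrim F f) (h' : IsPrim G g) :
    IsPrim (fun x => F x * G x) (fun x => f x * G x + F x * g x) := by
  refine of_absolutelyContinuous
    (fun a b => (h.absolutelyContinuous a b).smul (h'.absolutelyContinuous a b)) ?_
    ((h.1.mul_continuous h'.continuous).add (h'.1.continuous_mul h.continuous))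
  filter_upwards [h.ae_hasDerivAt, h'.ae_hasDerivAt] with x h1 h2
  exact h1.mul h2

theorem conj (h : IsPrim F f) : IsPrim (fun x => star (F x)) (fun x => star (f x)) := by
  have hs : LocallyIntegrable (fun x => star (f x)) volume :=
    h.1.mono (continuous_star.comp_aestronglyMeasurable h.1.aestronglyMeasurable)
      (.of_forall fun x => (norm_star _).le)
  refine of_absolutelyContinuous (fun a b => ?_) ?_ hs
  · have := h.absolutelyContinuous a b
    unfold AbsolutelyContinuousOnInterval at this ⊢
    simpa using this
  · filter_upwards [h.ae_hasDerivAt] with x hx using hx.star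

/-- An integrable function with an integrable derivative: the derivative has integral zero. -/
theorem integral_eq_zero (h : IsPrim F f) (hF : Integrable F) (hf : Integrable f) :
    ∫ x, f x = 0 := by
  -- The limit exists because `f` is integrable. It must be zero because `F` is integrable and
  -- neighbourhoods of infinity have infinite measure.
  have top : Tendsto F atTop (𝓝 0) := by
    have A : Tendsto F atTop (𝓝 (F 0 + ∫ x in Ioi (0 : ℝ), f x)) := by
      nth_rw 1 [h.eq_add]
      exact (intervalIntegral_tendsto_integral_Ioi 0 hf.integrableOn tendsto_id).const_add _
    have e := IntegrableAtFilter.eq_zero_of_tendsto (hF.integrableAtFilter atTop)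
      (fun s hs => by
        obtain ⟨b, hb⟩ := mem_atTop_sets.1 hs
        rw [← top_le_iff, ← Real.volume_Ici (a := b)]
        exact measure_mono hb) A
    rwa [e] at A
  have bot : Tendsto F atBot (𝓝 0) := by
    have A : Tendsto F atBot (𝓝 (F 0 - ∫ x in Iic (0 : ℝ), f x)) := by
      have e : F = fun b => F 0 - ∫ x in b..(0 : ℝ), f x := by
        funext b
        rw [← h.2 b 0]
        abel
      nth_rw 1 [e]
      exact (intervalIntegral_tendsto_integral_Iic 0 hf.integrableOn tendsto_id).const_sub _
    have e := IntegrableAtFilter.eq_zero_of_tendsto (hF.integrableAtFilter atBot)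
      (fun s hs => by
        obtain ⟨b, hb⟩ := mem_atBot_sets.1 hs
        rw [← top_le_iff, ← Real.volume_Iic (a := b)]
        exact measure_mono hb) A
    rwa [e] at A
  have A := intervalIntegral_tendsto_integral hf
    (tendsto_neg_atTop_atBot : Tendsto (fun n : ℝ => -n) atTop atBot) tendsto_id
  have B : Tendsto (fun n : ℝ => F n - F (-n)) atTop (𝓝 (0 - 0)) :=
    top.sub (bot.comp tendsto_neg_atTop_atBot)
  simp only [h.2, sub_zero] at B
  exact tendsto_nhds_unique A B

end IsPrim

/-! ### The scalar equation `y' = κ y + h` in `L²` -/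

theorem _root_.MeasureTheory.MemLp.locallyIntegrable_two {f : ℝ → ℂ} (hf : MemLp f 2 volume) :
    LocallyIntegrable f volume :=
  hf.locallyIntegrable (by norm_num)

theorem _root_.MeasureTheory.MemLp.integrable_norm_sq {f : ℝ → ℂ} (hf : MemLp f 2 volume) :
    Integrable (fun x => ‖f x‖ ^ 2) volume :=
  (memLp_two_iff_integrable_sq_norm hf.1).1 hf

theorem _root_.MeasureTheory.MemLp.integrable_mul_star {f g : ℝ → ℂ} (hf : MemLp f 2 volume)
    (hg : MemLp g 2 volume) : Integrable (fun x => f x * star (g x)) volume :=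
  hf.integrable_mul hg.star

/-- The energy identity for `y' = κ y + h` in `L²`. -/
theorem IsPrim.energy {y h : ℝ → ℂ} {κ : ℂ} (hp : IsPrim y fun x => κ * y x + h x)
    (hy : MemLp y 2 volume) (hh : MemLp h 2 volume) :
    κ.re * ∫ x, ‖y x‖ ^ 2 = -∫ x, (h x * star (y x)).re := by
  -- The function `|y|²` is integrable with derivative `2 Re κ |y|² + 2 Re (h ȳ)`, so that
  -- derivative integrates to zero.
  have hm := hp.mul hp.conj
  have e : (fun x => (κ * y x + h x) * star (y x) + y x * star (κ * y x + h x)) =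
      fun x => ((2 * κ.re * ‖y x‖ ^ 2 + 2 * (h x * star (y x)).re : ℝ) : ℂ) := by
    funext x
    have h1 : (‖y x‖ : ℂ) ^ 2 = y x * star (y x) := (Complex.mul_conj' _).symm
    have h2 := Complex.add_conj κ
    have h3 := Complex.add_conj (h x * star (y x))
    push_cast
    rw [h1]
    simp only [Complex.star_def, map_mul, map_add, Complex.conj_conj] at h2 h3 ⊢
    push_cast at h2 h3
    linear_combination (y x * (starRingEnd ℂ) (y x)) * h2 + h3
  rw [e] at hm
  have i1 := hy.integrable_norm_sq.const_mul (2 * κ.re)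
  have i2 : Integrable (fun x => 2 * (h x * star (y x)).re) volume :=
    (hh.integrable_mul_star hy).re.const_mul 2
  have hz := hm.integral_eq_zero (hy.integrable_mul_star hy) (i1.add i2).ofReal
  rw [integral_complex_ofReal, Complex.ofReal_eq_zero, integral_add i1 i2, integral_const_mul,
    integral_const_mul] at hz
  linarith

theorem IsPrim.eq_zero {y : ℝ → ℂ} {κ : ℂ} (hκ : κ.re ≠ 0) (hp : IsPrim y fun x => κ * y x)
    (hy : MemLp y 2 volume) : y = 0 := by
  have hp' : IsPrim y fun x => κ * y x + (fun _ => (0 : ℂ)) x := by simpa using hp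
  have := hp'.energy hy MemLp.zero
  simp only [zero_mul, Complex.zero_re, integral_zero, neg_zero, mul_eq_zero, hκ, false_or] at this
  rw [integral_eq_zero_iff_of_nonneg (fun x => by positivity) hy.integrable_norm_sq] at this
  refine (Continuous.ae_eq_iff_eq volume hp.continuous continuous_const).mp ?_
  filter_upwards [this] with x hx
  change y x = 0
  simpa using hx

/-- Since `Re κ < 0`, the solution that comes from `-∞`, `y(x) = ∫_{-∞}^x exp(κ (x - s)) h(s) ds`,
has a decaying kernel. Square integrability comes from the differential inequality for `|y|²` on
`[-n, n]`. Only afterwards is the energy identity on the whole line available, and it gives the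
constant `(Re κ)⁻²`. -/
theorem exists_memLp_isPrim_of_re_neg {κ : ℂ} (hκ : κ.re < 0) {h : ℝ → ℂ}
    (hh : MemLp h 2 volume) :
    ∃ y, MemLp y 2 volume ∧ (IsPrim y fun x => κ * y x + h x) ∧
      ∫ x, ‖y x‖ ^ 2 ≤ (κ.re ^ 2)⁻¹ * ∫ x, ‖h x‖ ^ 2 := by
  obtain ⟨a, ha⟩ : ∃ a, a = -κ.re := ⟨_, rfl⟩
  have ha0 : 0 < a := by linarith
  set e : ℝ → ℂ := fun s => Complex.exp (-κ * s) with he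
  have hec : Continuous e := by fun_prop
  have hen : ∀ s, ‖e s‖ = Real.exp (a * s) := fun s => by
    rw [he, Complex.norm_exp]
    simp [ha]
  have hen2 : ∀ s, ‖e s‖ ^ 2 = Real.exp (2 * a * s) := fun s => by
    rw [hen, ← Real.exp_nat_mul]
    congr 1
    push_cast
    ring
  have he2 : ∀ x, IntegrableOn (fun s => ‖e s‖ ^ 2) (Iic x) volume := fun x => by
    simp only [hen2]
    exact integrableOn_exp_mul_Iic (by positivity) x
  have heL : ∀ x, MemLp e 2 (volume.restrict (Iic x)) := fun x =>
    (memLp_two_iff_integrable_sq_norm hec.aestronglyMeasurable).2 (he2 x)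
  have hint : ∀ x, IntegrableOn (fun s => e s * h s) (Iic x) volume := fun x =>
    (heL x).integrable_mul (hh.restrict (Iic x))
  have hY : IsPrim (fun x => ∫ s in Iic x, e s * h s) (fun s => e s * h s) :=
    ⟨hh.locallyIntegrable_two.continuous_mul hec, fun A b =>
      intervalIntegral.integral_Iic_sub_Iic (hint A) (hint b)⟩
  have hE : IsPrim (fun x : ℝ => Complex.exp (κ * x)) (fun x : ℝ => Complex.exp (κ * x) * κ) := by
    refine .of_hasDerivAt (fun x => ?_) (by fun_prop)
    have := ((hasDerivAt_id (x : ℂ)).const_mul κ).cexp.comp_ofReal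
    simpa using this
  set y : ℝ → ℂ := fun x => Complex.exp (κ * x) * ∫ s in Iic x, e s * h s with hy
  have hp : IsPrim y fun x => κ * y x + h x := by
    refine (hE.mul hY).congr_ae (.of_forall fun x => ?_)
    have : Complex.exp (κ * x) * e x = 1 := by
      rw [he, ← Complex.exp_add]
      simp
    simp only [hy]
    linear_combination h x * this
  obtain ⟨N, hN⟩ : ∃ N, N = ∫ x, ‖h x‖ ^ 2 := ⟨_, rfl⟩
  have hN0 : 0 ≤ N := by rw [hN]; positivity
  -- a crude pointwise bound
  have hbd : ∀ x, ‖y x‖ ≤ 1 / (2 * a) + N := fun x => by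
    have h1 : ‖y x‖ ≤ ∫ s in Iic x, Real.exp (-(a * x)) * ‖e s * h s‖ := by
      rw [integral_const_mul, hy, norm_mul, Complex.norm_exp]
      gcongr
      · simp [ha]
      · exact norm_integral_le_integral_norm _
    have h2 : ∫ s in Iic x, Real.exp (-(a * x)) * ‖e s * h s‖ ≤
        ∫ s in Iic x, (Real.exp (-(2 * a * x)) * ‖e s‖ ^ 2 + ‖h s‖ ^ 2) := by
      refine integral_mono ((hint x).norm.const_mul _)
        (((he2 x).const_mul _).add hh.integrable_norm_sq.integrableOn) fun s => ?_
      have h3 : Real.exp (-(2 * a * x)) = Real.exp (-(a * x)) ^ 2 := by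
        rw [← Real.exp_nat_mul]
        congr 1
        push_cast
        ring
      simp only [norm_mul]
      rw [h3]
      nlinarith [sq_nonneg (Real.exp (-(a * x)) * ‖e s‖ - ‖h s‖),
        sq_nonneg (Real.exp (-(a * x)) * ‖e s‖), sq_nonneg ‖h s‖]
    have h4 : ∫ s in Iic x, (Real.exp (-(2 * a * x)) * ‖e s‖ ^ 2 + ‖h s‖ ^ 2) ≤
        1 / (2 * a) + N := by
      rw [integral_add ((he2 x).const_mul _) hh.integrable_norm_sq.integrableOn]
      gcongr
      · simp only [hen2]
        rw [integral_const_mul, integral_exp_mul_Iic (by positivity), ← mul_div_assoc,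
          ← Real.exp_add]
        simp
      · rw [hN]
        exact setIntegral_le_integral hh.integrable_norm_sq (.of_forall fun s => by positivity)
    exact h1.trans (h2.trans h4)
  -- integrability of the square
  have hyc := hp.continuous
  have hy2 : Integrable (fun x => ‖y x‖ ^ 2) volume := by
    -- With `a = -Re κ`, integrating `(|y|²)' ≤ -a |y|² + a⁻¹ |h|²` over `[-n, n]` and dropping
    -- `|y(n)|²` bounds `a ∫ |y|²` by `|y(-n)|² + a⁻¹ N`. The pointwise bound controls `|y(-n)|`
    -- uniformly in `n`.
    refine integrable_of_intervalIntegral_norm_bounded (l := atTop)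
      (a := fun n : ℝ => -n) (b := id) (a⁻¹ * ((1 / (2 * a) + N) ^ 2 + a⁻¹ * N))
      (fun n => ((hyc.norm.pow 2).integrableOn_Icc).mono_set Ioc_subset_Icc_self)
      tendsto_neg_atTop_atBot tendsto_id ?_
    filter_upwards [eventually_ge_atTop 0] with n hn
    have hm := hp.mul hp.conj
    have hm2 := hm.2 (-n) n
    have hre : ∫ x in (-n)..n, ((κ * y x + h x) * star (y x) + y x * star (κ * y x + h x)).re =
        ‖y n‖ ^ 2 - ‖y (-n)‖ ^ 2 := by
      have := congrArg Complex.re hm2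
      rw [← Complex.reCLM_apply (∫ x in (-n)..n, _),
        ← ContinuousLinearMap.intervalIntegral_comp_comm _ (hm.1.intervalIntegrable' _ _)] at this
      simp only [Complex.star_def, Complex.mul_conj, Complex.sub_re, Complex.ofReal_re,
        Complex.normSq_eq_norm_sq, Complex.reCLM_apply] at this ⊢
      exact this.symm
    have hle : ∫ x in (-n)..n, ((κ * y x + h x) * star (y x) + y x * star (κ * y x + h x)).re ≤
        ∫ x in (-n)..n, (-a * ‖y x‖ ^ 2 + a⁻¹ * ‖h x‖ ^ 2) := by
      have hmi := hm.1.intervalIntegrable' (-n) n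
      refine intervalIntegral.integral_mono_on (by linarith) ⟨hmi.1.re, hmi.2.re⟩ ?_ fun x _ => ?_
      · exact (((hyc.norm.pow 2).const_mul _).intervalIntegrable _ _).add
          ((hh.integrable_norm_sq.const_mul _).intervalIntegrable)
      · have e1 : ((κ * y x + h x) * star (y x) + y x * star (κ * y x + h x)).re =
            -2 * a * ‖y x‖ ^ 2 + 2 * (h x * star (y x)).re := by
          rw [← Complex.normSq_eq_norm_sq, Complex.normSq_apply, ha]
          simp
          ring
        have e2 : (h x * star (y x)).re ≤ ‖h x‖ * ‖y x‖ := by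
          simpa using Complex.re_le_norm (h x * star (y x))
        rw [e1]
        have e3 : 2 * (‖h x‖ * ‖y x‖) ≤ a * ‖y x‖ ^ 2 + a⁻¹ * ‖h x‖ ^ 2 := by
          have : a * ‖y x‖ ^ 2 + a⁻¹ * ‖h x‖ ^ 2 - 2 * (‖h x‖ * ‖y x‖) =
              a⁻¹ * (a * ‖y x‖ - ‖h x‖) ^ 2 := by
            field_simp
            ring
          nlinarith [mul_nonneg (inv_nonneg.2 ha0.le) (sq_nonneg (a * ‖y x‖ - ‖h x‖))]
        nlinarith
    have hyi : IntervalIntegrable (fun x => -a * ‖y x‖ ^ 2) volume (-n) n :=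
      ((hyc.norm.pow 2).const_mul _).intervalIntegrable _ _
    rw [hre, intervalIntegral.integral_add hyi
      ((hh.integrable_norm_sq.const_mul _).intervalIntegrable),
      intervalIntegral.integral_const_mul, intervalIntegral.integral_const_mul] at hle
    have hI : ∫ x in (-n)..n, ‖h x‖ ^ 2 ≤ N := by
      rw [intervalIntegral.integral_of_le (by linarith), hN]
      exact setIntegral_le_integral hh.integrable_norm_sq (.of_forall fun s => by positivity)
    have hb := pow_le_pow_left₀ (norm_nonneg _) (hbd (-n)) 2
    have h5 := mul_le_mul_of_nonneg_left hI (inv_nonneg.2 ha0.le)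
    simp only [norm_pow, norm_norm, id]
    rw [← div_eq_inv_mul, le_div_iff₀ ha0]
    nlinarith [sq_nonneg ‖y n‖]
  have hyL : MemLp y 2 volume :=
    (memLp_two_iff_integrable_sq_norm hyc.aestronglyMeasurable).2 hy2
  refine ⟨y, hyL, hp, ?_⟩
  have hen := hp.energy hyL hh
  -- Young's inequality with weights `a / 2` and `1 / (2 a)`: half of the left side of the energy
  -- identity is absorbed.
  have hle : ∫ x, (h x * star (y x)).re ≤ ∫ x, (a / 2 * ‖y x‖ ^ 2 + (2 * a)⁻¹ * ‖h x‖ ^ 2) := by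
    refine integral_mono (hh.integrable_mul_star hyL).re
      ((hy2.const_mul _).add (hh.integrable_norm_sq.const_mul _)) fun x => ?_
    have e2 : (h x * star (y x)).re ≤ ‖h x‖ * ‖y x‖ := by
      simpa using Complex.re_le_norm (h x * star (y x))
    have e3 : a / 2 * ‖y x‖ ^ 2 + (2 * a)⁻¹ * ‖h x‖ ^ 2 - ‖h x‖ * ‖y x‖ =
        (2 * a)⁻¹ * (a * ‖y x‖ - ‖h x‖) ^ 2 := by
      field_simp
      ring
    have e4 : 0 ≤ (2 * a)⁻¹ * (a * ‖y x‖ - ‖h x‖) ^ 2 := by positivity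
    change (h x * star (y x)).re ≤ _
    linarith
  rw [integral_add (hy2.const_mul _) (hh.integrable_norm_sq.const_mul _), integral_const_mul,
    integral_const_mul, ← hN] at hle
  have hk : κ.re = -a := by linarith
  rw [← hN, hk, neg_sq, ← div_eq_inv_mul, le_div_iff₀ (by positivity)]
  rw [hk] at hen
  have h6 : a * (a / 2 * (∫ x, ‖y x‖ ^ 2) + (2 * a)⁻¹ * N) =
      a ^ 2 / 2 * (∫ x, ‖y x‖ ^ 2) + N / 2 := by
    field_simp
  nlinarith

/-- The case `Re κ > 0` is the reflection `x ↦ -x` of the other one. -/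
theorem exists_memLp_isPrim {κ : ℂ} (hκ : κ.re ≠ 0) {h : ℝ → ℂ} (hh : MemLp h 2 volume) :
    ∃ y, MemLp y 2 volume ∧ (IsPrim y fun x => κ * y x + h x) ∧
      ∫ x, ‖y x‖ ^ 2 ≤ (κ.re ^ 2)⁻¹ * ∫ x, ‖h x‖ ^ 2 := by
  rcases lt_or_gt_of_ne hκ with hκ | hκ
  · exact exists_memLp_isPrim_of_re_neg hκ hh
  · have hm := Measure.measurePreserving_neg (volume : Measure ℝ)
    have hh' : MemLp (fun x => -h (-x)) 2 volume := (hh.comp_measurePreserving hm).neg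
    obtain ⟨y, hy, hp, hb⟩ := exists_memLp_isPrim_of_re_neg (κ := -κ) (by simpa using hκ) hh'
    refine ⟨fun x => y (-x), hy.comp_measurePreserving hm, ?_, ?_⟩
    · refine hp.comp_neg.congr_ae (.of_forall fun x => ?_)
      simp only [neg_neg]
      ring
    · rw [integral_neg_eq_self (fun x => ‖y x‖ ^ 2)]
      simp only [norm_neg, Complex.neg_re, neg_sq] at hb
      rwa [integral_neg_eq_self (fun x => ‖h x‖ ^ 2)] at hb

/-! ### The breather, the reflection `S` and its differential equations -/

theorem beta_pos {l : ℝ} (hl : 1 < l) : 0 < beta l :=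
  mul_pos two_pos (Real.sqrt_pos.2 (by nlinarith))

theorem beta_sq {l : ℝ} (hl : 1 < l) : beta l ^ 2 = 4 * (l ^ 2 - 1) := by
  rw [beta, mul_pow, Real.sq_sqrt (by nlinarith)]
  ring

/-- The denominator `λ₀ cosh β₀ x - cos α₀ t` of the breather. -/
def denom (l x t : ℝ) : ℝ := l * Real.cosh (beta l * x) - Real.cos (alpha l * t)

theorem denom_pos {l : ℝ} (hl : 1 < l) (x t : ℝ) : 0 < denom l x t := by
  have h1 := Real.one_le_cosh (beta l * x)
  have h2 := Real.cos_le_one (alpha l * t)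
  rw [denom]
  nlinarith

/-- The diagonal entry of the reflection `S` that generates the Darboux transformation. -/
def refl₁ (l x t : ℝ) : ℂ := ((beta l / 2 * Real.sinh (beta l * x) / denom l x t : ℝ) : ℂ)

/-- The off-diagonal entry of the reflection `S` that generates the Darboux transformation. -/
def refl₂ (l x t : ℝ) : ℂ :=
  ((-Real.cosh (beta l * x) + l * Real.cos (alpha l * t) : ℝ) +
    Complex.I * (beta l / 2 * Real.sin (alpha l * t) : ℝ)) / (denom l x t : ℂ)

theorem star_refl₁ (l x t : ℝ) : star (refl₁ l x t) = refl₁ l x t := Complex.conj_ofReal _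

theorem star_refl₂ (l x t : ℝ) : star (refl₂ l x t) =
    ((-Real.cosh (beta l * x) + l * Real.cos (alpha l * t) : ℝ) -
    Complex.I * (beta l / 2 * Real.sin (alpha l * t) : ℝ)) / (denom l x t : ℂ) := by
  rw [refl₂, Complex.star_def, map_div₀, map_add, map_mul, Complex.conj_ofReal,
    Complex.conj_ofReal, Complex.conj_ofReal, Complex.conj_I]
  ring

theorem denom_ne_zero {l : ℝ} (hl : 1 < l) (x t : ℝ) : (denom l x t : ℂ) ≠ 0 :=
  Complex.ofReal_ne_zero.2 (denom_pos hl x t).ne'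

/-- The Darboux form of the potential. The background changes from `-1` to `1` because `2 l * refl₂`
contains `-2 l cosh` in its numerator and therefore tends to `-2` at infinity. -/
theorem kmb_eq {l : ℝ} (hl : 1 < l) (x t : ℝ) : kmb l x t = 1 + 2 * l * refl₂ l x t := by
  have hD := denom_ne_zero hl x t
  rw [kmb, refl₂, ← denom]
  field_simp
  rw [denom]
  simp only [alpha]
  push_cast
  ring

theorem beta_sq_complex {l : ℝ} (hl : 1 < l) : (beta l : ℂ) ^ 2 = 4 * ((l : ℂ) ^ 2 - 1) := by
  exact_mod_cast congrArg Complex.ofReal (beta_sq hl)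

/-- This is `S² = 1` for `S = (refl₁, refl₂; conj refl₂, -refl₁)`. It rests on the hyperbolic and
trigonometric Pythagorean identities and on `β₀² = 4 (λ₀² - 1)`. Both the invertibility of `z - λ₀
S` and its uniform bounds come from here. -/
theorem refl_sq {l : ℝ} (hl : 1 < l) (x t : ℝ) :
    refl₁ l x t * refl₁ l x t + refl₂ l x t * star (refl₂ l x t) = 1 := by
  have hD := denom_ne_zero hl x t
  have h1 := Complex.cosh_sq_sub_sinh_sq ((beta l * x : ℝ) : ℂ)
  have h2 := Complex.sin_sq_add_cos_sq ((alpha l * t : ℝ) : ℂ)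
  have h3 := beta_sq_complex hl
  rw [star_refl₂, refl₁, refl₂]
  push_cast
  field_simp
  simp only [denom]
  push_cast at h1 h2 ⊢
  generalize Complex.cosh (beta l * x) = C at *
  generalize Complex.sinh (beta l * x) = S at *
  generalize Complex.cos (alpha l * t) = c at *
  generalize Complex.sin (alpha l * t) = σ at *
  have hI := Complex.I_sq
  grind

theorem hasDerivAt_denom_x (l x t : ℝ) :
    HasDerivAt (fun y => (denom l y t : ℂ)) (l * (beta l * Real.sinh (beta l * x)) : ℝ) x := by
  refine HasDerivAt.ofReal_comp ?_
  have := (((hasDerivAt_id x).const_mul (beta l)).cosh.const_mul l).sub_const (Real.cos (alpha l * t))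
  refine this.congr_deriv ?_
  simp only [id, mul_one]
  ring

theorem hasDerivAt_denom_t (l x t : ℝ) :
    HasDerivAt (fun s => (denom l x s : ℂ)) (alpha l * Real.sin (alpha l * t) : ℝ) t := by
  refine HasDerivAt.ofReal_comp ?_
  have := (((hasDerivAt_id t).const_mul (alpha l)).cos).const_sub (l * Real.cosh (beta l * x))
  refine this.congr_deriv ?_
  simp only [id, mul_one]
  ring

/-- The diagonal entry of `S_x = Q(û₀) S - S Q(1)`, where `Q(u) = (0, u; -ū, 0)`: the condition for
`z - λ₀ S` to intertwine the two spectral problems. -/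
theorem hasDerivAt_refl₁_x {l : ℝ} (hl : 1 < l) (x t : ℝ) :
    HasDerivAt (fun y => refl₁ l y t)
      (refl₂ l x t + star (refl₂ l x t) + 2 * l * (refl₂ l x t * star (refl₂ l x t))) x := by
  have hD := denom_ne_zero hl x t
  have h1 := Complex.cosh_sq_sub_sinh_sq ((beta l * x : ℝ) : ℂ)
  have h2 := Complex.sin_sq_add_cos_sq ((alpha l * t : ℝ) : ℂ)
  have h3 := beta_sq_complex hl
  have hn : HasDerivAt (fun y : ℝ => ((beta l / 2 * Real.sinh (beta l * y) : ℝ) : ℂ))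
      (beta l / 2 * (beta l * Real.cosh (beta l * x)) : ℝ) x := by
    refine HasDerivAt.ofReal_comp ?_
    refine (((hasDerivAt_id x).const_mul (beta l)).sinh.const_mul (beta l / 2)).congr_deriv ?_
    simp only [id, mul_one]
    ring
  have := hn.div (hasDerivAt_denom_x l x t) hD
  have e : (fun y => refl₁ l y t) =
      fun y => ((beta l / 2 * Real.sinh (beta l * y) : ℝ) : ℂ) / (denom l y t : ℂ) := by
    funext y
    rw [refl₁, Complex.ofReal_div]
  rw [e]
  refine this.congr_deriv ?_
  rw [show refl₂ l x t * star (refl₂ l x t) = 1 - refl₁ l x t * refl₁ l x t by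
    linear_combination refl_sq hl x t, star_refl₂, refl₂, refl₁]
  push_cast
  field_simp
  simp only [denom]
  push_cast at h1 h2 ⊢
  generalize Complex.cosh (beta l * x) = C at *
  generalize Complex.sinh (beta l * x) = S at *
  generalize Complex.cos (alpha l * t) = c at *
  generalize Complex.sin (alpha l * t) = σ at *
  have hI := Complex.I_sq
  grind

/-- The off-diagonal entry of `S_x = Q(û₀) S - S Q(1)`. -/
theorem hasDerivAt_refl₂_x {l : ℝ} (hl : 1 < l) (x t : ℝ) :
    HasDerivAt (fun y => refl₂ l y t) (-2 * (1 + l * refl₂ l x t) * refl₁ l x t) x := by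
  have hD := denom_ne_zero hl x t
  have hn : HasDerivAt (fun y : ℝ => ((-Real.cosh (beta l * y) + l * Real.cos (alpha l * t) : ℝ) : ℂ)
      + Complex.I * (beta l / 2 * Real.sin (alpha l * t) : ℝ))
      (-(beta l * Real.sinh (beta l * x)) : ℝ) x := by
    refine HasDerivAt.add_const _ (HasDerivAt.ofReal_comp ?_)
    refine ((((hasDerivAt_id x).const_mul (beta l)).cosh.neg).add_const _).congr_deriv ?_
    simp only [id, mul_one]
    ring
  refine (hn.div (hasDerivAt_denom_x l x t) hD).congr_deriv ?_
  rw [refl₁, refl₂]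
  push_cast
  field_simp
  ring

/-- The diagonal entry of `S_t = i λ₀ S_x S`, with the entries of `S_x` written out. -/
theorem hasDerivAt_refl₁_t {l : ℝ} (hl : 1 < l) (x t : ℝ) :
    HasDerivAt (fun s => refl₁ l x s)
      (Complex.I * l * (refl₁ l x t *
        (refl₂ l x t + star (refl₂ l x t) + 2 * l * (refl₂ l x t * star (refl₂ l x t))) +
        (-2 * (1 + l * refl₂ l x t) * refl₁ l x t) * star (refl₂ l x t))) t := by
  have hD := denom_ne_zero hl x t
  have e : (fun s => refl₁ l x s) =
      fun s => ((beta l / 2 * Real.sinh (beta l * x) : ℝ) : ℂ) / (denom l x s : ℂ) := by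
    funext y
    rw [refl₁, Complex.ofReal_div]
  rw [e]
  refine ((hasDerivAt_const t _).div (hasDerivAt_denom_t l x t) hD).congr_deriv ?_
  rw [star_refl₂, refl₁, refl₂]
  push_cast
  field_simp
  simp only [alpha]
  push_cast
  linear_combination -(2 * denom l x t * l * beta l ^ 2 * Complex.sinh (beta l * x) *
    Complex.sin (l * beta l * t)) * Complex.I_sq

/-- The off-diagonal entry of `S_t = i λ₀ S_x S`. -/
theorem hasDerivAt_refl₂_t {l : ℝ} (hl : 1 < l) (x t : ℝ) :
    HasDerivAt (fun s => refl₂ l x s)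
      (Complex.I * l * ((refl₂ l x t + star (refl₂ l x t) +
        2 * l * (refl₂ l x t * star (refl₂ l x t))) * refl₂ l x t -
        (-2 * (1 + l * refl₂ l x t) * refl₁ l x t) * refl₁ l x t)) t := by
  have hD := denom_ne_zero hl x t
  have hs := refl_sq hl x t
  have h1 := Complex.cosh_sq_sub_sinh_sq ((beta l * x : ℝ) : ℂ)
  have h2 := Complex.sin_sq_add_cos_sq ((alpha l * t : ℝ) : ℂ)
  have h3 := beta_sq_complex hl
  have hn : HasDerivAt (fun s : ℝ => ((-Real.cosh (beta l * x) + l * Real.cos (alpha l * s) : ℝ) : ℂ)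
      + Complex.I * (beta l / 2 * Real.sin (alpha l * s) : ℝ))
      ((-(l * (alpha l * Real.sin (alpha l * t))) : ℝ) +
        Complex.I * (beta l / 2 * (alpha l * Real.cos (alpha l * t)) : ℝ)) t := by
    refine HasDerivAt.add (HasDerivAt.ofReal_comp ?_) ((HasDerivAt.ofReal_comp ?_).const_mul _)
    · refine ((((hasDerivAt_id t).const_mul (alpha l)).cos.const_mul l).const_add _).congr_deriv ?_
      simp only [id, mul_one]
      ring
    · refine (((hasDerivAt_id t).const_mul (alpha l)).sin.const_mul (beta l / 2)).congr_deriv ?_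
      simp only [id, mul_one]
      ring
  refine (hn.div (hasDerivAt_denom_t l x t) hD).congr_deriv ?_
  -- eliminate `s * star s` and simplify
  have e : (refl₂ l x t + star (refl₂ l x t) + 2 * l * (refl₂ l x t * star (refl₂ l x t))) *
      refl₂ l x t - (-2 * (1 + l * refl₂ l x t) * refl₁ l x t) * refl₁ l x t =
      refl₂ l x t * (refl₂ l x t + 2 * l) + (1 + refl₁ l x t * refl₁ l x t) := by
    linear_combination (1 + 2 * l * refl₂ l x t) * hs
  rw [e, refl₁, refl₂]
  push_cast
  field_simp
  simp only [denom, alpha] at h2 ⊢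
  push_cast at h1 h2 ⊢
  generalize Complex.cosh (beta l * x) = C at *
  generalize Complex.sinh (beta l * x) = S at *
  generalize Complex.cos (l * beta l * t) = c at *
  generalize Complex.sin (l * beta l * t) = σ at *
  have hI := Complex.I_sq
  grind

/-! ### The spectral problem and the Lax system in components -/

theorem isZSSolution_iff {u : ℝ → ℂ} {z : ℂ} {φ : ℝ → Fin 2 → ℂ} :
    IsZSSolution u z φ ↔ (∀ x, HasDerivAt (fun y => φ y 0) (z * φ x 0 + u x * φ x 1) x) ∧
      ∀ x, HasDerivAt (fun y => φ y 1) (-star (u x) * φ x 0 - z * φ x 1) x := by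
  rw [← forall_and]
  refine forall_congr' fun x => ?_
  rw [hasDerivAt_pi, Fin.forall_fin_two]
  simp [laxU, Matrix.mulVec, dotProduct, Fin.sum_univ_two, sub_eq_add_neg]

theorem conj_two : (starRingEnd ℂ) 2 = 2 := map_ofNat _ 2

/-- The entries of the time evolution of the breather, in terms of those of `S`. -/
theorem laxV_kmb {l : ℝ} (hl : 1 < l) (z : ℂ) (x t : ℝ) (v : Fin 2 → ℂ) :
    laxV (kmb l x t) (deriv (fun y => kmb l y t) x) z *ᵥ v =
      ![Complex.I * ((z ^ 2 + l * (refl₂ l x t + star (refl₂ l x t) +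
          2 * l * (refl₂ l x t * star (refl₂ l x t)))) * v 0 +
          (z * (1 + 2 * l * refl₂ l x t) - 2 * l * (1 + l * refl₂ l x t) * refl₁ l x t) * v 1),
        Complex.I * ((-z * (1 + 2 * l * star (refl₂ l x t)) -
          2 * l * (1 + l * star (refl₂ l x t)) * refl₁ l x t) * v 0 -
          (z ^ 2 + l * (refl₂ l x t + star (refl₂ l x t) +
          2 * l * (refl₂ l x t * star (refl₂ l x t)))) * v 1)] := by
  have hd : deriv (fun y => kmb l y t) x =
      2 * l * (-2 * (1 + l * refl₂ l x t) * refl₁ l x t) := by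
    simp only [kmb_eq hl]
    exact (((hasDerivAt_refl₂_x hl x t).const_mul (2 * (l : ℂ))).const_add 1).deriv
  have hn : (‖kmb l x t‖ : ℂ) ^ 2 =
      (1 + 2 * l * refl₂ l x t) * (1 + 2 * l * star (refl₂ l x t)) := by
    rw [← Complex.mul_conj', kmb_eq hl]
    simp [conj_two]
  have h1 : star (refl₁ l x t) = refl₁ l x t := star_refl₁ l x t
  rw [laxV, hn, hd, kmb_eq hl]
  simp only [Complex.star_def] at *
  ext i
  fin_cases i <;>
    simp [Matrix.mulVec, dotProduct, Fin.sum_univ_two, h1, conj_two] <;> ring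

theorem isLaxSolution_kmb_iff {l : ℝ} (hl : 1 < l) {z : ℂ} {φ : ℝ → ℝ → Fin 2 → ℂ} :
    IsLaxSolution (kmb l) z φ ↔ (∀ t, IsZSSolution (fun x => kmb l x t) z fun x => φ x t) ∧
      (∀ x t, HasDerivAt (fun s => φ x s 0)
        (Complex.I * ((z ^ 2 + l * (refl₂ l x t + star (refl₂ l x t) +
          2 * l * (refl₂ l x t * star (refl₂ l x t)))) * φ x t 0 +
          (z * (1 + 2 * l * refl₂ l x t) - 2 * l * (1 + l * refl₂ l x t) * refl₁ l x t) *
            φ x t 1)) t) ∧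
      ∀ x t, HasDerivAt (fun s => φ x s 1)
        (Complex.I * ((-z * (1 + 2 * l * star (refl₂ l x t)) -
          2 * l * (1 + l * star (refl₂ l x t)) * refl₁ l x t) * φ x t 0 -
          (z ^ 2 + l * (refl₂ l x t + star (refl₂ l x t) +
          2 * l * (refl₂ l x t * star (refl₂ l x t)))) * φ x t 1)) t := by
  refine and_congr_right fun _ => ?_
  simp only [← forall_and]
  refine forall_congr' fun x => forall_congr' fun t => ?_
  rw [hasDerivAt_pi, Fin.forall_fin_two, laxV_kmb hl]
  rfl

/-! ### Solutions for the constant potential -/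

/-- `cosh (k ξ)`. -/
def seedCosh (k ξ : ℂ) : ℂ := Complex.cosh (k * ξ)

/-- `sinh (k ξ) / k`, continued by `ξ` to `k = 0`. -/
def seedSinh (k ξ : ℂ) : ℂ := if k = 0 then ξ else Complex.sinh (k * ξ) / k

theorem hasDerivAt_seedCosh (k ξ : ℂ) :
    HasDerivAt (seedCosh k) (k ^ 2 * seedSinh k ξ) ξ := by
  refine ((hasDerivAt_id ξ).const_mul k).ccosh.congr_deriv ?_
  by_cases hk : k = 0
  · simp [hk]
  · simp only [seedSinh, hk, if_false, id]
    field_simp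

theorem hasDerivAt_seedSinh (k ξ : ℂ) : HasDerivAt (seedSinh k) (seedCosh k ξ) ξ := by
  by_cases hk : k = 0
  · simp only [seedCosh, hk, zero_mul, Complex.cosh_zero]
    have : seedSinh 0 = fun ξ => ξ := by
      funext ξ
      simp [seedSinh]
    rw [this]
    exact hasDerivAt_id ξ
  · have : seedSinh k = fun ξ => Complex.sinh (k * ξ) / k := by
      funext ξ
      simp [seedSinh, hk]
    rw [this]
    refine (((hasDerivAt_id ξ).const_mul k).csinh.div_const k).congr_deriv ?_
    simp only [seedCosh, id]
    field_simp

/-- The determinant of `exp(ξ U) = cosh(kξ) + (sinh(kξ) / k) U`, in a form that includes `k = 0`; it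
makes `seedInit` inverse to `seedSol`. -/
theorem seedCosh_sq_sub (k ξ : ℂ) : seedCosh k ξ ^ 2 - k ^ 2 * seedSinh k ξ ^ 2 = 1 := by
  by_cases hk : k = 0
  · simp [hk, seedCosh]
  · have := Complex.cosh_sq_sub_sinh_sq (k * ξ)
    simp only [seedSinh, seedCosh, hk, if_false]
    field_simp
    exact this

/-- The variable `ξ = x + i z t` of the solutions for the constant potential. -/
def seedVar (z : ℂ) (x t : ℝ) : ℂ := x + Complex.I * z * t

theorem hasDerivAt_seedVar_x (z : ℂ) (x t : ℝ) : HasDerivAt (fun y => seedVar z y t) 1 x :=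
  (Complex.ofRealCLM.hasDerivAt (x := x)).add_const _

theorem hasDerivAt_seedVar_t (z : ℂ) (x t : ℝ) :
    HasDerivAt (fun s => seedVar z x s) (Complex.I * z) t := by
  refine (((Complex.ofRealCLM.hasDerivAt (x := t)).const_mul (Complex.I * z)).const_add
    (x : ℂ)).congr_deriv ?_
  simp

/-! ### The Darboux transformation -/

/-- The Darboux transformation `z - λ₀ S`. -/
def dress (l : ℝ) (z : ℂ) (x t : ℝ) (v : Fin 2 → ℂ) : Fin 2 → ℂ :=
  ![(z - l * refl₁ l x t) * v 0 - l * refl₂ l x t * v 1,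
    -l * star (refl₂ l x t) * v 0 + (z + l * refl₁ l x t) * v 1]

/-- The inverse `(z + λ₀ S) / (z² - λ₀²)` of the Darboux transformation. -/
def undress (l : ℝ) (z : ℂ) (x t : ℝ) (v : Fin 2 → ℂ) : Fin 2 → ℂ :=
  ![(z ^ 2 - l ^ 2)⁻¹ * ((z + l * refl₁ l x t) * v 0 + l * refl₂ l x t * v 1),
    (z ^ 2 - l ^ 2)⁻¹ * (l * star (refl₂ l x t) * v 0 + (z - l * refl₁ l x t) * v 1)]

/-- Since `S² = 1`, `(z - λ₀ S)(z + λ₀ S) = z² - λ₀²`. -/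
theorem dress_undress {l : ℝ} (hl : 1 < l) {z : ℂ} (hz : z ^ 2 - l ^ 2 ≠ 0) (x t : ℝ)
    (v : Fin 2 → ℂ) : dress l z x t (undress l z x t v) = v := by
  have h := refl_sq hl x t
  rw [Complex.star_def] at h
  ext i
  fin_cases i <;> simp [dress, undress] <;> field_simp
  · linear_combination (-(l : ℂ) ^ 2 * v 0) * h
  · linear_combination (-(l : ℂ) ^ 2 * v 1) * h

theorem undress_dress {l : ℝ} (hl : 1 < l) {z : ℂ} (hz : z ^ 2 - l ^ 2 ≠ 0) (x t : ℝ)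
    (v : Fin 2 → ℂ) : undress l z x t (dress l z x t v) = v := by
  have h := refl_sq hl x t
  rw [Complex.star_def] at h
  ext i
  fin_cases i <;> simp [dress, undress] <;> field_simp
  · linear_combination (-(l : ℂ) ^ 2 * v 0) * h
  · linear_combination (-(l : ℂ) ^ 2 * v 1) * h

theorem hasDerivAt_star_refl₂_x {l : ℝ} (hl : 1 < l) (x t : ℝ) :
    HasDerivAt (fun y => star (refl₂ l y t))
      (-2 * (1 + l * star (refl₂ l x t)) * refl₁ l x t) x := by
  refine (hasDerivAt_refl₂_x hl x t).star.congr_deriv ?_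
  have h1 := star_refl₁ l x t
  simp only [Complex.star_def] at *
  simp [h1, conj_two]

theorem hasDerivAt_star_refl₂_t {l : ℝ} (hl : 1 < l) (x t : ℝ) :
    HasDerivAt (fun s => star (refl₂ l x s))
      (-(Complex.I * l * ((refl₂ l x t + star (refl₂ l x t) +
        2 * l * (refl₂ l x t * star (refl₂ l x t))) * star (refl₂ l x t) -
        (-2 * (1 + l * star (refl₂ l x t)) * refl₁ l x t) * refl₁ l x t))) t := by
  refine (hasDerivAt_refl₂_t hl x t).star.congr_deriv ?_
  have h1 := star_refl₁ l x t
  simp only [Complex.star_def] at *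
  simp only [map_mul, map_sub, map_add, map_one, map_neg, h1, conj_two, Complex.conj_conj,
    Complex.conj_I, Complex.conj_ofReal]
  ring

/-- The Darboux transformation maps solutions for the potential `1` to solutions for the
breather. -/
theorem hasDerivAt_dress_x {l : ℝ} (hl : 1 < l) {z : ℂ} {A B : ℝ → ℂ} {x t : ℝ} {a b : ℂ}
    (hA : HasDerivAt A (z * A x + B x + a) x) (hB : HasDerivAt B (-A x - z * B x + b) x) :
    HasDerivAt (fun y => dress l z y t ![A y, B y] 0)
      (z * dress l z x t ![A x, B x] 0 + kmb l x t * dress l z x t ![A x, B x] 1 +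
        dress l z x t ![a, b] 0) x ∧
    HasDerivAt (fun y => dress l z y t ![A y, B y] 1)
      (-star (kmb l x t) * dress l z x t ![A x, B x] 0 - z * dress l z x t ![A x, B x] 1 +
        dress l z x t ![a, b] 1) x := by
  have h1 := hasDerivAt_refl₁_x hl x t
  have h2 := hasDerivAt_refl₂_x hl x t
  have h3 := hasDerivAt_star_refl₂_x hl x t
  have hs := refl_sq hl x t
  constructor
  · refine (((h1.const_mul (l : ℂ)).const_sub z |>.mul hA).sub
      ((h2.const_mul (l : ℂ)).mul hB)).congr_deriv ?_
    simp only [dress, kmb_eq hl, Matrix.cons_val_zero, Matrix.cons_val_one]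
    ring
  · refine (((h3.const_mul (-l : ℂ)).mul hA).add
      ((h1.const_mul (l : ℂ)).const_add z |>.mul hB)).congr_deriv ?_
    simp only [dress, kmb_eq hl, Matrix.cons_val_zero, Matrix.cons_val_one, star_add, star_mul',
      star_one, Complex.star_def, Complex.conj_ofReal, conj_two]
    ring

/-- For the constant potential `V = i z U`, so the hypotheses are the seed's time equations. The
intertwining of the time flows follows from `S_t = i λ₀ S_x S` and `S² = 1`. -/
theorem hasDerivAt_dress_t {l : ℝ} (hl : 1 < l) {z : ℂ} {A B : ℝ → ℂ} {x t : ℝ}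
    (hA : HasDerivAt A (Complex.I * z * (z * A t + B t)) t)
    (hB : HasDerivAt B (Complex.I * z * (-A t - z * B t)) t) :
    HasDerivAt (fun s => dress l z x s ![A s, B s])
      (laxV (kmb l x t) (deriv (fun y => kmb l y t) x) z *ᵥ dress l z x t ![A t, B t]) t := by
  have h1 := hasDerivAt_refl₁_t hl x t
  have h2 := hasDerivAt_refl₂_t hl x t
  have h3 := hasDerivAt_star_refl₂_t hl x t
  have hs := refl_sq hl x t
  rw [laxV_kmb hl, hasDerivAt_pi, Fin.forall_fin_two]
  constructor
  · refine (((h1.const_mul (l : ℂ)).const_sub z |>.mul hA).sub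
      ((h2.const_mul (l : ℂ)).mul hB)).congr_deriv ?_
    simp only [dress, Matrix.cons_val_zero, Matrix.cons_val_one]
    generalize refl₁ l x t = r at *
    generalize star (refl₂ l x t) = sb at *
    generalize refl₂ l x t = s at *
    grind
  · refine (((h3.const_mul (-l : ℂ)).mul hA).add
      ((h1.const_mul (l : ℂ)).const_add z |>.mul hB)).congr_deriv ?_
    simp only [dress, Matrix.cons_val_zero, Matrix.cons_val_one]
    generalize refl₁ l x t = r at *
    generalize star (refl₂ l x t) = sb at *
    generalize refl₂ l x t = s at *
    grind

/-- The inverse Darboux transformation maps solutions for the breather to solutions for the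
potential `1`. -/
theorem hasDerivAt_undress_x {l : ℝ} (hl : 1 < l) {z : ℂ} {φ : ℝ → Fin 2 → ℂ} {x t : ℝ}
    (h0 : HasDerivAt (fun y => φ y 0) (z * φ x 0 + kmb l x t * φ x 1) x)
    (h1 : HasDerivAt (fun y => φ y 1) (-star (kmb l x t) * φ x 0 - z * φ x 1) x) :
    HasDerivAt (fun y => undress l z y t (φ y) 0)
      (z * undress l z x t (φ x) 0 + undress l z x t (φ x) 1) x ∧
    HasDerivAt (fun y => undress l z y t (φ y) 1)
      (-undress l z x t (φ x) 0 - z * undress l z x t (φ x) 1) x := by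
  have d1 := hasDerivAt_refl₁_x hl x t
  have d2 := hasDerivAt_refl₂_x hl x t
  have d3 := hasDerivAt_star_refl₂_x hl x t
  have hs := refl_sq hl x t
  have hu : star (kmb l x t) = 1 + 2 * l * star (refl₂ l x t) := by
    rw [kmb_eq hl]
    simp
  rw [hu] at h1
  rw [kmb_eq hl] at h0
  constructor
  · refine ((((d1.const_mul (l : ℂ)).const_add z |>.mul h0).add
      ((d2.const_mul (l : ℂ)).mul h1)).const_mul _).congr_deriv ?_
    simp only [undress, Matrix.cons_val_zero, Matrix.cons_val_one]
    generalize ((z ^ 2 - l ^ 2)⁻¹ : ℂ) = w at *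
    generalize refl₁ l x t = r at *
    generalize star (refl₂ l x t) = sb at *
    generalize refl₂ l x t = s at *
    grind
  · refine ((((d3.const_mul (l : ℂ)).mul h0).add
      ((d1.const_mul (l : ℂ)).const_sub z |>.mul h1)).const_mul _).congr_deriv ?_
    simp only [undress, Matrix.cons_val_zero, Matrix.cons_val_one]
    generalize ((z ^ 2 - l ^ 2)⁻¹ : ℂ) = w at *
    generalize refl₁ l x t = r at *
    generalize star (refl₂ l x t) = sb at *
    generalize refl₂ l x t = s at *
    grind

theorem hasDerivAt_undress_t {l : ℝ} (hl : 1 < l) {z : ℂ} {φ : ℝ → Fin 2 → ℂ} {x t : ℝ}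
    (h : HasDerivAt φ (laxV (kmb l x t) (deriv (fun y => kmb l y t) x) z *ᵥ φ t) t) :
    HasDerivAt (fun s => undress l z x s (φ s) 0)
      (Complex.I * z * (z * undress l z x t (φ t) 0 + undress l z x t (φ t) 1)) t ∧
    HasDerivAt (fun s => undress l z x s (φ s) 1)
      (Complex.I * z * (-undress l z x t (φ t) 0 - z * undress l z x t (φ t) 1)) t := by
  have d1 := hasDerivAt_refl₁_t hl x t
  have d2 := hasDerivAt_refl₂_t hl x t
  have d3 := hasDerivAt_star_refl₂_t hl x t
  have hs := refl_sq hl x t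
  rw [laxV_kmb hl, hasDerivAt_pi, Fin.forall_fin_two] at h
  obtain ⟨h0, h1⟩ := h
  simp only [Matrix.cons_val_zero, Matrix.cons_val_one] at h0 h1
  constructor
  · refine ((((d1.const_mul (l : ℂ)).const_add z |>.mul h0).add
      ((d2.const_mul (l : ℂ)).mul h1)).const_mul _).congr_deriv ?_
    simp only [undress, Matrix.cons_val_zero, Matrix.cons_val_one]
    generalize ((z ^ 2 - l ^ 2)⁻¹ : ℂ) = w at *
    generalize refl₁ l x t = r at *
    generalize star (refl₂ l x t) = sb at *
    generalize refl₂ l x t = s at *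
    grind
  · refine ((((d3.const_mul (l : ℂ)).mul h0).add
      ((d1.const_mul (l : ℂ)).const_sub z |>.mul h1)).const_mul _).congr_deriv ?_
    simp only [undress, Matrix.cons_val_zero, Matrix.cons_val_one]
    generalize ((z ^ 2 - l ^ 2)⁻¹ : ℂ) = w at *
    generalize refl₁ l x t = r at *
    generalize star (refl₂ l x t) = sb at *
    generalize refl₂ l x t = s at *
    grind

/-! ### Parametrization of all solutions by dressed seed solutions -/

/-- The solution for the constant potential `1` with the value `v` at `ξ = 0`, if `k² = z² - 1`. -/
def seedSol (z k : ℂ) (x t : ℝ) (v : Fin 2 → ℂ) : Fin 2 → ℂ :=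
  ![seedCosh k (seedVar z x t) * v 0 + seedSinh k (seedVar z x t) * (z * v 0 + v 1),
    seedCosh k (seedVar z x t) * v 1 - seedSinh k (seedVar z x t) * (v 0 + z * v 1)]

/-- The inverse of `seedSol`. -/
def seedInit (z k : ℂ) (x t : ℝ) (w : Fin 2 → ℂ) : Fin 2 → ℂ :=
  ![seedCosh k (seedVar z x t) * w 0 - seedSinh k (seedVar z x t) * (z * w 0 + w 1),
    seedCosh k (seedVar z x t) * w 1 + seedSinh k (seedVar z x t) * (w 0 + z * w 1)]

theorem seedSol_seedInit {z k : ℂ} (hk : k ^ 2 = z ^ 2 - 1) (x t : ℝ) (w : Fin 2 → ℂ) :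
    seedSol z k x t (seedInit z k x t w) = w := by
  have h := seedCosh_sq_sub k (seedVar z x t)
  ext i
  fin_cases i <;> simp [seedSol, seedInit] <;> grind

theorem seedInit_seedSol {z k : ℂ} (hk : k ^ 2 = z ^ 2 - 1) (x t : ℝ) (w : Fin 2 → ℂ) :
    seedInit z k x t (seedSol z k x t w) = w := by
  have h := seedCosh_sq_sub k (seedVar z x t)
  ext i
  fin_cases i <;> simp [seedSol, seedInit] <;> grind

theorem hasDerivAt_seedCosh_comp {k : ℂ} {f : ℝ → ℂ} {f' : ℂ} {x : ℝ} (hf : HasDerivAt f f' x) :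
    HasDerivAt (fun y => seedCosh k (f y)) (k ^ 2 * seedSinh k (f x) * f') x :=
  (hasDerivAt_seedCosh k (f x)).comp x hf

theorem hasDerivAt_seedSinh_comp {k : ℂ} {f : ℝ → ℂ} {f' : ℂ} {x : ℝ} (hf : HasDerivAt f f' x) :
    HasDerivAt (fun y => seedSinh k (f y)) (seedCosh k (f x) * f') x :=
  (hasDerivAt_seedSinh k (f x)).comp x hf

/-- The dressed solutions. -/
def dressedSol (l : ℝ) (z k : ℂ) : (Fin 2 → ℂ) →ₗ[ℂ] (ℝ → ℝ → Fin 2 → ℂ) where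
  toFun v x t := dress l z x t (seedSol z k x t v)
  map_add' v w := by
    funext x t i
    fin_cases i <;> simp [dress, seedSol] <;> ring
  map_smul' c v := by
    funext x t i
    fin_cases i <;> simp [dress, seedSol] <;> ring

theorem isLaxSolution_dressedSol {l : ℝ} (hl : 1 < l) {z k : ℂ} (hk : k ^ 2 = z ^ 2 - 1)
    (v : Fin 2 → ℂ) : IsLaxSolution (kmb l) z (dressedSol l z k v) := by
  constructor
  · intro t
    rw [isZSSolution_iff, ← forall_and]
    intro x
    have hc := hasDerivAt_seedCosh_comp (k := k) (hasDerivAt_seedVar_x z x t)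
    have hs := hasDerivAt_seedSinh_comp (k := k) (hasDerivAt_seedVar_x z x t)
    have := hasDerivAt_dress_x hl (a := 0) (b := 0) (z := z) (x := x) (t := t)
      (((hc.mul_const (v 0)).add (hs.mul_const (z * v 0 + v 1))).congr_deriv (by
        simp only [Pi.add_apply, Pi.sub_apply]; grind))
      (((hc.mul_const (v 1)).sub (hs.mul_const (v 0 + z * v 1))).congr_deriv (by
        simp only [Pi.add_apply, Pi.sub_apply]; grind))
    have e : ∀ i, dress l z x t ![(0 : ℂ), 0] i = 0 := fun i => by
      fin_cases i <;> simp [dress]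
    simp only [e, add_zero] at this
    exact this
  · intro x t
    have hc := hasDerivAt_seedCosh_comp (k := k) (hasDerivAt_seedVar_t z x t)
    have hs := hasDerivAt_seedSinh_comp (k := k) (hasDerivAt_seedVar_t z x t)
    exact hasDerivAt_dress_t hl (z := z) (x := x) (t := t)
      (((hc.mul_const (v 0)).add (hs.mul_const (z * v 0 + v 1))).congr_deriv (by grind))
      (((hc.mul_const (v 1)).sub (hs.mul_const (v 0 + z * v 1))).congr_deriv (by grind))

/-- Variation of constants: `exp(-ξ U)` applied to a solution of `v' = ξ' U v` is constant. One
statement serves both flows, with `ξ' = 1` in `x` and `ξ' = i z` in `t`. -/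
theorem hasDerivAt_seedInit {z k : ℂ} (hk : k ^ 2 = z ^ 2 - 1) {ξ : ℝ → ℂ} {A B : ℝ → ℂ} {x : ℝ}
    {ξ' : ℂ} (hξ : HasDerivAt ξ ξ' x) (hA : HasDerivAt A (ξ' * (z * A x + B x)) x)
    (hB : HasDerivAt B (ξ' * (-A x - z * B x)) x) :
    HasDerivAt (fun y => (![seedCosh k (ξ y) * A y - seedSinh k (ξ y) * (z * A y + B y),
      seedCosh k (ξ y) * B y + seedSinh k (ξ y) * (A y + z * B y)] : Fin 2 → ℂ)) 0 x := by
  have hc := hasDerivAt_seedCosh_comp (k := k) hξ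
  have hs := hasDerivAt_seedSinh_comp (k := k) hξ
  rw [hasDerivAt_pi, Fin.forall_fin_two]
  constructor
  · refine ((hc.mul hA).sub (hs.mul ((hA.const_mul z).add hB))).congr_deriv ?_
    simp only [Pi.add_apply, Pi.zero_apply]
    grind
  · refine ((hc.mul hB).add (hs.mul (hA.add (hB.const_mul z)))).congr_deriv ?_
    simp only [Pi.add_apply, Pi.zero_apply]
    grind

theorem eq_of_hasDerivAt_zero {f : ℝ → Fin 2 → ℂ} (h : ∀ x, HasDerivAt f 0 x) (x y : ℝ) :
    f x = f y :=
  is_const_of_deriv_eq_zero (fun x => (h x).differentiableAt) (fun x => (h x).deriv) x y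

theorem seedInit_undress_const_x {l : ℝ} (hl : 1 < l) {z k : ℂ} (hk : k ^ 2 = z ^ 2 - 1)
    {φ : ℝ → Fin 2 → ℂ} {t : ℝ} (h : IsZSSolution (fun x => kmb l x t) z φ) (x : ℝ) :
    seedInit z k x t (undress l z x t (φ x)) = seedInit z k 0 t (undress l z 0 t (φ 0)) := by
  rw [isZSSolution_iff] at h
  refine eq_of_hasDerivAt_zero
    (f := fun x => seedInit z k x t (undress l z x t (φ x))) (fun y => ?_) x 0
  have hu := hasDerivAt_undress_x hl (z := z) (h.1 y) (h.2 y)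
  exact hasDerivAt_seedInit hk (hasDerivAt_seedVar_x z y t) (by simpa using hu.1)
    (by simpa using hu.2)

theorem seedInit_undress_const_t {l : ℝ} (hl : 1 < l) {z k : ℂ} (hk : k ^ 2 = z ^ 2 - 1)
    {φ : ℝ → Fin 2 → ℂ} {x : ℝ}
    (h : ∀ t, HasDerivAt φ (laxV (kmb l x t) (deriv (fun y => kmb l y t) x) z *ᵥ φ t) t) (t : ℝ) :
    seedInit z k x t (undress l z x t (φ t)) = seedInit z k x 0 (undress l z x 0 (φ 0)) := by
  refine eq_of_hasDerivAt_zero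
    (f := fun t => seedInit z k x t (undress l z x t (φ t))) (fun y => ?_) t 0
  have hu := hasDerivAt_undress_t hl (z := z) (h y)
  exact hasDerivAt_seedInit hk (hasDerivAt_seedVar_t z x y) hu.1 hu.2

/-- Undressing gives a solution for the potential `1`, and undoing the propagator `exp(ξ U)` leaves
a constant vector, which is the required `v`. -/
theorem IsZSSolution.exists_eq_dressedSol {l : ℝ} (hl : 1 < l) {z k : ℂ}
    (hk : k ^ 2 = z ^ 2 - 1) (hz : z ^ 2 - l ^ 2 ≠ 0) {φ : ℝ → Fin 2 → ℂ} {t : ℝ}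
    (h : IsZSSolution (fun x => kmb l x t) z φ) :
    ∃ v, φ = fun x => dressedSol l z k v x t := by
  refine ⟨seedInit z k 0 t (undress l z 0 t (φ 0)), funext fun x => ?_⟩
  change φ x = dress l z x t (seedSol z k x t _)
  rw [← seedInit_undress_const_x hl hk h x, seedSol_seedInit hk, dress_undress hl hz]

theorem IsLaxSolution.exists_eq_dressedSol {l : ℝ} (hl : 1 < l) {z k : ℂ}
    (hk : k ^ 2 = z ^ 2 - 1) (hz : z ^ 2 - l ^ 2 ≠ 0) {φ : ℝ → ℝ → Fin 2 → ℂ}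
    (h : IsLaxSolution (kmb l) z φ) : ∃ v, φ = dressedSol l z k v := by
  refine ⟨seedInit z k 0 0 (undress l z 0 0 (φ 0 0)), funext fun x => funext fun t => ?_⟩
  change φ x t = dress l z x t (seedSol z k x t _)
  -- The constant vector is carried from `(0, 0)` to `(x, 0)` by the space flow and then to `(x, t)`
  -- by the time flow.
  rw [← seedInit_undress_const_x hl hk (h.1 0) x, ← seedInit_undress_const_t hl hk (h.2 x) t,
    seedSol_seedInit hk, dress_undress hl hz]

theorem dressedSol_injective {l : ℝ} (hl : 1 < l) {z k : ℂ} (hk : k ^ 2 = z ^ 2 - 1)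
    (hz : z ^ 2 - l ^ 2 ≠ 0) (t : ℝ) {v w : Fin 2 → ℂ}
    (h : dressedSol l z k v 0 t = dressedSol l z k w 0 t) : v = w := by
  have h1 := congrArg (fun u => seedInit z k 0 t (undress l z 0 t u)) h
  simpa only [dressedSol, LinearMap.coe_mk, AddHom.coe_mk, undress_dress hl hz,
    seedInit_seedSol hk] using h1

/-! ### Bounded solutions -/

theorem norm_refl_sq {l : ℝ} (hl : 1 < l) (x t : ℝ) :
    ‖refl₁ l x t‖ ^ 2 + ‖refl₂ l x t‖ ^ 2 = 1 := by
  have h := refl_sq hl x t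
  nth_rw 2 [← star_refl₁] at h
  rw [Complex.star_def, Complex.mul_conj', Complex.mul_conj'] at h
  exact_mod_cast h

theorem norm_refl₁_le {l : ℝ} (hl : 1 < l) (x t : ℝ) : ‖refl₁ l x t‖ ≤ 1 := by
  nlinarith [norm_refl_sq hl x t, sq_nonneg ‖refl₂ l x t‖, norm_nonneg (refl₁ l x t)]

theorem norm_refl₂_le {l : ℝ} (hl : 1 < l) (x t : ℝ) : ‖refl₂ l x t‖ ≤ 1 := by
  nlinarith [norm_refl_sq hl x t, sq_nonneg ‖refl₁ l x t‖, norm_nonneg (refl₂ l x t)]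

theorem norm_dress_entry_le {l : ℝ} (hl : 1 < l) (z : ℂ) (x t : ℝ) (a b : ℂ) :
    ‖(z - l * refl₁ l x t) * a - l * refl₂ l x t * b‖ ≤ (‖z‖ + l) * ‖a‖ + l * ‖b‖ := by
  have h1 := norm_refl₁_le hl x t
  have h2 := norm_refl₂_le hl x t
  have hl' : ‖(l : ℂ)‖ = l := by
    rw [Complex.norm_real, Real.norm_of_nonneg (by linarith)]
  calc _ ≤ (‖z‖ + ‖(l : ℂ)‖ * ‖refl₁ l x t‖) * ‖a‖ + ‖(l : ℂ)‖ * ‖refl₂ l x t‖ * ‖b‖ := by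
        refine (norm_sub_le _ _).trans ?_
        rw [norm_mul, norm_mul, norm_mul]
        gcongr
        exact (norm_sub_le _ _).trans (by rw [norm_mul])
    _ ≤ (‖z‖ + l * 1) * ‖a‖ + l * 1 * ‖b‖ := by
        rw [hl']
        gcongr
    _ = _ := by ring

theorem norm_dress_entry_le' {l : ℝ} (hl : 1 < l) (z : ℂ) (x t : ℝ) (a b : ℂ) :
    ‖-l * star (refl₂ l x t) * a + (z + l * refl₁ l x t) * b‖ ≤ (‖z‖ + l) * ‖b‖ + l * ‖a‖ := by
  have h1 := norm_refl₁_le hl x t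
  have h2 := norm_refl₂_le hl x t
  have hl' : ‖(l : ℂ)‖ = l := by
    rw [Complex.norm_real, Real.norm_of_nonneg (by linarith)]
  calc _ ≤ ‖(l : ℂ)‖ * ‖refl₂ l x t‖ * ‖a‖ + (‖z‖ + ‖(l : ℂ)‖ * ‖refl₁ l x t‖) * ‖b‖ := by
        refine (norm_add_le _ _).trans ?_
        rw [norm_mul, norm_mul, norm_mul, norm_neg, norm_star]
        gcongr
        exact (norm_add_le _ _).trans (by rw [norm_mul])
    _ ≤ l * 1 * ‖a‖ + (‖z‖ + l * 1) * ‖b‖ := by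
        rw [hl']
        gcongr
    _ = _ := by ring

theorem norm_dress_le {l : ℝ} (hl : 1 < l) (z : ℂ) (x t : ℝ) (v : Fin 2 → ℂ) :
    ‖dress l z x t v‖ ≤ (‖z‖ + 2 * l) * ‖v‖ := by
  have h0 := norm_le_pi_norm v 0
  have h1 := norm_le_pi_norm v 1
  have hz := norm_nonneg z
  refine (pi_norm_le_iff_of_nonneg (by positivity)).2 fun i => ?_
  fin_cases i
  · refine (norm_dress_entry_le hl z x t (v 0) (v 1)).trans ?_
    nlinarith
  · refine (norm_dress_entry_le' hl z x t (v 0) (v 1)).trans ?_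
    nlinarith

theorem norm_undress_le {l : ℝ} (hl : 1 < l) (z : ℂ) (x t : ℝ) (v : Fin 2 → ℂ) :
    ‖undress l z x t v‖ ≤ ‖(z ^ 2 - l ^ 2)⁻¹‖ * ((‖z‖ + 2 * l) * ‖v‖) := by
  have e : undress l z x t v = (-(z ^ 2 - l ^ 2)⁻¹) • dress l (-z) x t v := by
    ext i
    fin_cases i <;> simp [undress, dress] <;> ring
  rw [e, norm_smul, norm_neg]
  have := norm_dress_le hl (-z) x t v
  rw [norm_neg] at this
  gcongr

/-- The dressed solutions at a fixed time. -/
def dressedSolAt (l : ℝ) (z k : ℂ) (t : ℝ) : (Fin 2 → ℂ) →ₗ[ℂ] (ℝ → Fin 2 → ℂ) where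
  toFun v x := dressedSol l z k v x t
  map_add' v w := by
    rw [map_add]
    rfl
  map_smul' c v := by
    rw [map_smul]
    rfl

/-- Both `z - λ₀ S` and its inverse are bounded uniformly in `x`. -/
theorem bounded_dressedSol_iff {l : ℝ} (hl : 1 < l) {z k : ℂ} (hz : z ^ 2 - l ^ 2 ≠ 0) (t : ℝ)
    (v : Fin 2 → ℂ) : (∃ C : ℝ, ∀ x, ‖dressedSol l z k v x t‖ ≤ C) ↔
      ∃ C : ℝ, ∀ x, ‖seedSol z k x t v‖ ≤ C := by
  constructor
  · rintro ⟨C, hC⟩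
    refine ⟨‖(z ^ 2 - l ^ 2 : ℂ)⁻¹‖ * ((‖z‖ + 2 * l) * C), fun x => ?_⟩
    rw [← undress_dress hl hz x t (seedSol z k x t v)]
    refine (norm_undress_le hl z x t _).trans ?_
    gcongr
    exact hC x
  · rintro ⟨C, hC⟩
    refine ⟨(‖z‖ + 2 * l) * C, fun x => (norm_dress_le hl z x t _).trans ?_⟩
    gcongr
    exact hC x

theorem boundedZSSolutions_eq_map {l : ℝ} (hl : 1 < l) {z k : ℂ} (hk : k ^ 2 = z ^ 2 - 1)
    (hz : z ^ 2 - l ^ 2 ≠ 0) (t : ℝ) {W : Submodule ℂ (Fin 2 → ℂ)}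
    (hW : ∀ v, v ∈ W ↔ ∃ C : ℝ, ∀ x, ‖seedSol z k x t v‖ ≤ C) :
    boundedZSSolutions (fun x => kmb l x t) z = W.map (dressedSolAt l z k t) := by
  ext φ
  rw [Submodule.mem_map]
  constructor
  · rintro ⟨h, hb⟩
    obtain ⟨v, rfl⟩ := h.exists_eq_dressedSol hl hk hz
    exact ⟨v, (hW v).2 ((bounded_dressedSol_iff hl hz t v).1 hb), rfl⟩
  · rintro ⟨v, hv, rfl⟩
    exact ⟨(isLaxSolution_dressedSol hl hk v).1 t,
      (bounded_dressedSol_iff hl hz t v).2 ((hW v).1 hv)⟩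

theorem boundedLaxSolutions_eq_map {l : ℝ} (hl : 1 < l) {z k : ℂ} (hk : k ^ 2 = z ^ 2 - 1)
    (hz : z ^ 2 - l ^ 2 ≠ 0) {W : Submodule ℂ (Fin 2 → ℂ)}
    (hW : ∀ t v, v ∈ W ↔ ∃ C : ℝ, ∀ x, ‖seedSol z k x t v‖ ≤ C) :
    boundedLaxSolutions (kmb l) z = W.map (dressedSol l z k) := by
  ext φ
  rw [Submodule.mem_map]
  constructor
  · rintro ⟨h, hb⟩
    obtain ⟨v, rfl⟩ := h.exists_eq_dressedSol hl hk hz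
    exact ⟨v, (hW 0 v).2 ((bounded_dressedSol_iff hl hz 0 v).1 (hb 0)), rfl⟩
  · rintro ⟨v, hv, rfl⟩
    exact ⟨isLaxSolution_dressedSol hl hk v, fun t =>
      (bounded_dressedSol_iff hl hz t v).2 ((hW t v).1 hv)⟩

/-- Counting bounded solutions for the breather becomes counting the vectors `v` for which the seed
solution is bounded. The same `W` must serve every `t`, so that the Lax system and the spectral
problem at each time have equal counts. -/
theorem finrank_bounded {l : ℝ} (hl : 1 < l) {z k : ℂ} (hk : k ^ 2 = z ^ 2 - 1)
    (hz : z ^ 2 - l ^ 2 ≠ 0) {W : Submodule ℂ (Fin 2 → ℂ)}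
    (hW : ∀ t v, v ∈ W ↔ ∃ C : ℝ, ∀ x, ‖seedSol z k x t v‖ ≤ C) :
    Module.finrank ℂ (boundedLaxSolutions (kmb l) z) = Module.finrank ℂ W ∧
      ∀ t : ℝ, Module.finrank ℂ (boundedZSSolutions (fun x => kmb l x t) z) =
        Module.finrank ℂ W := by
  constructor
  · rw [boundedLaxSolutions_eq_map hl hk hz hW]
    refine (Submodule.equivMapOfInjective _ (fun v w h => ?_) W).finrank_eq.symm
    exact dressedSol_injective hl hk hz 0 (congrFun (congrFun h 0) 0)
  · intro t
    rw [boundedZSSolutions_eq_map hl hk hz t (hW t)]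
    refine (Submodule.equivMapOfInjective _ (fun v w h => ?_) W).finrank_eq.symm
    exact dressedSol_injective hl hk hz t (congrFun h 0)

theorem bounded_seedSol_of_re_eq_zero {z k : ℂ} (hk : k.re = 0) (hk0 : k ≠ 0) (t : ℝ)
    (v : Fin 2 → ℂ) : ∃ C : ℝ, ∀ x, ‖seedSol z k x t v‖ ≤ C := by
  obtain ⟨M, hM⟩ : ∃ M : ℝ, ∀ x, ‖Complex.exp (k * seedVar z x t)‖ ≤ M ∧
      ‖Complex.exp (-(k * seedVar z x t))‖ ≤ M := by
    -- As `k` is imaginary, `k x` contributes only a phase and the modulus of `exp(± k ξ)` does not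
    -- depend on `x`.
    refine ⟨Real.exp |(k * (Complex.I * z * t)).re|, fun x => ?_⟩
    have e : (k * seedVar z x t).re = (k * (Complex.I * z * t)).re := by
      rw [seedVar, mul_add, Complex.add_re]
      simp [hk]
    rw [Complex.norm_exp, Complex.norm_exp, Complex.neg_re, e]
    exact ⟨Real.exp_le_exp.2 (le_abs_self _), Real.exp_le_exp.2 (neg_le_abs _)⟩
  have hM0 : 0 ≤ M := (norm_nonneg _).trans (hM 0).1
  have hc : ∀ x, ‖seedCosh k (seedVar z x t)‖ ≤ M := fun x => by
    rw [seedCosh, Complex.cosh, norm_div, Complex.norm_two, div_le_iff₀ two_pos]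
    exact (norm_add_le _ _).trans (by linarith [(hM x).1, (hM x).2])
  have hs : ∀ x, ‖seedSinh k (seedVar z x t)‖ ≤ M / ‖k‖ := fun x => by
    simp only [seedSinh, hk0, if_false]
    rw [norm_div, Complex.sinh, norm_div, Complex.norm_two]
    gcongr
    rw [div_le_iff₀ two_pos]
    exact (norm_sub_le _ _).trans (by linarith [(hM x).1, (hM x).2])
  refine ⟨(M * ‖v 0‖ + M / ‖k‖ * ‖z * v 0 + v 1‖) + (M * ‖v 1‖ + M / ‖k‖ * ‖v 0 + z * v 1‖),
    fun x => (pi_norm_le_iff_of_nonneg (by positivity)).2 fun i => ?_⟩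
  have h1 := hc x
  have h2 := hs x
  fin_cases i
  · refine le_trans ?_ (le_add_of_nonneg_right (by positivity))
    refine (norm_add_le _ _).trans ?_
    rw [norm_mul, norm_mul]
    gcongr
  · refine le_trans ?_ (le_add_of_nonneg_left (by positivity))
    refine (norm_sub_le _ _).trans ?_
    rw [norm_mul, norm_mul]
    gcongr

/-- `z² - 1` for `z` in the open part of the continuous spectrum is the square of a nonzero
imaginary number. -/
theorem exists_imaginary_root {z : ℂ} (hz : z ∈ {z : ℂ | z.re = 0} ∪ Complex.ofReal '' Ioo (-1) 1) :
    ∃ k : ℂ, k ^ 2 = z ^ 2 - 1 ∧ k.re = 0 ∧ k ≠ 0 := by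
  obtain ⟨a, ha, hza⟩ : ∃ a : ℝ, 0 < a ∧ z ^ 2 - 1 = -(a : ℂ) := by
    rcases hz with hz | ⟨y, hy, rfl⟩
    · refine ⟨1 + z.im ^ 2, by positivity, ?_⟩
      have : z = z.im * Complex.I := by
        apply Complex.ext <;> simp [show z.re = 0 from hz]
      rw [this]
      push_cast
      simp only [Complex.mul_im, Complex.ofReal_re, Complex.I_im, Complex.ofReal_im, Complex.I_re,
        mul_one, mul_zero, add_zero]
      linear_combination (z.im : ℂ) ^ 2 * Complex.I_sq
    · refine ⟨1 - y ^ 2, ?_, by push_cast; ring⟩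
      nlinarith [hy.1, hy.2]
  refine ⟨Complex.I * (√a : ℝ), ?_, by simp, ?_⟩
  · have : ((√a : ℝ) : ℂ) ^ 2 = a := by exact_mod_cast Real.sq_sqrt ha.le
    rw [hza, mul_pow, this, Complex.I_sq]
    ring
  · exact mul_ne_zero Complex.I_ne_zero (Complex.ofReal_ne_zero.2 (Real.sqrt_pos.2 ha).ne')

theorem sq_sub_sq_ne_zero {l : ℝ} {z : ℂ} (h1 : z ≠ l) (h2 : z ≠ -l) : z ^ 2 - l ^ 2 ≠ 0 := by
  rw [sq_sub_sq]
  exact mul_ne_zero (fun h => h2 (eq_neg_of_add_eq_zero_left h)) (sub_ne_zero.2 h1)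

theorem ne_of_mem_continuousSpectrum {l : ℝ} (hl : 1 < l) {z : ℂ}
    (hz : z ∈ {z : ℂ | z.re = 0} ∪ Complex.ofReal '' Icc (-1) 1) : z ^ 2 - l ^ 2 ≠ 0 := by
  rcases hz with hz | ⟨y, hy, rfl⟩
  · apply sq_sub_sq_ne_zero <;> rintro rfl
    · simp only [mem_ofPred_eq, Complex.ofReal_re] at hz
      linarith
    · simp only [mem_ofPred_eq, Complex.neg_re, Complex.ofReal_re] at hz
      linarith
  · apply sq_sub_sq_ne_zero
    · exact fun h => by linarith [Complex.ofReal_injective h, hy.2]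
    · rw [← Complex.ofReal_neg]
      exact fun h => by linarith [Complex.ofReal_injective h, hy.1]

theorem finrank_bounded_eq_two {l : ℝ} (hl : 1 < l) {z : ℂ}
    (hz : z ∈ {z : ℂ | z.re = 0} ∪ Complex.ofReal '' Ioo (-1) 1) :
    Module.finrank ℂ (boundedLaxSolutions (kmb l) z) = 2 ∧
      ∀ t : ℝ, Module.finrank ℂ (boundedZSSolutions (fun x => kmb l x t) z) = 2 := by
  obtain ⟨k, hk, hre, hk0⟩ := exists_imaginary_root hz
  have hz' : z ^ 2 - l ^ 2 ≠ 0 := ne_of_mem_continuousSpectrum hl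
    (union_subset_union_right _ (image_mono Ioo_subset_Icc_self) hz)
  have := finrank_bounded hl hk hz' (W := ⊤) fun t v => by
    simpa using bounded_seedSol_of_re_eq_zero hre hk0 t v
  simpa using this

/-- Here `U² = 0` and the seed solution is the polynomial `v + ξ U v`, bounded exactly when `U v =
0`. Because `z² = 1`, the two components of `U v` vanish together. -/
theorem bounded_seedSol_iff {z : ℂ} (hz : z ^ 2 = 1) (t : ℝ) (v : Fin 2 → ℂ) :
    (∃ C : ℝ, ∀ x, ‖seedSol z 0 x t v‖ ≤ C) ↔ z * v 0 + v 1 = 0 := by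
  constructor
  · rintro ⟨C, hC⟩
    by_contra hw
    have hw' : 0 < ‖z * v 0 + v 1‖ := norm_pos_iff.2 hw
    -- A point so far to the right that `|ξ| ≥ x - |i z t|` exceeds the bound which `C` imposes on
    -- `|ξ|`.
    obtain ⟨x, hx⟩ : ∃ x : ℝ, x = ‖Complex.I * z * t‖ + (C + ‖v 0‖) / ‖z * v 0 + v 1‖ + 1 :=
      ⟨_, rfl⟩
    have h1 := (norm_le_pi_norm _ 0).trans (hC x)
    simp only [seedSol, seedCosh, seedSinh, zero_mul, Complex.cosh_zero, if_true, one_mul,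
      Matrix.cons_val_zero] at h1
    have h2 : ‖seedVar z x t * (z * v 0 + v 1)‖ ≤ C + ‖v 0‖ := by
      have := norm_sub_le (v 0 + seedVar z x t * (z * v 0 + v 1)) (v 0)
      rw [add_sub_cancel_left] at this
      linarith
    rw [norm_mul, ← le_div_iff₀ hw'] at h2
    have h3 : x ≤ ‖seedVar z x t‖ + ‖Complex.I * z * t‖ := by
      have := norm_sub_le (seedVar z x t) (Complex.I * z * t)
      rw [seedVar, add_sub_cancel_right, Complex.norm_real] at this
      exact (le_abs_self x).trans this
    linarith
  · intro hw
    have hw' : v 0 + z * v 1 = 0 := by linear_combination z * hw - v 0 * hz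
    refine ⟨‖v‖, fun x => ?_⟩
    have e : seedSol z 0 x t v = v := by
      ext i
      fin_cases i <;> simp [seedSol, seedCosh, hw, hw']
    rw [e]

theorem finrank_bounded_eq_one {l : ℝ} (hl : 1 < l) {z : ℂ} (hz : z ∈ ({1, -1} : Set ℂ)) :
    Module.finrank ℂ (boundedLaxSolutions (kmb l) z) = 1 ∧
      ∀ t : ℝ, Module.finrank ℂ (boundedZSSolutions (fun x => kmb l x t) z) = 1 := by
  have hz1 : z ^ 2 = 1 := by
    rcases hz with rfl | rfl <;> norm_num
  have hz' : z ^ 2 - l ^ 2 ≠ 0 := by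
    rw [hz1, sub_ne_zero]
    have : (1 : ℝ) ≠ l ^ 2 := by nlinarith
    exact_mod_cast this
  have hW := finrank_bounded hl (k := 0) (by rw [hz1]; ring) hz'
    (W := Submodule.span ℂ {![1, -z]}) fun t v => by
      rw [bounded_seedSol_iff hz1, Submodule.mem_span_singleton]
      constructor
      · rintro ⟨a, rfl⟩
        simp
        ring
      · intro h
        refine ⟨v 0, ?_⟩
        ext i
        fin_cases i
        · simp
        · simp
          linear_combination -h
  rwa [finrank_span_singleton (by simp)] at hW

/-! ### Unbounded operators -/

section Operators

variable {X : Type*} [NormedAddCommGroup X] [NormedSpace ℂ X]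

/-- Injectivity makes the chosen preimages linear in `f`, and the estimate makes the resulting
inverse continuous. -/
theorem mem_resolventSet_of_bijective {A : X →ₗ.[ℂ] X} {z : ℂ} (C : ℝ)
    (hs : ∀ f : X, ∃ y : A.domain, A y - z • (y : X) = f ∧ ‖(y : X)‖ ≤ C * ‖f‖)
    (hi : ∀ y : A.domain, A y - z • (y : X) = 0 → y = 0) : z ∈ resolventSet A := by
  choose r hr hb using hs
  have hi' : ∀ y y' : A.domain, A y - z • (y : X) = A y' - z • (y' : X) → y = y' := fun y y' h => by
    rw [← sub_eq_zero]
    refine hi _ ?_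
    rw [LinearPMap.map_sub, Submodule.coe_sub, smul_sub, ← sub_eq_zero.2 h]
    abel
  let R : X →ₗ[ℂ] X :=
    { toFun := fun f => r f
      map_add' := fun f g => by
        rw [← Submodule.coe_add]
        congr 1
        refine hi' _ _ ?_
        rw [hr, LinearPMap.map_add, Submodule.coe_add, smul_add, add_sub_add_comm, hr, hr]
      map_smul' := fun c f => by
        rw [RingHom.id_apply, ← Submodule.coe_smul]
        congr 1
        refine hi' _ _ ?_
        rw [hr, LinearPMap.map_smul, Submodule.coe_smul, smul_comm z, ← smul_sub, hr] }
  refine ⟨R.mkContinuous C hb, fun f => ⟨(r f).2, hr f⟩, fun y => ?_⟩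
  exact congrArg Subtype.val (hi' _ _ (hr _))

theorem IsEigenvector.mem_spectrum {A : X →ₗ.[ℂ] X} {z : ℂ} {f : X} (h : IsEigenvector A z f) :
    z ∈ spectrum A := by
  rintro ⟨R, -, hR⟩
  obtain ⟨h0, hd, he⟩ := h
  have := hR ⟨f, hd⟩
  rw [he, sub_self, map_zero] at this
  exact h0 this.symm

theorem mem_powKer_succ {A : X →ₗ.[ℂ] X} {z : ℂ} {k : ℕ} {f : X} :
    f ∈ powKer A z (k + 1) ↔ ∃ h : f ∈ A.domain, A ⟨f, h⟩ - z • f ∈ powKer A z k := by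
  rw [powKer, Submodule.mem_map]
  constructor
  · rintro ⟨y, hy, rfl⟩
    exact ⟨y.2, hy⟩
  · rintro ⟨h, hf⟩
    exact ⟨⟨f, h⟩, hf, rfl⟩

/-- A geometrically simple eigenvalue is algebraically simple if the eigenvector has a nonzero
pairing with a functional that vanishes on the range of `A - z`. -/
theorem algMult_eq_one {A : X →ₗ.[ℂ] X} {z : ℂ} {f : X} (hf : IsEigenvector A z f)
    (hker : ∀ y : A.domain, A y = z • (y : X) → ∃ c : ℂ, (y : X) = c • f)
    (L : X →ₗ[ℂ] ℂ) (hL : ∀ y : A.domain, L (A y) = z * L y) (hLf : L f ≠ 0) :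
    algMult A z = 1 := by
  have hle : ∀ k, powKer A z k ≤ Submodule.span ℂ {f} := by
    intro k
    induction k with
    | zero => exact bot_le
    | succ k ih =>
      intro g hg
      obtain ⟨hd, hg⟩ := mem_powKer_succ.1 hg
      obtain ⟨c, hc⟩ := Submodule.mem_span_singleton.1 (ih hg)
      -- If `(A - z) g = c f`, applying `L` gives `0 = c L f`. Thus `c = 0`, and a chain cannot get
      -- longer than one.
      have h1 := congrArg L hc
      rw [map_smul, map_sub, hL, map_smul, smul_eq_mul, smul_eq_mul, sub_self] at h1
      rw [(mul_eq_zero.1 h1).resolve_right hLf, zero_smul] at hc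
      obtain ⟨a, ha⟩ := hker ⟨g, hd⟩ (sub_eq_zero.1 hc.symm)
      exact Submodule.mem_span_singleton.2 ⟨a, ha.symm⟩
  have hmem : f ∈ powKer A z 1 := by
    obtain ⟨-, hd, he⟩ := hf
    refine mem_powKer_succ.2 ⟨hd, ?_⟩
    rw [he, sub_self]
    exact zero_mem _
  have : (⨆ k, powKer A z k : Submodule ℂ X) = Submodule.span ℂ {f} :=
    le_antisymm (iSup_le hle) ((Submodule.span_singleton_le_iff_mem _ _).2
      (Submodule.mem_iSup_of_mem 1 hmem))
  rw [algMult, this, finrank_span_singleton hf.1]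

end Operators

/-! ### The graph of the Zakharov–Shabat operator in components -/

/-- The function with values in `ℂ²` and given components. -/
def pair (F₀ F₁ : ℝ → ℂ) (x : ℝ) : EuclideanSpace ℂ (Fin 2) := !₂[F₀ x, F₁ x]

theorem memLp_pair {F₀ F₁ : ℝ → ℂ} (h₀ : MemLp F₀ 2 volume) (h₁ : MemLp F₁ 2 volume) :
    MemLp (pair F₀ F₁) 2 volume := by
  refine MemLp.of_eval_piLp fun i => ?_
  fin_cases i
  · exact h₀
  · exact h₁

theorem memLp_entry (f : L2) (i : Fin 2) : MemLp (fun x => f x i) 2 volume :=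
  (Lp.memLp f).eval_piLp i

theorem HasL2Deriv.exists_isPrim {f g : L2} (h : HasL2Deriv f g) :
    ∃ F₀ F₁ : ℝ → ℂ, f =ᵐ[volume] pair F₀ F₁ ∧ IsPrim F₀ (fun x => g x 0) ∧
      IsPrim F₁ fun x => g x 1 := by
  obtain ⟨F, hf, hF⟩ := h
  have hp : ∀ i, IsPrim (fun x => F x i) fun x => g x i := fun i =>
    ⟨(memLp_entry g i).locallyIntegrable_two, fun a b => by
      have := congrArg (EuclideanSpace.proj (𝕜 := ℂ) i) (hF a b)
      rw [← ContinuousLinearMap.intervalIntegral_comp_comm _ (L2.intervalIntegrable g a b)] at this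
      exact this⟩
  refine ⟨fun x => F x 0, fun x => F x 1, ?_, hp 0, hp 1⟩
  filter_upwards [hf] with x hx
  rw [hx]
  ext i
  fin_cases i <;> rfl

theorem hasL2Deriv_of_isPrim {f g : L2} {F₀ F₁ g₀ g₁ : ℝ → ℂ} (hf : f =ᵐ[volume] pair F₀ F₁)
    (hg : g =ᵐ[volume] pair g₀ g₁) (h₀ : IsPrim F₀ g₀) (h₁ : IsPrim F₁ g₁) : HasL2Deriv f g := by
  refine ⟨pair F₀ F₁, hf, fun a b => ?_⟩
  have hi := L2.intervalIntegrable g a b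
  ext i
  have e : (∫ x in a..b, g x) i = ∫ x in a..b, g x i :=
    (ContinuousLinearMap.intervalIntegral_comp_comm (EuclideanSpace.proj (𝕜 := ℂ) i) hi).symm
  rw [e]
  fin_cases i
  · refine (h₀.2 a b).trans (intervalIntegral.integral_congr_ae ?_)
    filter_upwards [hg] with x hx _
    rw [hx]
    rfl
  · refine (h₁.2 a b).trans (intervalIntegral.integral_congr_ae ?_)
    filter_upwards [hg] with x hx _
    rw [hx]
    rfl

theorem exists_isPrim_of_mem_zsGraph {u : ℝ → ℂ} {f h : L2} (hm : (f, h) ∈ zsGraph u) :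
    ∃ F₀ F₁ g₀ g₁ : ℝ → ℂ, f =ᵐ[volume] pair F₀ F₁ ∧ MemLp F₀ 2 volume ∧ MemLp F₁ 2 volume ∧
      MemLp g₀ 2 volume ∧ MemLp g₁ 2 volume ∧ IsPrim F₀ g₀ ∧ IsPrim F₁ g₁ ∧
      h =ᵐ[volume] pair (fun x => g₀ x - u x * F₁ x) (fun x => -star (u x) * F₀ x - g₁ x) := by
  obtain ⟨g, hg, hh⟩ := hm
  obtain ⟨F₀, F₁, hf, h₀, h₁⟩ := hg.exists_isPrim
  refine ⟨F₀, F₁, _, _, hf, ?_, ?_, memLp_entry g 0, memLp_entry g 1, h₀, h₁, ?_⟩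
  · refine (memLp_congr_ae ?_).1 (memLp_entry f 0)
    filter_upwards [hf] with x hx
    rw [hx]
    rfl
  · refine (memLp_congr_ae ?_).1 (memLp_entry f 1)
    filter_upwards [hf] with x hx
    rw [hx]
    rfl
  · filter_upwards [hh, hf] with x h1 h2
    rw [h1, h2]
    rfl

theorem mem_zsGraph_of_isPrim {u : ℝ → ℂ} {f h : L2} {F₀ F₁ g₀ g₁ : ℝ → ℂ}
    (hf : f =ᵐ[volume] pair F₀ F₁) (hg₀ : MemLp g₀ 2 volume) (hg₁ : MemLp g₁ 2 volume)
    (h₀ : IsPrim F₀ g₀) (h₁ : IsPrim F₁ g₁)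
    (hh : h =ᵐ[volume] pair (fun x => g₀ x - u x * F₁ x) (fun x => -star (u x) * F₀ x - g₁ x)) :
    (f, h) ∈ zsGraph u := by
  have hg := (memLp_pair hg₀ hg₁).coeFn_toLp
  refine ⟨(memLp_pair hg₀ hg₁).toLp _, hasL2Deriv_of_isPrim hf hg h₀ h₁, ?_⟩
  filter_upwards [hf, hg, hh] with x h1 h2 h3
  rw [h1, h2, h3]
  rfl

theorem zsOperator_apply_of_mem {u : ℝ → ℂ} {f h : L2} (hm : (f, h) ∈ zsGraph u) :
    ∃ hf : f ∈ (zsOperator u).domain, zsOperator u ⟨f, hf⟩ = h := by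
  rw [← zsOperator_graph, LinearPMap.mem_graph_iff] at hm
  obtain ⟨y, rfl, rfl⟩ := hm
  exact ⟨y.2, rfl⟩

theorem mem_zsGraph_apply {u : ℝ → ℂ} (y : (zsOperator u).domain) :
    ((y : L2), zsOperator u y) ∈ zsGraph u := by
  rw [← zsOperator_graph]
  exact LinearPMap.mem_graph _ y

theorem norm_sq_pair (F₀ F₁ : ℝ → ℂ) (x : ℝ) : ‖pair F₀ F₁ x‖ ^ 2 = ‖F₀ x‖ ^ 2 + ‖F₁ x‖ ^ 2 := by
  rw [EuclideanSpace.norm_sq_eq, Fin.sum_univ_two]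
  rfl

theorem norm_sq_eq_integral {f : L2} {F₀ F₁ : ℝ → ℂ} (hf : f =ᵐ[volume] pair F₀ F₁) :
    ‖f‖ ^ 2 = ∫ x, (‖F₀ x‖ ^ 2 + ‖F₁ x‖ ^ 2) := by
  have h : ((‖f‖ ^ 2 : ℝ) : ℂ) = inner ℂ f f := by
    rw [inner_self_eq_norm_sq_to_K]
    norm_cast
  rw [L2.inner_def] at h
  have e : ∫ x, inner ℂ (f x) (f x) = ∫ x, ((‖F₀ x‖ ^ 2 + ‖F₁ x‖ ^ 2 : ℝ) : ℂ) := by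
    refine integral_congr_ae ?_
    filter_upwards [hf] with x hx
    rw [hx, inner_self_eq_norm_sq_to_K, ← norm_sq_pair]
    norm_cast
  rw [e, integral_complex_ofReal] at h
  exact_mod_cast h

theorem inner_eq_integral {f g : L2} {F₀ F₁ G₀ G₁ : ℝ → ℂ} (hf : f =ᵐ[volume] pair F₀ F₁)
    (hg : g =ᵐ[volume] pair G₀ G₁) :
    inner ℂ f g = ∫ x, (G₀ x * star (F₀ x) + G₁ x * star (F₁ x)) := by
  rw [L2.inner_def]
  refine integral_congr_ae ?_
  filter_upwards [hf, hg] with x h1 h2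
  rw [h1, h2, PiLp.inner_apply, Fin.sum_univ_two]
  rfl

theorem _root_.MeasureTheory.MemLp.bounded_mul {a f : ℝ → ℂ} (hf : MemLp f 2 volume)
    (ha : Continuous a) {C : ℝ} (hC : ∀ x, ‖a x‖ ≤ C) : MemLp (fun x => a x * f x) 2 volume :=
  hf.of_le_mul (c := C) (ha.aestronglyMeasurable.mul hf.1) (.of_forall fun x => by
    rw [norm_mul]
    exact mul_le_mul_of_nonneg_right (hC x) (norm_nonneg _))

/-! ### The operator with a bounded continuous potential -/

section Potential

variable {u : ℝ → ℂ} {C : ℝ}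

/-- The domain of the Zakharov–Shabat operator is dense. -/
theorem dense_zsOperator_domain (hu : Continuous u) (hC : ∀ x, ‖u x‖ ≤ C) :
    Dense ((zsOperator u).domain : Set L2) := by
  refine (Lp.dense_hasCompactSupport_contDiff (E := ℝ) (F := EuclideanSpace ℂ (Fin 2))
    (μ := volume) (p := 2) (by norm_num)).mono ?_
  rintro f ⟨F, hf, hs, hF⟩
  rw [SetLike.mem_coe, mem_zsOperator_domain_iff hu.measurable hC]
  have hd : ∀ x, HasDerivAt F (deriv F x) x := fun x =>
    (hF.differentiable (by simp)).differentiableAt.hasDerivAt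
  have hc : Continuous (deriv F) := hF.continuous_deriv (by simp)
  have hm : MemLp (deriv F) 2 volume := hc.memLp_of_hasCompactSupport hs.deriv
  refine ⟨hm.toLp _, F, hf, fun a b => ?_⟩
  rw [← intervalIntegral.integral_eq_sub_of_hasDerivAt (fun x _ => hd x)
    (hc.intervalIntegrable a b)]
  refine intervalIntegral.integral_congr_ae ?_
  filter_upwards [hm.coeFn_toLp] with x hx _
  rw [hx]

theorem IsZSSolution.isPrim {z : ℂ} {φ : ℝ → Fin 2 → ℂ} (hu : Continuous u)
    (h : IsZSSolution u z φ) :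
    (IsPrim (fun x => φ x 0) fun x => z * φ x 0 + u x * φ x 1) ∧
      IsPrim (fun x => φ x 1) fun x => -star (u x) * φ x 0 - z * φ x 1 := by
  rw [isZSSolution_iff] at h
  have c0 : Continuous fun x => φ x 0 := continuous_iff_continuousAt.2 fun x => (h.1 x).continuousAt
  have c1 : Continuous fun x => φ x 1 := continuous_iff_continuousAt.2 fun x => (h.2 x).continuousAt
  have := continuous_star.comp hu
  exact ⟨.of_hasDerivAt h.1 (by fun_prop), .of_hasDerivAt h.2 (by fun_prop)⟩

theorem IsZSSolution.mem_zsGraph {z : ℂ} {φ : ℝ → Fin 2 → ℂ} (hu : Continuous u)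
    (hC : ∀ x, ‖u x‖ ≤ C) (h : IsZSSolution u z φ) (h₀ : MemLp (fun x => φ x 0) 2 volume)
    (h₁ : MemLp (fun x => φ x 1) 2 volume) {f : L2}
    (hf : f =ᵐ[volume] pair (fun x => φ x 0) fun x => φ x 1) : (f, z • f) ∈ zsGraph u := by
  obtain ⟨p0, p1⟩ := h.isPrim hu
  refine mem_zsGraph_of_isPrim hf ?_ ?_ p0 p1 ?_
  · exact (h₀.const_mul z).add (h₁.bounded_mul hu hC)
  · refine MemLp.sub ?_ (h₁.const_mul z)
    refine h₀.bounded_mul (C := C) (continuous_star.comp hu).neg fun x => ?_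
    rw [norm_neg, norm_star]
    exact hC x
  · filter_upwards [Lp.coeFn_smul z f, hf] with x h1 h2
    rw [h1, Pi.smul_apply, h2]
    ext i
    fin_cases i <;> simp [pair]

/-- Elements of `ker (L - z)` are classical solutions of the spectral problem. -/
theorem exists_isZSSolution_of_mem_zsGraph {z : ℂ} (hu : Continuous u) {f : L2}
    (h : (f, z • f) ∈ zsGraph u) : ∃ φ : ℝ → Fin 2 → ℂ, IsZSSolution u z φ ∧
      MemLp (fun x => φ x 0) 2 volume ∧ MemLp (fun x => φ x 1) 2 volume ∧
      f =ᵐ[volume] pair (fun x => φ x 0) fun x => φ x 1 := by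
  obtain ⟨F₀, F₁, g₀, g₁, hf, hF₀, hF₁, -, -, p0, p1, hh⟩ := exists_isPrim_of_mem_zsGraph h
  have hae : ∀ᵐ x, g₀ x = z * F₀ x + u x * F₁ x ∧ g₁ x = -star (u x) * F₀ x - z * F₁ x := by
    filter_upwards [hh, hf, Lp.coeFn_smul z f] with x h1 h2 h3
    rw [h3, Pi.smul_apply, h2] at h1
    have e0 := congrArg (fun v : EuclideanSpace ℂ (Fin 2) => v 0) h1
    have e1 := congrArg (fun v : EuclideanSpace ℂ (Fin 2) => v 1) h1
    simp only [pair, PiLp.smul_apply, smul_eq_mul, PiLp.toLp_apply, Matrix.cons_val_zero,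
      Matrix.cons_val_one] at e0 e1
    exact ⟨by linear_combination -e0, by linear_combination e1⟩
  have c0 := p0.continuous
  have c1 := p1.continuous
  have cu := continuous_star.comp hu
  refine ⟨fun x => ![F₀ x, F₁ x], isZSSolution_iff.2 ⟨fun x => ?_, fun x => ?_⟩, hF₀, hF₁, hf⟩
  -- The weak derivative agrees almost everywhere with a continuous function, so the equation holds
  -- at every point.
  · exact (p0.congr_ae (hae.mono fun x hx => hx.1)).hasDerivAt (by fun_prop) x
  · exact (p1.congr_ae (hae.mono fun x hx => hx.2)).hasDerivAt (by fun_prop) x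

/-- The vector field is linear and globally Lipschitz with constant `‖z‖ + C` in the maximum norm,
so the solution through zero is unique on all of `ℝ`. -/
theorem IsZSSolution.eq_zero {z : ℂ} {φ : ℝ → Fin 2 → ℂ} (hC : ∀ x, ‖u x‖ ≤ C)
    (h : IsZSSolution u z φ) {x₀ : ℝ} (h0 : φ x₀ = 0) : φ = 0 := by
  have hC0 : 0 ≤ C := (norm_nonneg _).trans (hC 0)
  have hl : ∀ x, LipschitzWith (Real.toNNReal (‖z‖ + C)) fun v => laxU (u x) z *ᵥ v := fun x => by
    refine LipschitzWith.of_dist_le_mul fun v w => ?_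
    rw [dist_eq_norm, dist_eq_norm, ← Matrix.mulVec_sub, Real.coe_toNNReal _ (by positivity)]
    generalize v - w = y
    have h0 := norm_le_pi_norm y 0
    have h1 := norm_le_pi_norm y 1
    have hx := hC x
    refine (pi_norm_le_iff_of_nonneg (by positivity)).2 fun i => ?_
    rw [add_mul]
    fin_cases i
    · simp only [laxU, Matrix.mulVec, dotProduct, Fin.sum_univ_two]
      refine (norm_add_le _ _).trans ?_
      simp only [norm_mul]
      exact add_le_add (mul_le_mul_of_nonneg_left h0 (norm_nonneg _))
        (mul_le_mul hx h1 (norm_nonneg _) hC0)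
    · simp only [laxU, Matrix.mulVec, dotProduct, Fin.sum_univ_two]
      refine (norm_add_le _ _).trans ?_
      simp only [norm_mul]
      rw [add_comm]
      refine add_le_add (mul_le_mul_of_nonneg_right ?_ (norm_nonneg _) |>.trans
        (mul_le_mul_of_nonneg_left h1 (norm_nonneg _)))
        (mul_le_mul ?_ h0 (norm_nonneg _) hC0)
      · simp
      · simpa using hx
  refine ODE_solution_unique_univ (v := fun x v => laxU (u x) z *ᵥ v) (s := fun _ => univ)
    (t₀ := x₀) (fun x => (hl x).lipschitzOnWith) (fun x => ⟨h x, mem_univ _⟩)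
    (fun x => ⟨IsZSSolution.zero u z x, mem_univ _⟩) h0

theorem IsZSSolution.continuous {z : ℂ} {φ : ℝ → Fin 2 → ℂ} (h : IsZSSolution u z φ) :
    Continuous φ :=
  continuous_iff_continuousAt.2 fun x => (h x).continuousAt

/-- Square integrable solutions of the spectral problem are unique up to multiples. -/
theorem IsZSSolution.exists_eq_smul {z : ℂ} {φ ψ : ℝ → Fin 2 → ℂ} (hC : ∀ x, ‖u x‖ ≤ C)
    (h : IsZSSolution u z φ) (hφ : φ 0 ≠ 0)
    (h₀ : MemLp (fun x => φ x 0) 2 volume) (h₁ : MemLp (fun x => φ x 1) 2 volume)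
    (h' : IsZSSolution u z ψ) (h₀' : MemLp (fun x => ψ x 0) 2 volume)
    (h₁' : MemLp (fun x => ψ x 1) 2 volume) : ∃ c : ℂ, ψ = c • φ := by
  -- The Wronskian is constant because `U` has trace zero, and integrable because all entries are in
  -- `L²`. An integrable constant on `ℝ` is zero, so the values at `0` are parallel.
  have hd : ∀ x, HasDerivAt (fun y => φ y 0 * ψ y 1 - φ y 1 * ψ y 0) 0 x := fun x => by
    have a := isZSSolution_iff.1 h
    have b := isZSSolution_iff.1 h'
    refine (((a.1 x).mul (b.2 x)).sub ((a.2 x).mul (b.1 x))).congr_deriv ?_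
    ring
  have hconst : ∀ x, φ x 0 * ψ x 1 - φ x 1 * ψ x 0 = φ 0 0 * ψ 0 1 - φ 0 1 * ψ 0 0 := fun x =>
    is_const_of_deriv_eq_zero (fun x => (hd x).differentiableAt) (fun x => (hd x).deriv) x 0
  have hint : Integrable (fun x => φ x 0 * ψ x 1 - φ x 1 * ψ x 0) volume :=
    (h₀.integrable_mul h₁').sub (h₁.integrable_mul h₀')
  simp only [hconst] at hint
  rw [integrable_const_iff] at hint
  have hw : φ 0 0 * ψ 0 1 - φ 0 1 * ψ 0 0 = 0 := by
    rcases hint with hint | hint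
    · exact hint
    · exact absurd hint.measure_univ_lt_top (by simp)
  obtain ⟨c, hc⟩ : ∃ c : ℂ, ψ 0 = c • φ 0 := by
    by_cases h00 : φ 0 0 = 0
    · have h01 : φ 0 1 ≠ 0 := fun h01 => hφ (by
        ext i
        fin_cases i <;> assumption)
      refine ⟨ψ 0 1 / φ 0 1, ?_⟩
      ext i
      fin_cases i <;> simp <;> field_simp
      linear_combination -hw
    · refine ⟨ψ 0 0 / φ 0 0, ?_⟩
      ext i
      fin_cases i <;> simp <;> field_simp
      linear_combination hw
  refine ⟨c, ?_⟩
  have hz := (h'.add (h.smul (-c))).eq_zero hC (x₀ := 0) (by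
    rw [Pi.add_apply, Pi.smul_apply, hc, neg_smul, add_neg_cancel])
  rw [neg_smul, ← sub_eq_add_neg, sub_eq_zero] at hz
  exact hz

/-- If `φ` solves the spectral problem with parameter `w`, then `(φ₁, -φ₂)` is orthogonal to the
range of `L + conj w`. -/
theorem inner_zsGraph (hu : Continuous u) (hC : ∀ x, ‖u x‖ ≤ C) {w : ℂ} {φ : ℝ → Fin 2 → ℂ}
    (h : IsZSSolution u w φ) (h₀ : MemLp (fun x => φ x 0) 2 volume)
    (h₁ : MemLp (fun x => φ x 1) 2 volume) {g : L2}
    (hg : g =ᵐ[volume] pair (fun x => φ x 0) fun x => -φ x 1) {f k : L2}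
    (hm : (f, k) ∈ zsGraph u) : inner ℂ g k = inner ℂ (-w • g) f := by
  obtain ⟨F₀, F₁, g₀, g₁, hf, hF₀, hF₁, hg₀, hg₁, p0, p1, hk⟩ := exists_isPrim_of_mem_zsGraph hm
  obtain ⟨q0, q1⟩ := h.isPrim hu
  have hs : ∀ x, ‖star (u x)‖ ≤ C := fun x => by
    rw [norm_star]
    exact hC x
  have hus : Continuous fun x => star (u x) := continuous_star.comp hu
  rw [inner_smul_left, inner_eq_integral hg hk, inner_eq_integral hg hf, ← sub_eq_zero,
    ← integral_const_mul, ← integral_sub]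
  · have hP := (p0.mul q0.conj).add (p1.mul q1.conj)
    have hz := hP.integral_eq_zero ((hF₀.integrable_mul_star h₀).add (hF₁.integrable_mul_star h₁)) ?_
    · rw [← hz]
      refine integral_congr_ae (.of_forall fun x => ?_)
      simp only [Complex.star_def, map_add, map_sub, map_mul, map_neg, Complex.conj_conj]
      ring
    · have e1 := (h₀.const_mul w).add (h₁.bounded_mul hu hC)
      have e2 := (h₀.bounded_mul hus.neg (C := C) fun x => by
        rw [Pi.neg_apply, norm_neg]
        exact hs x).sub (h₁.const_mul w)
      exact ((hg₀.integrable_mul_star h₀).add (hF₀.integrable_mul_star e1)).add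
        ((hg₁.integrable_mul_star h₁).add (hF₁.integrable_mul_star e2))
  · exact ((hg₀.sub (hF₁.bounded_mul hu hC)).integrable_mul_star h₀).add
      (((hF₀.bounded_mul hus.neg (C := C) fun x => by
        rw [Pi.neg_apply, norm_neg]
        exact hs x).sub hg₁).integrable_mul_star h₁.neg)
  · exact ((hF₀.integrable_mul_star h₀).add (hF₁.integrable_mul_star h₁.neg)).const_mul _

/-- If `φ` solves the spectral problem with parameter `w`, then `(φ₁, -φ₂)` is an eigenfunction of
the adjoint for `-w`. -/
theorem isEigenvector_adjoint (hu : Continuous u) (hC : ∀ x, ‖u x‖ ≤ C) {w : ℂ}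
    {φ : ℝ → Fin 2 → ℂ} (h : IsZSSolution u w φ) (h₀ : MemLp (fun x => φ x 0) 2 volume)
    (h₁ : MemLp (fun x => φ x 1) 2 volume) {g : L2} (hg0 : g ≠ 0)
    (hg : g =ᵐ[volume] pair (fun x => φ x 0) fun x => -φ x 1) :
    IsEigenvector (zsOperator u).adjoint (-w) g := by
  have hi : ∀ y : (zsOperator u).domain, inner ℂ (-w • g) (y : L2) = inner ℂ g (zsOperator u y) :=
    fun y => (inner_zsGraph hu hC h h₀ h₁ hg (mem_zsGraph_apply y)).symm
  have hd := dense_zsOperator_domain hu hC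
  have hm := LinearPMap.mem_adjoint_domain_of_exists (T := zsOperator u) g ⟨-w • g, hi⟩
  exact ⟨hg0, hm, LinearPMap.adjoint_apply_eq hd ⟨g, hm⟩ hi⟩

/-- If the spectral problem has a bounded nonzero solution, then its parameter belongs to the
spectrum. -/
theorem mem_spectrum_of_bounded (hu : Continuous u) (hC : ∀ x, ‖u x‖ ≤ C) {z : ℂ}
    {φ : ℝ → Fin 2 → ℂ} (h : IsZSSolution u z φ) {M : ℝ} (hM : ∀ x, ‖φ x‖ ≤ M) (hφ : φ ≠ 0) :
    z ∈ spectrum (zsOperator u) := by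
  rintro ⟨R, -, hR⟩
  refine hφ ?_
  -- A cut-off solution `f` will satisfy `‖(L - z) f‖ ≤ ε ‖f‖`, which a bounded inverse of norm
  -- below `1 / ε` rules out unless `f = 0`.
  obtain ⟨ε, hε0, hε⟩ : ∃ ε : ℝ, 0 < ε ∧ ‖R‖ * ε < 1 := by
    refine ⟨(‖R‖ + 1)⁻¹, by positivity, ?_⟩
    rw [← div_eq_mul_inv, div_lt_one (by positivity)]
    linarith
  obtain ⟨p0, p1⟩ := h.isPrim hu
  have hpos : ∀ x : ℝ, 0 < 1 + (ε * x) ^ 2 := fun x => by positivity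
  -- This cut-off is square integrable, never zero, and satisfies `|χ'| ≤ ε |χ|` pointwise, so no
  -- growth information on `φ` is needed beyond boundedness.
  set χ : ℝ → ℂ := fun x => (((1 + (ε * x) ^ 2)⁻¹ : ℝ) : ℂ) with hχ
  set χ' : ℝ → ℂ := fun x => ((-(2 * (ε * x) * ε) / (1 + (ε * x) ^ 2) ^ 2 : ℝ) : ℂ) with hχ'
  have hχd : ∀ x, HasDerivAt χ (χ' x) x := fun x => by
    refine HasDerivAt.ofReal_comp ?_
    have := ((((hasDerivAt_id x).const_mul ε).pow 2).const_add 1).inv (hpos x).ne'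
    refine this.congr_deriv ?_
    simp
  have hχc : Continuous χ := continuous_iff_continuousAt.2 fun x => (hχd x).continuousAt
  have hχc' : Continuous χ' := by
    refine Complex.continuous_ofReal.comp ?_
    refine Continuous.div (by fun_prop) (by fun_prop) fun x => ?_
    have := hpos x
    positivity
  have hχn : ∀ x, ‖χ x‖ = (1 + (ε * x) ^ 2)⁻¹ := fun x => by
    rw [hχ, Complex.norm_real, Real.norm_of_nonneg (inv_nonneg.2 (hpos x).le)]
  have hχle : ∀ x, ‖χ' x‖ ≤ ε * ‖χ x‖ := fun x => by
    have e : ε * (1 + (ε * x) ^ 2)⁻¹ * (1 + (ε * x) ^ 2) ^ 2 = ε * (1 + (ε * x) ^ 2) := by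
      have := (hpos x).ne'
      field_simp
    rw [hχn, hχ', Complex.norm_real, norm_div, Real.norm_of_nonneg (sq_nonneg (1 + (ε * x) ^ 2)),
      div_le_iff₀ (pow_pos (hpos x) 2), e, norm_neg, norm_mul, Real.norm_of_nonneg hε0.le, mul_comm]
    gcongr
    rw [Real.norm_eq_abs, abs_le]
    constructor <;> nlinarith [sq_nonneg (ε * x - 1), sq_nonneg (ε * x + 1)]
  have hχ1 : ∀ x, ‖χ x‖ ≤ 1 := fun x => by
    rw [hχn]
    exact inv_le_one_of_one_le₀ (by nlinarith [sq_nonneg (ε * x)])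
  have hχL : MemLp χ 2 volume := by
    refine (memLp_two_iff_integrable_sq_norm hχc.aestronglyMeasurable).2 ?_
    refine (integrable_inv_one_add_sq.comp_mul_left' hε0.ne').mono'
      (hχc.norm.pow 2).aestronglyMeasurable (.of_forall fun x => ?_)
    rw [norm_pow, norm_norm, ← hχn]
    nlinarith [hχ1 x, norm_nonneg (χ x)]
  have hχL' : MemLp χ' 2 volume :=
    hχL.of_le_mul hχc'.aestronglyMeasurable (.of_forall hχle)
  have hb : ∀ i x, ‖φ x i‖ ≤ M := fun i x => (norm_le_pi_norm (φ x) i).trans (hM x)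
  have c0 := p0.continuous
  have c1 := p1.continuous
  -- the cut-off solution
  have m0 : MemLp (fun x => φ x 0 * χ x) 2 volume := hχL.bounded_mul c0 (hb 0)
  have m1 : MemLp (fun x => φ x 1 * χ x) 2 volume := hχL.bounded_mul c1 (hb 1)
  have n0 : MemLp (fun x => φ x 0 * χ' x) 2 volume := hχL'.bounded_mul c0 (hb 0)
  have n1 : MemLp (fun x => φ x 1 * χ' x) 2 volume := hχL'.bounded_mul c1 (hb 1)
  have hχp : IsPrim χ χ' := .of_hasDerivAt hχd hχc'
  set f : L2 := (memLp_pair m0 m1).toLp _ with hf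
  set r : L2 := (memLp_pair n0 n1.neg).toLp _ with hr
  have hfe := (memLp_pair m0 m1).coeFn_toLp
  have hre := (memLp_pair n0 n1.neg).coeFn_toLp
  have hus : Continuous fun x => -star (u x) := (continuous_star.comp hu).neg
  -- The equation for `φ` cancels everything except the commutator term: `(L - z)(χ φ) = χ' (φ₁,
  -- -φ₂)`.
  have hm : (f, z • f + r) ∈ zsGraph u := by
    refine mem_zsGraph_of_isPrim hfe (g₀ := fun x => (z * φ x 0 + u x * φ x 1) * χ x + φ x 0 * χ' x)
      (g₁ := fun x => (-star (u x) * φ x 0 - z * φ x 1) * χ x + φ x 1 * χ' x) ?_ ?_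
      (p0.mul hχp) (p1.mul hχp) ?_
    · refine MemLp.add ?_ n0
      refine ((m0.const_mul z).add (m1.bounded_mul hu hC)).ae_eq (.of_forall fun x => ?_)
      simp only [Pi.add_apply]
      ring
    · refine MemLp.add ?_ n1
      refine ((m0.bounded_mul hus (C := C) fun x => ?_).sub (m1.const_mul z)).ae_eq
        (.of_forall fun x => ?_)
      · rw [norm_neg, norm_star]
        exact hC x
      · simp only [Pi.sub_apply]
        ring
    · filter_upwards [Lp.coeFn_add (z • f) r, Lp.coeFn_smul z f, hfe, hre] with x h1 h2 h3 h4
      rw [h1, Pi.add_apply, h2, Pi.smul_apply, h3, h4]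
      ext i
      fin_cases i <;> simp [pair] <;> ring
  obtain ⟨hd, he⟩ := zsOperator_apply_of_mem hm
  have hRf := hR ⟨f, hd⟩
  rw [he, add_sub_cancel_left] at hRf
  have hrf : ‖r‖ ≤ ε * ‖f‖ := by
    refine Lp.norm_le_mul_norm_of_ae_le_mul ?_
    filter_upwards [hfe, hre] with x h3 h4
    rw [h3, h4]
    refine le_of_sq_le_sq ?_ (by positivity)
    rw [mul_pow, norm_sq_pair, norm_sq_pair]
    simp only [norm_neg, norm_mul, mul_pow, Pi.neg_apply]
    have := pow_le_pow_left₀ (norm_nonneg _) (hχle x) 2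
    rw [mul_pow] at this
    nlinarith [sq_nonneg ‖φ x 0‖, sq_nonneg ‖φ x 1‖]
  have hf0 : f = 0 := by
    have h1 : ‖f‖ ≤ ‖R‖ * ‖r‖ := by
      have := R.le_opNorm r
      rwa [hRf] at this
    have h2 : ‖R‖ * ‖r‖ ≤ ‖R‖ * ε * ‖f‖ := by
      rw [mul_assoc]
      gcongr
    by_contra hne
    have := norm_pos_iff.2 hne
    nlinarith
  have hae : ∀ᵐ x, φ x = 0 := by
    rw [← hf, hf0] at hfe
    filter_upwards [hfe, Lp.coeFn_zero (EuclideanSpace ℂ (Fin 2)) 2 (volume : Measure ℝ)]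
      with x h1 h2
    rw [h2] at h1
    have hx : χ x ≠ 0 := norm_pos_iff.1 (by rw [hχn]; exact inv_pos.2 (hpos x))
    have e0 := congrArg (fun v : EuclideanSpace ℂ (Fin 2) => v 0) h1
    have e1 := congrArg (fun v : EuclideanSpace ℂ (Fin 2) => v 1) h1
    simp only [pair, PiLp.zero_apply, PiLp.toLp_apply, Matrix.cons_val_zero,
      Matrix.cons_val_one, Pi.zero_apply] at e0 e1
    ext i
    fin_cases i
    · exact (mul_eq_zero.1 e0.symm).resolve_right hx
    · exact (mul_eq_zero.1 e1.symm).resolve_right hx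
  exact (Continuous.ae_eq_iff_eq volume h.continuous continuous_const).mp hae

end Potential

/-! ### The resolvent away from the spectrum -/

theorem norm_sq_lincomb_le {a b : ℂ} {M : ℝ} (ha : ‖a‖ ≤ M) (hb : ‖b‖ ≤ M) (v w : ℂ) :
    ‖a * v + b * w‖ ^ 2 ≤ 2 * M ^ 2 * (‖v‖ ^ 2 + ‖w‖ ^ 2) := by
  have hM : 0 ≤ M := (norm_nonneg _).trans ha
  have h : ‖a * v + b * w‖ ≤ M * (‖v‖ + ‖w‖) := by
    refine (norm_add_le _ _).trans ?_
    rw [norm_mul, norm_mul, mul_add]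
    gcongr
  have := pow_le_pow_left₀ (norm_nonneg _) h 2
  nlinarith [mul_nonneg (sq_nonneg M) (sq_nonneg (‖v‖ - ‖w‖))]

theorem sum_norm_sq_le {A : (Fin 2 → ℂ) → Fin 2 → ℂ} {K : ℝ} (hA : ∀ v, ‖A v‖ ≤ K * ‖v‖)
    (v : Fin 2 → ℂ) : ‖A v 0‖ ^ 2 + ‖A v 1‖ ^ 2 ≤ 2 * K ^ 2 * (‖v 0‖ ^ 2 + ‖v 1‖ ^ 2) := by
  have hv : ‖v‖ ^ 2 ≤ ‖v 0‖ ^ 2 + ‖v 1‖ ^ 2 := by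
    have : ‖v‖ ≤ √(‖v 0‖ ^ 2 + ‖v 1‖ ^ 2) := by
      refine (pi_norm_le_iff_of_nonneg (Real.sqrt_nonneg _)).2 fun i => Real.le_sqrt_of_sq_le ?_
      fin_cases i
      · exact le_add_of_nonneg_right (sq_nonneg _)
      · exact le_add_of_nonneg_left (sq_nonneg _)
    exact (Real.le_sqrt (norm_nonneg _) (by positivity)).1 this
  have h : ∀ i, ‖A v i‖ ^ 2 ≤ K ^ 2 * ‖v‖ ^ 2 := fun i => by
    rw [← mul_pow]
    exact pow_le_pow_left₀ (norm_nonneg _) ((norm_le_pi_norm _ i).trans (hA v)) 2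
  have h2 := mul_le_mul_of_nonneg_left hv (sq_nonneg K)
  linarith [h 0, h 1]

/-- The inhomogeneous spectral problem with the constant potential `1` is boundedly solvable
in `L²`. -/
theorem exists_seed_solution {z k : ℂ} (hk : k ^ 2 = z ^ 2 - 1) (hre : k.re ≠ 0) :
    ∃ C : ℝ, 0 ≤ C ∧ ∀ g₀ g₁ : ℝ → ℂ, MemLp g₀ 2 volume → MemLp g₁ 2 volume →
      ∃ G₀ G₁ : ℝ → ℂ, MemLp G₀ 2 volume ∧ MemLp G₁ 2 volume ∧
        (IsPrim G₀ fun x => z * G₀ x + G₁ x + g₀ x) ∧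
        (IsPrim G₁ fun x => -G₀ x - z * G₁ x + g₁ x) ∧
        ∫ x, (‖G₀ x‖ ^ 2 + ‖G₁ x‖ ^ 2) ≤ C * ∫ x, (‖g₀ x‖ ^ 2 + ‖g₁ x‖ ^ 2) := by
  have hk0 : k ≠ 0 := fun h => hre (by simp [h])
  obtain ⟨M, hM1, hM2, hM3, hM0⟩ : ∃ M : ℝ, ‖z + k‖ ≤ M ∧ ‖z - k‖ ≤ M ∧ ‖(1 : ℂ)‖ ≤ M ∧ 0 ≤ M :=
    ⟨‖z‖ + ‖k‖ + 1, (norm_add_le _ _).trans (by linarith), (norm_sub_le _ _).trans (by linarith),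
      by rw [norm_one]; linarith [norm_nonneg z, norm_nonneg k], by positivity⟩
  obtain ⟨N, hN1, hN2, hN3, hN4, hN0⟩ : ∃ N : ℝ, ‖(2 * k)⁻¹‖ ≤ N ∧ ‖-(2 * k)⁻¹‖ ≤ N ∧
      ‖1 - (z + k) * (2 * k)⁻¹‖ ≤ N ∧ ‖(z + k) * (2 * k)⁻¹‖ ≤ N ∧ 0 ≤ N :=
    ⟨‖(2 * k)⁻¹‖ + ‖1 - (z + k) * (2 * k)⁻¹‖ + ‖(z + k) * (2 * k)⁻¹‖,
      by linarith [norm_nonneg (1 - (z + k) * (2 * k)⁻¹), norm_nonneg ((z + k) * (2 * k)⁻¹)],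
      by rw [norm_neg]
         linarith [norm_nonneg (1 - (z + k) * (2 * k)⁻¹), norm_nonneg ((z + k) * (2 * k)⁻¹)],
      by linarith [norm_nonneg (2 * k)⁻¹, norm_nonneg ((z + k) * (2 * k)⁻¹)],
      by linarith [norm_nonneg (1 - (z + k) * (2 * k)⁻¹), norm_nonneg (2 * k)⁻¹], by positivity⟩
  refine ⟨4 * N ^ 2 * ((k.re ^ 2)⁻¹ * (4 * M ^ 2)), by positivity, fun g₀ g₁ hg₀ hg₁ => ?_⟩
  -- The combinations `y = (z + k) G₀ + G₁` and `w = (z - k) G₀ + G₁` decouple the system into `y' =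
  -- k y + …` and `w' = -k w + …`. One recovers `G₀ = (y - w) / (2 k)` and `G₁ = y - (z + k) G₀`.
  have hh1 : MemLp (fun x => (z + k) * g₀ x + 1 * g₁ x) 2 volume :=
    (hg₀.const_mul _).add (hg₁.const_mul _)
  have hh2 : MemLp (fun x => (z - k) * g₀ x + 1 * g₁ x) 2 volume :=
    (hg₀.const_mul _).add (hg₁.const_mul _)
  obtain ⟨y, hy, py, by'⟩ := exists_memLp_isPrim hre hh1
  obtain ⟨w, hw, pw, bw⟩ := exists_memLp_isPrim (κ := -k) (by simpa using hre) hh2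
  have hI := hg₀.integrable_norm_sq.add hg₁.integrable_norm_sq
  have b1 : ∫ x, ‖y x‖ ^ 2 ≤ (k.re ^ 2)⁻¹ * (2 * M ^ 2 * ∫ x, (‖g₀ x‖ ^ 2 + ‖g₁ x‖ ^ 2)) := by
    refine by'.trans (mul_le_mul_of_nonneg_left ?_ (inv_nonneg.2 (sq_nonneg _)))
    rw [← integral_const_mul]
    exact integral_mono hh1.integrable_norm_sq (hI.const_mul _)
      fun x => norm_sq_lincomb_le hM1 hM3 _ _
  have b2 : ∫ x, ‖w x‖ ^ 2 ≤ (k.re ^ 2)⁻¹ * (2 * M ^ 2 * ∫ x, (‖g₀ x‖ ^ 2 + ‖g₁ x‖ ^ 2)) := by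
    rw [Complex.neg_re, neg_sq] at bw
    refine bw.trans (mul_le_mul_of_nonneg_left ?_ (inv_nonneg.2 (sq_nonneg _)))
    rw [← integral_const_mul]
    exact integral_mono hh2.integrable_norm_sq (hI.const_mul _)
      fun x => norm_sq_lincomb_le hM2 hM3 _ _
  have m0 : MemLp (fun x => (2 * k)⁻¹ * y x + -(2 * k)⁻¹ * w x) 2 volume :=
    (hy.const_mul _).add (hw.const_mul _)
  have m1 : MemLp (fun x => (1 - (z + k) * (2 * k)⁻¹) * y x + (z + k) * (2 * k)⁻¹ * w x) 2
    volume := (hy.const_mul _).add (hw.const_mul _)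
  refine ⟨_, _, m0, m1, ?_, ?_, ?_⟩
  · refine ((py.const_mul (2 * k)⁻¹).add (pw.const_mul (-(2 * k)⁻¹))).congr_ae
      (.of_forall fun x => ?_)
    simp only
    field_simp
    ring
  · refine ((py.const_mul (1 - (z + k) * (2 * k)⁻¹)).add
      (pw.const_mul ((z + k) * (2 * k)⁻¹))).congr_ae (.of_forall fun x => ?_)
    simp only
    field_simp
    linear_combination (y x - w x) * hk
  · have hJ := hy.integrable_norm_sq.add hw.integrable_norm_sq
    have b3 : ∫ x, (‖(2 * k)⁻¹ * y x + -(2 * k)⁻¹ * w x‖ ^ 2 +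
        ‖(1 - (z + k) * (2 * k)⁻¹) * y x + (z + k) * (2 * k)⁻¹ * w x‖ ^ 2) ≤
        ∫ x, 4 * N ^ 2 * (‖y x‖ ^ 2 + ‖w x‖ ^ 2) := by
      refine integral_mono (m0.integrable_norm_sq.add m1.integrable_norm_sq) (hJ.const_mul _)
        fun x => ?_
      have e1 := norm_sq_lincomb_le hN1 hN2 (y x) (w x)
      have e2 := norm_sq_lincomb_le hN3 hN4 (y x) (w x)
      simp only
      linarith
    rw [integral_const_mul, integral_add hy.integrable_norm_sq hw.integrable_norm_sq] at b3
    have b4 := mul_le_mul_of_nonneg_left (add_le_add b1 b2) (show 0 ≤ 4 * N ^ 2 by positivity)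
    linarith

theorem continuous_refl₁ {l : ℝ} (hl : 1 < l) (t : ℝ) : Continuous fun x => refl₁ l x t :=
  continuous_iff_continuousAt.2 fun x => (hasDerivAt_refl₁_x hl x t).continuousAt

theorem continuous_refl₂ {l : ℝ} (hl : 1 < l) (t : ℝ) : Continuous fun x => refl₂ l x t :=
  continuous_iff_continuousAt.2 fun x => (hasDerivAt_refl₂_x hl x t).continuousAt

theorem continuous_kmb {l : ℝ} (hl : 1 < l) (t : ℝ) : Continuous fun x => kmb l x t := by
  simp only [kmb_eq hl]
  have := continuous_refl₂ hl t
  fun_prop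

theorem norm_kmb_le {l : ℝ} (hl : 1 < l) (x t : ℝ) : ‖kmb l x t‖ ≤ 1 + 2 * l := by
  rw [kmb_eq hl]
  refine (norm_add_le _ _).trans ?_
  have hl' : ‖(l : ℂ)‖ = l := by
    rw [Complex.norm_real, Real.norm_of_nonneg (by linarith)]
  rw [norm_one, norm_mul, norm_mul, hl', Complex.norm_two]
  nlinarith [norm_refl₂_le hl x t]

theorem isPrim_refl₁ {l : ℝ} (hl : 1 < l) (t : ℝ) : ∃ g, IsPrim (fun x => refl₁ l x t) g := by
  have h1 := continuous_refl₁ hl t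
  have h2 := continuous_refl₂ hl t
  have h3 := continuous_star.comp h2
  exact ⟨_, .of_hasDerivAt (fun x => hasDerivAt_refl₁_x hl x t) (by fun_prop)⟩

theorem isPrim_refl₂ {l : ℝ} (hl : 1 < l) (t : ℝ) : ∃ g, IsPrim (fun x => refl₂ l x t) g := by
  have h1 := continuous_refl₁ hl t
  have h2 := continuous_refl₂ hl t
  exact ⟨_, .of_hasDerivAt (fun x => hasDerivAt_refl₂_x hl x t) (by fun_prop)⟩

theorem IsPrim.const (c : ℂ) : IsPrim (fun _ => c) fun _ => 0 :=
  .of_hasDerivAt (fun x => hasDerivAt_const x c) continuous_const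

theorem memLp_dress {l : ℝ} (hl : 1 < l) (z : ℂ) (t : ℝ) {A B : ℝ → ℂ} (hA : MemLp A 2 volume)
    (hB : MemLp B 2 volume) (i : Fin 2) :
    MemLp (fun x => dress l z x t ![A x, B x] i) 2 volume := by
  have h1 := continuous_refl₁ hl t
  have h2 := continuous_refl₂ hl t
  have h3 : Continuous fun x => star (refl₂ l x t) := continuous_star.comp h2
  have hr : MemLp (fun x => refl₁ l x t * A x) 2 volume := hA.bounded_mul h1 (norm_refl₁_le hl · t)
  have hr' : MemLp (fun x => refl₁ l x t * B x) 2 volume := hB.bounded_mul h1 (norm_refl₁_le hl · t)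
  have hs : MemLp (fun x => refl₂ l x t * B x) 2 volume := hB.bounded_mul h2 (norm_refl₂_le hl · t)
  have hs' : MemLp (fun x => star (refl₂ l x t) * A x) 2 volume :=
    hA.bounded_mul h3 (C := 1) fun x => by
      rw [norm_star]
      exact norm_refl₂_le hl x t
  fin_cases i
  · refine (((hA.const_mul z).sub (hr.const_mul (l : ℂ))).sub (hs.const_mul (l : ℂ))).ae_eq
      (.of_forall fun x => ?_)
    simp [dress]
    ring
  · refine (((hs'.const_mul (-l : ℂ)).add (hB.const_mul z)).add (hr'.const_mul (l : ℂ))).ae_eq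
      (.of_forall fun x => ?_)
    simp [dress]
    ring

theorem undress_eq_dress (l : ℝ) (z : ℂ) (x t : ℝ) (v : Fin 2 → ℂ) :
    undress l z x t v = (-(z ^ 2 - l ^ 2)⁻¹) • dress l (-z) x t v := by
  ext i
  fin_cases i <;> simp [undress, dress] <;> ring

theorem memLp_undress {l : ℝ} (hl : 1 < l) (z : ℂ) (t : ℝ) {A B : ℝ → ℂ} (hA : MemLp A 2 volume)
    (hB : MemLp B 2 volume) (i : Fin 2) :
    MemLp (fun x => undress l z x t ![A x, B x] i) 2 volume := by
  simp only [undress_eq_dress, Pi.smul_apply, smul_eq_mul]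
  exact (memLp_dress hl (-z) t hA hB i).const_mul _

/-- The Darboux transformation maps solutions of the inhomogeneous problem for the potential `1` to
solutions for the breather. -/
theorem isPrim_dress {l : ℝ} (hl : 1 < l) {z : ℂ} (t : ℝ) {A B a b : ℝ → ℂ}
    (hA : IsPrim A fun x => z * A x + B x + a x) (hB : IsPrim B fun x => -A x - z * B x + b x) :
    (IsPrim (fun x => dress l z x t ![A x, B x] 0) fun x =>
      z * dress l z x t ![A x, B x] 0 + kmb l x t * dress l z x t ![A x, B x] 1 +
        dress l z x t ![a x, b x] 0) ∧
    IsPrim (fun x => dress l z x t ![A x, B x] 1) fun x =>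
      -star (kmb l x t) * dress l z x t ![A x, B x] 0 - z * dress l z x t ![A x, B x] 1 +
        dress l z x t ![a x, b x] 1 := by
  obtain ⟨r', hr⟩ := isPrim_refl₁ hl t
  obtain ⟨s', hs⟩ := isPrim_refl₂ hl t
  have h0 := (((IsPrim.const z).add (hr.const_mul (-l : ℂ))).mul hA).add
    ((hs.const_mul (-l : ℂ)).mul hB)
  have h1 := ((hs.conj.const_mul (-l : ℂ)).mul hA).add
    (((IsPrim.const z).add (hr.const_mul (l : ℂ))).mul hB)
  have e0 : (fun x => dress l z x t ![A x, B x] 0) = fun x =>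
      (z + -l * refl₁ l x t) * A x + -l * refl₂ l x t * B x := by
    funext x
    simp [dress]
    ring
  have e1 : (fun x => dress l z x t ![A x, B x] 1) = fun x =>
      -l * star (refl₂ l x t) * A x + (z + l * refl₁ l x t) * B x := rfl
  rw [← e0] at h0
  rw [← e1] at h1
  constructor
  · refine h0.congr_ae ?_
    -- The product rule gives some derivative; where all derivatives exist, uniqueness identifies it
    -- with the one from the pointwise intertwining relation.
    filter_upwards [h0.ae_hasDerivAt, hA.ae_hasDerivAt, hB.ae_hasDerivAt] with x d0 dA dB
    exact d0.unique (hasDerivAt_dress_x hl dA dB).1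
  · refine h1.congr_ae ?_
    filter_upwards [h1.ae_hasDerivAt, hA.ae_hasDerivAt, hB.ae_hasDerivAt] with x d0 dA dB
    exact d0.unique (hasDerivAt_dress_x hl dA dB).2

/-- If a root `k` were imaginary, `z² - 1` would be real and nonpositive; then either `Re z = 0`, or
`z` is real with `z² ≤ 1`. -/
theorem exists_root_re_ne_zero {z : ℂ} (hz : z ∉ {z : ℂ | z.re = 0} ∪ Complex.ofReal '' Icc (-1) 1) :
    ∃ k : ℂ, k ^ 2 = z ^ 2 - 1 ∧ k.re ≠ 0 := by
  obtain ⟨k, hk⟩ := IsAlgClosed.exists_pow_nat_eq (z ^ 2 - 1) two_pos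
  refine ⟨k, hk, fun hre => hz ?_⟩
  have h1 := congrArg Complex.re hk
  have h2 := congrArg Complex.im hk
  simp only [pow_two, Complex.mul_re, Complex.mul_im, Complex.sub_re, Complex.sub_im,
    Complex.one_re, Complex.one_im, hre] at h1 h2
  have h3 : z.re * z.im = 0 := by linarith
  rcases mul_eq_zero.1 h3 with h | h
  · exact Or.inl h
  · refine Or.inr ⟨z.re, ?_, ?_⟩
    · rw [h] at h1
      constructor <;> nlinarith [sq_nonneg k.im]
    · apply Complex.ext <;> simp [h]

/-- The equation `(L - z) F = f` reads `F' = U F + (f₁, -f₂)`. The source is undressed, the problem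
is solved for the potential `1`, and the solution is dressed; the three bounds multiply. -/
theorem kmb_mem_resolventSet {l : ℝ} (hl : 1 < l) (t : ℝ) {z : ℂ}
    (hz : z ∉ {z : ℂ | z.re = 0} ∪ Complex.ofReal '' Icc (-1) 1) (hz' : z ^ 2 - l ^ 2 ≠ 0) :
    z ∈ resolventSet (zsOperator fun x => kmb l x t) := by
  obtain ⟨k, hk, hre⟩ := exists_root_re_ne_zero hz
  obtain ⟨C, hC0, hC⟩ := exists_seed_solution hk hre
  have hu := continuous_kmb hl t
  have hub := fun x => norm_kmb_le hl x t
  have hus : Continuous fun x => -star (kmb l x t) := (continuous_star.comp hu).neg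
  obtain ⟨K, hK⟩ : ∃ K : ℝ, ∀ x v, ‖dress l z x t v‖ ≤ K * ‖v‖ :=
    ⟨_, fun x v => norm_dress_le hl z x t v⟩
  obtain ⟨K', hK'⟩ : ∃ K : ℝ, ∀ x v, ‖undress l z x t v‖ ≤ K * ‖v‖ :=
    ⟨‖(z ^ 2 - l ^ 2 : ℂ)⁻¹‖ * (‖z‖ + 2 * l), fun x v =>
      (norm_undress_le hl z x t v).trans (by rw [mul_assoc])⟩
  refine mem_resolventSet_of_bijective √(2 * K ^ 2 * (C * (2 * K' ^ 2))) (fun f => ?_)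
    fun y hy => ?_
  · have hf0 := memLp_entry f 0
    have hf1 := (memLp_entry f 1).neg
    have hg0 := memLp_undress hl z t hf0 hf1 0
    have hg1 := memLp_undress hl z t hf0 hf1 1
    obtain ⟨A, B, hA, hB, pA, pB, hb⟩ := hC _ _ hg0 hg1
    obtain ⟨q0, q1⟩ := isPrim_dress hl t pA pB
    have hF0 := memLp_dress hl z t hA hB 0
    have hF1 := memLp_dress hl z t hA hB 1
    have e : ∀ x, dress l z x t ![undress l z x t ![f x 0, (-fun x => f x 1) x] 0,
        undress l z x t ![f x 0, (-fun x => f x 1) x] 1] = ![f x 0, -f x 1] := fun x => by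
      rw [show ![undress l z x t ![f x 0, (-fun x => f x 1) x] 0,
        undress l z x t ![f x 0, (-fun x => f x 1) x] 1] =
        undress l z x t ![f x 0, (-fun x => f x 1) x] by ext i; fin_cases i <;> rfl,
        dress_undress hl hz']
      rfl
    simp only [e, Matrix.cons_val_zero, Matrix.cons_val_one] at q0 q1
    have hFe := (memLp_pair hF0 hF1).coeFn_toLp
    have hm : ((memLp_pair hF0 hF1).toLp _, z • (memLp_pair hF0 hF1).toLp _ + f) ∈
        zsGraph fun x => kmb l x t := by
      refine mem_zsGraph_of_isPrim hFe ?_ ?_ q0 q1 ?_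
      · exact ((hF0.const_mul z).add (hF1.bounded_mul hu hub)).add hf0
      · refine ((hF0.bounded_mul hus (C := 1 + 2 * l) fun x => ?_).sub (hF1.const_mul z)).add hf1
        rw [norm_neg, norm_star]
        exact hub x
      · filter_upwards [Lp.coeFn_add (z • (memLp_pair hF0 hF1).toLp _) f,
          Lp.coeFn_smul z ((memLp_pair hF0 hF1).toLp _), hFe] with x h1 h2 h3
        rw [h1, Pi.add_apply, h2, Pi.smul_apply, h3]
        ext i
        fin_cases i <;> simp [pair] <;> ring
    obtain ⟨hd, he⟩ := zsOperator_apply_of_mem hm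
    refine ⟨⟨_, hd⟩, ?_, ?_⟩
    · rw [he, add_sub_cancel_left]
    · have hfe : f =ᵐ[volume] pair (fun x => f x 0) fun x => f x 1 := .of_forall fun x => by
        ext i
        fin_cases i <;> rfl
      refine le_of_sq_le_sq ?_ (by positivity)
      rw [mul_pow, Real.sq_sqrt (by positivity), norm_sq_eq_integral hFe, norm_sq_eq_integral hfe]
      have i1 := hF0.integrable_norm_sq.add hF1.integrable_norm_sq
      have i2 := hA.integrable_norm_sq.add hB.integrable_norm_sq
      have i3 := hg0.integrable_norm_sq.add hg1.integrable_norm_sq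
      have i4 := hf0.integrable_norm_sq.add hf1.integrable_norm_sq
      have b1 := integral_mono i1 (i2.const_mul (2 * K ^ 2)) fun x =>
        sum_norm_sq_le (hK x) ![A x, B x]
      have b2 := integral_mono i3 (i4.const_mul (2 * K' ^ 2)) fun x =>
        sum_norm_sq_le (hK' x) ![f x 0, (-fun x => f x 1) x]
      rw [integral_const_mul] at b1 b2
      simp only [Pi.add_apply, Pi.neg_apply, norm_neg] at b1 b2 hb
      have b3 := mul_le_mul_of_nonneg_left (hb.trans (mul_le_mul_of_nonneg_left b2 hC0))
        (show 0 ≤ 2 * K ^ 2 by positivity)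
      exact b1.trans (b3.trans_eq (by ring))
  · have hm := mem_zsGraph_apply y
    have hy' : zsOperator (fun x => kmb l x t) y = z • (y : L2) := sub_eq_zero.1 hy
    rw [hy'] at hm
    obtain ⟨φ, hφ, m0, m1, hf⟩ := exists_isZSSolution_of_mem_zsGraph hu hm
    have hd := isZSSolution_iff.1 hφ
    have e : ∀ x, ![φ x 0, φ x 1] = φ x := fun x => by
      ext i
      fin_cases i <;> rfl
    have n0 := memLp_undress hl z t m0 m1 0
    have n1 := memLp_undress hl z t m0 m1 1
    simp only [e] at n0 n1
    have hu' := fun x => hasDerivAt_undress_x hl (z := z) (hd.1 x) (hd.2 x)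
    have c0 : Continuous fun x => undress l z x t (φ x) 0 :=
      continuous_iff_continuousAt.2 fun x => (hu' x).1.continuousAt
    have c1 : Continuous fun x => undress l z x t (φ x) 1 :=
      continuous_iff_continuousAt.2 fun x => (hu' x).2.continuousAt
    have p0 := IsPrim.of_hasDerivAt (fun x => (hu' x).1) (by fun_prop)
    have p1 := IsPrim.of_hasDerivAt (fun x => (hu' x).2) (by fun_prop)
    -- Uniqueness: the undressed kernel element lies in `L²`, and its combination with factor `z +
    -- κ` solves `y' = κ y`, so it vanishes. The roots `κ = ± k` together kill both components.
    have key : ∀ κ : ℂ, κ ^ 2 = z ^ 2 - 1 → κ.re ≠ 0 → ∀ x,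
        (z + κ) * undress l z x t (φ x) 0 + undress l z x t (φ x) 1 = 0 := by
      intro κ hκ hκr
      have hp : IsPrim (fun x => (z + κ) * undress l z x t (φ x) 0 + undress l z x t (φ x) 1)
          fun x => κ * ((z + κ) * undress l z x t (φ x) 0 + undress l z x t (φ x) 1) := by
        refine ((p0.const_mul (z + κ)).add p1).congr_ae (.of_forall fun x => ?_)
        simp only
        linear_combination -(undress l z x t (φ x) 0) * hκ
      exact congrFun (hp.eq_zero hκr ((n0.const_mul (z + κ)).add n1))
    have hk0 : k ≠ 0 := fun h => hre (by simp [h])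
    have h0 : ∀ x, undress l z x t (φ x) = 0 := fun x => by
      have k1 := key k hk hre x
      have k2 := key (-k) (by rw [neg_sq, hk]) (by simpa using hre) x
      have a0 : undress l z x t (φ x) 0 = 0 := by
        have : 2 * k * undress l z x t (φ x) 0 = 0 := by linear_combination k1 - k2
        exact (mul_eq_zero.1 this).resolve_left (mul_ne_zero two_ne_zero hk0)
      ext i
      fin_cases i
      · exact a0
      · rw [a0] at k1
        simpa using k1
    have hφ0 : ∀ x, φ x = 0 := fun x => by
      rw [← dress_undress hl hz' x t (φ x), h0]
      ext i
      fin_cases i <;> simp [dress]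
    refine Subtype.ext (Lp.ext ?_)
    filter_upwards [hf, Lp.coeFn_zero (EuclideanSpace ℂ (Fin 2)) 2 (volume : Measure ℝ)]
      with x h1 h2
    rw [h1, Submodule.coe_zero, h2]
    ext i
    fin_cases i <;> simp [pair, hφ0]

/-! ### The eigenfunctions for `± λ₀` -/

theorem half_beta_lt {l : ℝ} (hl : 1 < l) : beta l / 2 < l := by
  nlinarith [beta_sq hl, beta_pos hl]

/-- Because `λ₀² - β₀² / 4 = 1`. This product and the two squares are all that is used about the
square roots. -/
theorem sqrt_mul_sqrt_beta {l : ℝ} (hl : 1 < l) :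
    ((√(l + beta l / 2) : ℝ) : ℂ) * (√(l - beta l / 2) : ℝ) = 1 := by
  have h := half_beta_lt hl
  rw [← Complex.ofReal_mul, ← Real.sqrt_mul (by linarith [beta_pos hl]),
    show (l + beta l / 2) * (l - beta l / 2) = 1 by linear_combination -beta_sq hl / 4,
    Real.sqrt_one, Complex.ofReal_one]

theorem sqrt_add_beta_sq {l : ℝ} (hl : 1 < l) :
    ((√(l + beta l / 2) : ℝ) : ℂ) * (√(l + beta l / 2) : ℝ) = l + beta l / 2 := by
  rw [← Complex.ofReal_mul, Real.mul_self_sqrt (by linarith [beta_pos hl])]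
  push_cast
  rfl

theorem sqrt_sub_beta_sq {l : ℝ} (hl : 1 < l) :
    ((√(l - beta l / 2) : ℝ) : ℂ) * (√(l - beta l / 2) : ℝ) = l - beta l / 2 := by
  rw [← Complex.ofReal_mul, Real.mul_self_sqrt (by linarith [half_beta_lt hl])]
  push_cast
  rfl

/-- The exponential that enters `p₀` and `q₀`. -/
def wave (l x t : ℝ) : ℂ := Complex.exp ((1 / 2) * (beta l * x + Complex.I * alpha l * t))

theorem p₀_eq (l x t : ℝ) : p₀ l x t = (√(l + beta l / 2) : ℝ) * wave l x t -
    (√(l - beta l / 2) : ℝ) * (wave l x t)⁻¹ := by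
  rw [p₀, wave, ← Complex.exp_neg, neg_mul]

theorem q₀_eq (l x t : ℝ) : q₀ l x t = -(√(l - beta l / 2) : ℝ) * wave l x t +
    (√(l + beta l / 2) : ℝ) * (wave l x t)⁻¹ := by
  rw [q₀, wave, ← Complex.exp_neg, neg_mul (1 / 2 : ℂ)]

theorem wave_ne_zero (l x t : ℝ) : wave l x t ≠ 0 := Complex.exp_ne_zero _

theorem hasDerivAt_wave_x (l x t : ℝ) :
    HasDerivAt (fun y => wave l y t) (beta l / 2 * wave l x t) x := by
  have h : HasDerivAt (fun y : ℝ => (1 / 2 : ℂ) * (beta l * y + Complex.I * alpha l * t))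
      (1 / 2 * (beta l * 1)) x :=
    (((hasDerivAt_id x).ofReal_comp.const_mul (beta l : ℂ)).add_const _).const_mul _
  refine h.cexp.congr_deriv ?_
  rw [wave]
  ring

theorem hasDerivAt_wave_t (l x t : ℝ) :
    HasDerivAt (fun s => wave l x s) (Complex.I * l * (beta l / 2 * wave l x t)) t := by
  have h : HasDerivAt (fun s : ℝ => (1 / 2 : ℂ) * (beta l * x + Complex.I * alpha l * s))
      (1 / 2 * (Complex.I * alpha l * 1)) t :=
    (((hasDerivAt_id t).ofReal_comp.const_mul (Complex.I * alpha l : ℂ)).const_add _).const_mul _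
  refine h.cexp.congr_deriv ?_
  rw [wave, alpha]
  push_cast
  ring

/-- The pair `(p₀, q₀)` is a seed solution for `z = λ₀`, where `k = β₀ / 2`. The factor `c` is the
speed of `ξ = x + i λ₀ t`: it is `1` for the `x`-derivative and `i λ₀` for the `t`-derivative. -/
theorem hasDerivAt_p₀ {l : ℝ} (hl : 1 < l) {w : ℝ → ℂ} {c : ℂ} {f : ℝ → ℂ} {s : ℝ} (hw : w s ≠ 0)
    (h : HasDerivAt w (c * (beta l / 2 * w s)) s)
    (hf : f = fun y => (√(l + beta l / 2) : ℝ) * w y - (√(l - beta l / 2) : ℝ) * (w y)⁻¹) :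
    HasDerivAt f (c * (l * ((√(l + beta l / 2) : ℝ) * w s - (√(l - beta l / 2) : ℝ) * (w s)⁻¹) +
      (-(√(l - beta l / 2) : ℝ) * w s + (√(l + beta l / 2) : ℝ) * (w s)⁻¹))) s := by
  rw [hf]
  refine ((h.const_mul _).sub ((h.inv hw).const_mul _)).congr_deriv ?_
  have h1 := sqrt_mul_sqrt_beta hl
  have h2 := sqrt_add_beta_sq hl
  have h3 := sqrt_sub_beta_sq hl
  generalize ((√(l + beta l / 2) : ℝ) : ℂ) = a at *
  generalize ((√(l - beta l / 2) : ℝ) : ℂ) = b at *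
  field_simp
  grind

theorem hasDerivAt_q₀ {l : ℝ} (hl : 1 < l) {w : ℝ → ℂ} {c : ℂ} {f : ℝ → ℂ} {s : ℝ} (hw : w s ≠ 0)
    (h : HasDerivAt w (c * (beta l / 2 * w s)) s)
    (hf : f = fun y => -(√(l - beta l / 2) : ℝ) * w y + (√(l + beta l / 2) : ℝ) * (w y)⁻¹) :
    HasDerivAt f (-c * (((√(l + beta l / 2) : ℝ) * w s - (√(l - beta l / 2) : ℝ) * (w s)⁻¹) +
      l * (-(√(l - beta l / 2) : ℝ) * w s + (√(l + beta l / 2) : ℝ) * (w s)⁻¹))) s := by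
  rw [hf]
  refine ((h.const_mul _).add ((h.inv hw).const_mul _)).congr_deriv ?_
  have h1 := sqrt_mul_sqrt_beta hl
  have h2 := sqrt_add_beta_sq hl
  have h3 := sqrt_sub_beta_sq hl
  generalize ((√(l + beta l / 2) : ℝ) : ℂ) = a at *
  generalize ((√(l - beta l / 2) : ℝ) : ℂ) = b at *
  field_simp
  grind

theorem hasDerivAt_p₀_x {l : ℝ} (hl : 1 < l) (x t : ℝ) :
    HasDerivAt (fun y => p₀ l y t) (l * p₀ l x t + q₀ l x t) x := by
  have := hasDerivAt_p₀ hl (w := fun y => wave l y t) (c := 1) (wave_ne_zero l x t)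
    ((hasDerivAt_wave_x l x t).congr_deriv (one_mul _).symm) (funext fun y => p₀_eq l y t)
  rwa [← p₀_eq, ← q₀_eq, one_mul] at this

theorem hasDerivAt_p₀_t {l : ℝ} (hl : 1 < l) (x t : ℝ) :
    HasDerivAt (fun s => p₀ l x s) (Complex.I * l * (l * p₀ l x t + q₀ l x t)) t := by
  have := hasDerivAt_p₀ hl (wave_ne_zero l x t) (hasDerivAt_wave_t l x t)
    (funext fun y => p₀_eq l x y)
  rwa [← p₀_eq, ← q₀_eq] at this

theorem hasDerivAt_q₀_x {l : ℝ} (hl : 1 < l) (x t : ℝ) :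
    HasDerivAt (fun y => q₀ l y t) (-(p₀ l x t + l * q₀ l x t)) x := by
  have := hasDerivAt_q₀ hl (w := fun y => wave l y t) (c := 1) (wave_ne_zero l x t)
    ((hasDerivAt_wave_x l x t).congr_deriv (one_mul _).symm) (funext fun y => q₀_eq l y t)
  rwa [← p₀_eq, ← q₀_eq, neg_one_mul] at this

theorem hasDerivAt_q₀_t {l : ℝ} (hl : 1 < l) (x t : ℝ) :
    HasDerivAt (fun s => q₀ l x s) (-(Complex.I * l) * (p₀ l x t + l * q₀ l x t)) t := by
  have := hasDerivAt_q₀ hl (wave_ne_zero l x t) (hasDerivAt_wave_t l x t)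
    (funext fun y => q₀_eq l x y)
  rwa [← p₀_eq, ← q₀_eq] at this

theorem wave_eq (l x t : ℝ) : wave l x t = Complex.exp (beta l * x / 2) *
    Complex.exp (alpha l * t / 2 * Complex.I) := by
  rw [wave, ← Complex.exp_add]
  ring_nf

theorem star_wave (l x t : ℝ) : star (wave l x t) = Complex.exp (beta l * x / 2) *
    (Complex.exp (alpha l * t / 2 * Complex.I))⁻¹ := by
  rw [wave, Complex.star_def, ← Complex.exp_conj, ← Complex.exp_neg, ← Complex.exp_add]
  simp only [map_mul, map_add, map_div₀, map_one, Complex.conj_ofReal, Complex.conj_I, conj_two]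
  ring_nf

theorem cosh_eq_half {x : ℝ} : ((Real.cosh x : ℝ) : ℂ) =
    (Complex.exp (x / 2) ^ 2 + (Complex.exp (x / 2))⁻¹ ^ 2) / 2 := by
  rw [Complex.ofReal_cosh, Complex.cosh, ← Complex.exp_neg, ← Complex.exp_nat_mul,
    ← Complex.exp_nat_mul]
  push_cast
  ring_nf

theorem sinh_eq_half {x : ℝ} : ((Real.sinh x : ℝ) : ℂ) =
    (Complex.exp (x / 2) ^ 2 - (Complex.exp (x / 2))⁻¹ ^ 2) / 2 := by
  rw [Complex.ofReal_sinh, Complex.sinh, ← Complex.exp_neg, ← Complex.exp_nat_mul,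
    ← Complex.exp_nat_mul]
  push_cast
  ring_nf

theorem cos_eq_half {x : ℝ} : ((Real.cos x : ℝ) : ℂ) =
    (Complex.exp (x / 2 * Complex.I) ^ 2 + (Complex.exp (x / 2 * Complex.I))⁻¹ ^ 2) / 2 := by
  rw [Complex.ofReal_cos, Complex.cos, ← Complex.exp_neg, ← Complex.exp_nat_mul,
    ← Complex.exp_nat_mul]
  push_cast
  ring_nf

theorem I_mul_sin_eq_half {x : ℝ} : Complex.I * ((Real.sin x : ℝ) : ℂ) =
    (Complex.exp (x / 2 * Complex.I) ^ 2 - (Complex.exp (x / 2 * Complex.I))⁻¹ ^ 2) / 2 := by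
  rw [Complex.ofReal_sin, Complex.sin, ← Complex.exp_neg, ← Complex.exp_nat_mul,
    ← Complex.exp_nat_mul]
  push_cast
  ring_nf
  rw [Complex.I_sq]
  ring_nf

theorem star_p₀ (l x t : ℝ) : star (p₀ l x t) = (√(l + beta l / 2) : ℝ) * star (wave l x t) -
    (√(l - beta l / 2) : ℝ) * (star (wave l x t))⁻¹ := by
  rw [p₀_eq]
  simp only [Complex.star_def, map_sub, map_mul, map_inv₀, Complex.conj_ofReal]

theorem star_q₀ (l x t : ℝ) : star (q₀ l x t) = -(√(l - beta l / 2) : ℝ) * star (wave l x t) +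
    (√(l + beta l / 2) : ℝ) * (star (wave l x t))⁻¹ := by
  rw [q₀_eq]
  simp only [Complex.star_def, map_add, map_neg, map_mul, map_inv₀, Complex.conj_ofReal]

/-- The quadratic expressions in `p₀` and `q₀`. -/
theorem p₀_q₀_quadratic {l : ℝ} (hl : 1 < l) (x t : ℝ) :
    p₀ l x t * star (p₀ l x t) + q₀ l x t * star (q₀ l x t) = 4 * denom l x t ∧
    p₀ l x t * star (p₀ l x t) - q₀ l x t * star (q₀ l x t) =
      4 * denom l x t * refl₁ l x t ∧
    2 * (p₀ l x t * star (q₀ l x t)) = 4 * denom l x t * refl₂ l x t ∧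
    p₀ l x t * q₀ l x t = 2 * l - 2 * (Real.cosh (beta l * x) * Real.cos (alpha l * t) +
      Complex.I * Real.sin (alpha l * t) * Real.sinh (beta l * x)) := by
  have hD := denom_ne_zero hl x t
  have hD' : (denom l x t : ℂ) = l * Real.cosh (beta l * x) - Real.cos (alpha l * t) := by
    rw [denom]
    push_cast
    rfl
  have e1 : (denom l x t : ℂ) * refl₁ l x t = beta l / 2 * Real.sinh (beta l * x) := by
    rw [refl₁]
    push_cast
    field_simp
  have e2 : (denom l x t : ℂ) * refl₂ l x t = -Real.cosh (beta l * x) + l * Real.cos (alpha l * t) +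
      beta l / 2 * (Complex.I * Real.sin (alpha l * t)) := by
    rw [refl₂]
    field_simp
    push_cast
    ring
  -- With `E = exp(β₀ x / 2)` and `W = exp(i α₀ t / 2)`, all four claims become Laurent polynomial
  -- identities in `E` and `W`.
  rw [mul_assoc, mul_assoc, e1, e2, hD', star_p₀, star_q₀, p₀_eq, q₀_eq, cosh_eq_half, sinh_eq_half,
    cos_eq_half, I_mul_sin_eq_half, star_wave, wave_eq]
  have h1 := sqrt_mul_sqrt_beta hl
  have h2 := sqrt_add_beta_sq hl
  have h3 := sqrt_sub_beta_sq hl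
  have hE : Complex.exp (beta l * x / 2) ≠ 0 := Complex.exp_ne_zero _
  have hW : Complex.exp (alpha l * t / 2 * Complex.I) ≠ 0 := Complex.exp_ne_zero _
  push_cast
  generalize ((√(l + beta l / 2) : ℝ) : ℂ) = a at *
  generalize ((√(l - beta l / 2) : ℝ) : ℂ) = b at *
  generalize Complex.exp (beta l * x / 2) = E at *
  generalize Complex.exp (alpha l * t / 2 * Complex.I) = W at *
  refine ⟨?_, ?_, ?_, ?_⟩ <;> field_simp
  · linear_combination 2 * (E ^ 4 * W ^ 2 + W ^ 2) * (h2 + h3) - 4 * E ^ 2 * (W ^ 4 + 1) * h1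
  · grind
  · grind
  · linear_combination 2 * E ^ 2 * W ^ 2 * (h2 + h3) - 2 * (E ^ 4 * W ^ 4 + 1) * h1

theorem norm_p₀_add_norm_q₀ {l : ℝ} (hl : 1 < l) (x t : ℝ) :
    ‖p₀ l x t‖ ^ 2 + ‖q₀ l x t‖ ^ 2 = 4 * denom l x t := by
  have h := (p₀_q₀_quadratic hl x t).1
  rw [Complex.star_def, Complex.mul_conj', Complex.mul_conj'] at h
  exact_mod_cast h

theorem pHat_eq {l : ℝ} (hl : 1 < l) (x t : ℝ) :
    pHat l x t = -(l / 2 * star (q₀ l x t)) / denom l x t := by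
  have hD := denom_ne_zero hl x t
  rw [pHat, norm_p₀_add_norm_q₀ hl]
  push_cast
  field_simp
  ring

theorem qHat_eq {l : ℝ} (hl : 1 < l) (x t : ℝ) :
    qHat l x t = l / 2 * star (p₀ l x t) / denom l x t := by
  have hD := denom_ne_zero hl x t
  rw [qHat, norm_p₀_add_norm_q₀ hl]
  push_cast
  field_simp
  ring

/-- `(-conj q₀, conj p₀)` and `(p₀, q₀)` span the eigenspaces of the reflection `S`. -/
theorem refl_mul_p₀_q₀ {l : ℝ} (hl : 1 < l) (x t : ℝ) :
    (1 + refl₁ l x t) * star (q₀ l x t) = refl₂ l x t * star (p₀ l x t) ∧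
    (1 - refl₁ l x t) * star (p₀ l x t) = star (refl₂ l x t) * star (q₀ l x t) := by
  have hD := denom_ne_zero hl x t
  obtain ⟨h1, h2, h3, -⟩ := p₀_q₀_quadratic hl x t
  have h4 := congrArg star h3
  rw [Complex.star_def] at *
  simp only [map_mul, Complex.conj_ofReal, Complex.conj_conj, map_ofNat] at h4
  have hD4 : (4 * denom l x t : ℂ) ≠ 0 := mul_ne_zero (by norm_num) hD
  refine ⟨mul_left_cancel₀ hD4 ?_, mul_left_cancel₀ hD4 ?_⟩
  · linear_combination -(starRingEnd ℂ (q₀ l x t)) * (h1 + h2) + starRingEnd ℂ (p₀ l x t) * h3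
  · linear_combination -(starRingEnd ℂ (p₀ l x t)) * (h1 - h2) + starRingEnd ℂ (q₀ l x t) * h4

theorem hasDerivAt_denom_x' {l : ℝ} (hl : 1 < l) (x t : ℝ) :
    HasDerivAt (fun y => (denom l y t : ℂ)) (2 * l * (denom l x t * refl₁ l x t)) x := by
  refine (hasDerivAt_denom_x l x t).congr_deriv ?_
  have hD := denom_ne_zero hl x t
  rw [refl₁]
  push_cast
  field_simp

theorem hasDerivAt_denom_t' {l : ℝ} (hl : 1 < l) (x t : ℝ) :
    HasDerivAt (fun s => (denom l x s : ℂ))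
      (-Complex.I * l * (denom l x t * (refl₂ l x t - star (refl₂ l x t)))) t := by
  refine (hasDerivAt_denom_t l x t).congr_deriv ?_
  have hD := denom_ne_zero hl x t
  rw [star_refl₂, refl₂, alpha]
  push_cast
  field_simp
  linear_combination 2 * (l : ℂ) * beta l * Complex.sin (l * beta l * t) * Complex.I_sq

/-- The vector `(-q̄₀, p̄₀)` is orthogonal to the kernel vector `(p₀, q₀)` of `λ₀ - λ₀ S`. Dividing
by the denominator `D` supplies the missing terms through its logarithmic derivatives, which are
linear in the entries of `S`; the eigenvector relations `S (p₀, q₀) = (p₀, q₀)` and `S (-q̄₀, p̄₀) =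
-(-q̄₀, p̄₀)` close the computation. -/
theorem isLaxSolution_eigenPlus {l : ℝ} (hl : 1 < l) : IsLaxSolution (kmb l) l (eigenPlus l) := by
  rw [isLaxSolution_kmb_iff hl]
  have e0 : ∀ x t, eigenPlus l x t 0 = -(l / 2 * star (q₀ l x t)) / denom l x t :=
    fun x t => pHat_eq hl x t
  have e1 : ∀ x t, eigenPlus l x t 1 = l / 2 * star (p₀ l x t) / denom l x t :=
    fun x t => qHat_eq hl x t
  simp only [isZSSolution_iff, e0, e1]
  refine ⟨fun t => ⟨fun x => ?_, fun x => ?_⟩, fun x t => ?_, fun x t => ?_⟩ <;>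
    have hD := denom_ne_zero hl x t <;>
    obtain ⟨h1, h2⟩ := refl_mul_p₀_q₀ hl x t
  · refine ((((hasDerivAt_q₀_x hl x t).star.const_mul _).neg.div (hasDerivAt_denom_x' hl x t)
      hD).congr_deriv ?_)
    rw [kmb_eq hl]
    simp only [Complex.star_def, Pi.neg_apply, map_mul, map_add, map_neg, Complex.conj_ofReal] at *
    field_simp
    linear_combination 2 * (l : ℂ) ^ 2 * h1
  · refine ((((hasDerivAt_p₀_x hl x t).star.const_mul _).div (hasDerivAt_denom_x' hl x t)
      hD).congr_deriv ?_)
    rw [kmb_eq hl]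
    simp only [Complex.star_def, map_mul, map_add, map_one, conj_two,
      Complex.conj_ofReal] at *
    field_simp
    linear_combination 2 * (l : ℂ) ^ 2 * h2
  · refine ((((hasDerivAt_q₀_t hl x t).star.const_mul _).neg.div (hasDerivAt_denom_t' hl x t)
      hD).congr_deriv ?_)
    simp only [Complex.star_def, Pi.neg_apply, map_mul, map_add, map_neg, Complex.conj_ofReal,
      Complex.conj_I] at *
    field_simp
    linear_combination -(2 * (l : ℂ) ^ 2 + 2 * l ^ 3 * refl₂ l x t) * h2
  · refine ((((hasDerivAt_p₀_t hl x t).star.const_mul _).div (hasDerivAt_denom_t' hl x t)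
      hD).congr_deriv ?_)
    simp only [Complex.star_def, map_mul, map_add, Complex.conj_ofReal,
      Complex.conj_I] at *
    field_simp
    linear_combination -(2 * (l : ℂ) ^ 2 + 2 * l ^ 3 * (starRingEnd ℂ) (refl₂ l x t)) * h1

/-- The symmetry of the Lax system for the breather that reverses the sign of the spectral
parameter. -/
theorem IsLaxSolution.conj {l : ℝ} (hl : 1 < l) {z : ℂ} {φ : ℝ → ℝ → Fin 2 → ℂ}
    (h : IsLaxSolution (kmb l) z φ) :
    IsLaxSolution (kmb l) (-star z) fun x t => ![star (φ x t 1), -star (φ x t 0)] := by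
  rw [isLaxSolution_kmb_iff hl] at *
  simp only [isZSSolution_iff, Matrix.cons_val_zero, Matrix.cons_val_one] at *
  obtain ⟨h1, h2, h3⟩ := h
  refine ⟨fun t => ⟨fun x => ?_, fun x => ?_⟩, fun x t => ?_, fun x t => ?_⟩
  · refine ((h1 t).2 x).star.congr_deriv ?_
    simp only [Complex.star_def, map_mul, map_sub, map_neg, Complex.conj_conj]
    ring
  · refine ((h1 t).1 x).star.neg.congr_deriv ?_
    simp only [Complex.star_def, map_mul, map_add]
    ring
  · refine (h3 x t).star.congr_deriv ?_
    have := star_refl₁ l x t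
    simp only [Complex.star_def, map_mul, map_add, map_sub, map_neg, map_one, map_pow, conj_two,
      Complex.conj_ofReal, Complex.conj_I, Complex.conj_conj] at *
    rw [this]
    ring
  · refine (h2 x t).star.neg.congr_deriv ?_
    have := star_refl₁ l x t
    simp only [Complex.star_def, map_mul, map_add, map_sub, map_one, map_pow, conj_two,
      Complex.conj_ofReal, Complex.conj_I, Complex.conj_conj] at *
    rw [this]
    ring

theorem isLaxSolution_eigenMinus {l : ℝ} (hl : 1 < l) :
    IsLaxSolution (kmb l) (-l) (eigenMinus l) := by
  have h := (isLaxSolution_eigenPlus hl).conj hl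
  rwa [Complex.star_def, Complex.conj_ofReal] at h

/-- From `cosh y = 1 + 2 sinh² (y / 2) ≥ 1 + y² / 2`. The true growth is exponential, but this
suffices for the square integrability of the eigenfunctions, whose squared modulus is `λ₀² / D`, and
for `D → ∞`. -/
theorem one_add_sq_le_denom {l : ℝ} (hl : 1 < l) (x t : ℝ) :
    (l - 1) / 2 * (1 + (beta l * x) ^ 2) ≤ denom l x t := by
  have h1 : 1 + (beta l * x) ^ 2 / 2 ≤ Real.cosh (beta l * x) := by
    have h2 : Real.cosh (beta l * x) = 1 + 2 * Real.sinh (beta l * x / 2) ^ 2 := by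
      have := Real.cosh_two_mul (beta l * x / 2)
      rw [Real.cosh_sq, mul_div_cancel₀ _ (two_ne_zero' ℝ)] at this
      linarith
    have h3 : (beta l * x / 2) ^ 2 ≤ Real.sinh (beta l * x / 2) ^ 2 := by
      rw [← sq_abs, ← sq_abs (Real.sinh _), Real.abs_sinh]
      exact pow_le_pow_left₀ (abs_nonneg _) (Real.self_le_sinh_iff.2 (abs_nonneg _)) 2
    rw [h2]
    linarith
  have h4 := Real.cos_le_one (alpha l * t)
  rw [denom]
  nlinarith [sq_nonneg (beta l * x)]

theorem continuous_eigenPlus {l : ℝ} (hl : 1 < l) (t : ℝ) :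
    (Continuous fun x => pHat l x t) ∧ Continuous fun x => qHat l x t := by
  have h := ((isLaxSolution_eigenPlus hl).1 t).continuous
  exact ⟨(continuous_apply 0).comp h, (continuous_apply 1).comp h⟩

theorem norm_pHat_sq_add {l : ℝ} (hl : 1 < l) (x t : ℝ) :
    ‖pHat l x t‖ ^ 2 + ‖qHat l x t‖ ^ 2 = l ^ 2 / denom l x t := by
  have hD := denom_pos hl x t
  have h := norm_p₀_add_norm_q₀ hl x t
  rw [pHat_eq hl, qHat_eq hl]
  simp only [norm_div, norm_neg, norm_mul, norm_star, Complex.norm_real, Real.norm_eq_abs, div_pow,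
    mul_pow, sq_abs, Complex.norm_ofNat]
  field_simp
  linear_combination h

theorem memLp_hat {l : ℝ} (hl : 1 < l) (t : ℝ) :
    MemLp (fun x => pHat l x t) 2 volume ∧ MemLp (fun x => qHat l x t) 2 volume := by
  have hi : Integrable fun x => l ^ 2 * ((l - 1) / 2)⁻¹ * (1 + (beta l * x) ^ 2)⁻¹ :=
    (integrable_inv_one_add_sq.comp_mul_left' (beta_pos hl).ne').const_mul _
  have hb : ∀ x, l ^ 2 / denom l x t ≤ l ^ 2 * ((l - 1) / 2)⁻¹ * (1 + (beta l * x) ^ 2)⁻¹ :=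
    fun x => by
      have hl1 : 0 < (l - 1) / 2 := by linarith
      rw [mul_assoc, ← mul_inv, ← div_eq_mul_inv]
      exact div_le_div_of_nonneg_left (sq_nonneg l) (by positivity) (one_add_sq_le_denom hl x t)
  have key : ∀ f : ℝ → ℂ, Continuous f → (∀ x, ‖f x‖ ^ 2 ≤ l ^ 2 / denom l x t) →
      MemLp f 2 volume := fun f hf h => by
    refine (memLp_two_iff_integrable_sq_norm hf.aestronglyMeasurable).2 ?_
    refine hi.mono' (by fun_prop) (.of_forall fun x => ?_)
    rw [Real.norm_of_nonneg (by positivity)]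
    exact (h x).trans (hb x)
  obtain ⟨c0, c1⟩ := continuous_eigenPlus hl t
  refine ⟨key _ c0 fun x => ?_, key _ c1 fun x => ?_⟩ <;>
    linarith [norm_pHat_sq_add hl x t, sq_nonneg ‖pHat l x t‖, sq_nonneg ‖qHat l x t‖]

theorem eigenPlus_ne_zero {l : ℝ} (hl : 1 < l) (x t : ℝ) : eigenPlus l x t ≠ 0 := fun h => by
  have h0 : pHat l x t = 0 := congrFun h 0
  have h1 : qHat l x t = 0 := congrFun h 1
  have := norm_pHat_sq_add hl x t
  have hD := denom_pos hl x t
  rw [h0, h1, norm_zero, eq_comm, div_eq_iff hD.ne'] at this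
  nlinarith

theorem eigenMinus_ne_zero {l : ℝ} (hl : 1 < l) (x t : ℝ) : eigenMinus l x t ≠ 0 := fun h => by
  refine eigenPlus_ne_zero hl x t ?_
  have h0 : star (qHat l x t) = 0 := congrFun h 0
  have h1 : -star (pHat l x t) = 0 := congrFun h 1
  rw [neg_eq_zero, star_eq_zero] at h1
  rw [star_eq_zero] at h0
  ext i
  fin_cases i
  · exact h1
  · exact h0

/-! ### The pairing of the eigenfunction with the adjoint eigenfunction -/

theorem tendsto_denom_atTop {l : ℝ} (hl : 1 < l) (t : ℝ) :
    Tendsto (fun x => denom l x t) atTop atTop := by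
  refine tendsto_atTop_mono (fun x => one_add_sq_le_denom hl x t) ?_
  refine Tendsto.const_mul_atTop (by linarith) (tendsto_atTop_add_const_left _ _ ?_)
  exact (tendsto_pow_atTop two_ne_zero).comp (tendsto_id.const_mul_atTop (beta_pos hl))

theorem tendsto_sinh_div_denom {l : ℝ} (hl : 1 < l) (t : ℝ) :
    Tendsto (fun x => Real.sinh (beta l * x) / denom l x t) atTop (𝓝 l⁻¹) := by
  have hl0 : l ≠ 0 := by linarith
  -- The difference `λ₀ sinh - D = cos - λ₀ (cosh - sinh)` stays bounded as `x → ∞`, while `D → ∞`.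
  have e : ∀ x, Real.sinh (beta l * x) / denom l x t = l⁻¹ +
      (Real.cos (alpha l * t) - l * Real.exp (-(beta l * x))) * (l * denom l x t)⁻¹ := fun x => by
    have hD := (denom_pos hl x t).ne'
    have := Real.cosh_sub_sinh (beta l * x)
    rw [← this]
    field_simp
    rw [denom]
    ring
  simp only [e]
  have h1 : Tendsto (fun x => Real.cos (alpha l * t) - l * Real.exp (-(beta l * x))) atTop
      (𝓝 (Real.cos (alpha l * t) - l * 0)) :=
    ((Real.tendsto_exp_neg_atTop_nhds_zero.comp
      (tendsto_id.const_mul_atTop (beta_pos hl))).const_mul l).const_sub _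
  have h2 : Tendsto (fun x => (l * denom l x t)⁻¹) atTop (𝓝 0) :=
    ((tendsto_denom_atTop hl t).const_mul_atTop (by linarith)).inv_tendsto_atTop
  simpa using (h1.mul h2).const_add l⁻¹

/-- A primitive of `2 p̂₀ q̂₀`. -/
def pairingPrim (l x t : ℝ) : ℂ :=
  -(l ^ 2 / beta l : ℂ) * (((Real.sinh (beta l * x) / denom l x t : ℝ) : ℂ) -
    Complex.I * Real.sin (alpha l * t) / l * (((denom l x t)⁻¹ : ℝ) : ℂ))

/-- The integrand is `-(λ₀² / 2) conj(p₀ q₀) / D²` with `p₀ q₀` known explicitly. The derivative of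
`sinh / D` yields its real part, by `cosh² - sinh² = 1`, and that of `1 / D` its imaginary part. -/
theorem hasDerivAt_pairingPrim {l : ℝ} (hl : 1 < l) (x t : ℝ) :
    HasDerivAt (fun y => pairingPrim l y t) (2 * (pHat l x t * qHat l x t)) x := by
  have hl0 : (l : ℂ) ≠ 0 := Complex.ofReal_ne_zero.2 (by linarith)
  have hβ : (beta l : ℂ) ≠ 0 := Complex.ofReal_ne_zero.2 (beta_pos hl).ne'
  have hD := denom_ne_zero hl x t
  have hS : HasDerivAt (fun y : ℝ => ((Real.sinh (beta l * y) : ℝ) : ℂ))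
      ((beta l * Real.cosh (beta l * x) : ℝ) : ℂ) x := by
    refine HasDerivAt.ofReal_comp ?_
    refine (((hasDerivAt_id x).const_mul (beta l)).sinh).congr_deriv ?_
    simp only [id, mul_one]
    ring
  have h := ((hS.div (hasDerivAt_denom_x l x t) hD).sub
    (((hasDerivAt_denom_x l x t).inv hD).const_mul (Complex.I * Real.sin (alpha l * t) / l))).const_mul
      (-(l ^ 2 / beta l : ℂ))
  have hf : (fun y => pairingPrim l y t) = fun y => -(l ^ 2 / beta l : ℂ) *
      (((Real.sinh (beta l * y) : ℝ) : ℂ) / denom l y t -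
        Complex.I * Real.sin (alpha l * t) / l * (denom l y t : ℂ)⁻¹) := by
    funext y
    rw [pairingPrim]
    push_cast
    rfl
  rw [hf]
  refine h.congr_deriv ?_
  have hq := congrArg star (p₀_q₀_quadratic hl x t).2.2.2
  have hcs : ((Real.cosh (beta l * x) : ℝ) : ℂ) ^ 2 = Real.sinh (beta l * x) ^ 2 + 1 := by
    exact_mod_cast Real.cosh_sq (beta l * x)
  have hDe : (denom l x t : ℂ) = l * Real.cosh (beta l * x) - Real.cos (alpha l * t) := by
    rw [denom]
    push_cast
    rfl
  rw [pHat_eq hl, qHat_eq hl]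
  simp only [Complex.star_def, map_mul, map_add, map_sub, conj_two, Complex.conj_ofReal,
    Complex.conj_I] at *
  simp only [Complex.ofReal_mul]
  generalize (starRingEnd ℂ) (p₀ l x t) = p at *
  generalize (starRingEnd ℂ) (q₀ l x t) = q at *
  generalize ((Real.cosh (beta l * x) : ℝ) : ℂ) = C at *
  generalize ((Real.sinh (beta l * x) : ℝ) : ℂ) = S at *
  generalize ((Real.sin (alpha l * t) : ℝ) : ℂ) = s at *
  generalize ((Real.cos (alpha l * t) : ℝ) : ℂ) = c at *
  generalize (denom l x t : ℂ) = D at *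
  field_simp
  subst hDe
  linear_combination hq - 2 * l * hcs

theorem sinh_div_denom_neg (l x t : ℝ) :
    Real.sinh (beta l * -x) / denom l (-x) t = -(Real.sinh (beta l * x) / denom l x t) := by
  rw [denom, denom, mul_neg, Real.sinh_neg, Real.cosh_neg, neg_div]

theorem denom_neg (l x t : ℝ) : denom l (-x) t = denom l x t := by
  rw [denom, denom, mul_neg, Real.cosh_neg]

/-- At infinity only the odd term `sinh / D` of the primitive survives, with limits `± 1 / λ₀`; the
term in `1 / D` vanishes at both ends. -/
theorem integral_pHat_mul_qHat {l : ℝ} (hl : 1 < l) (t : ℝ) :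
    ∫ x, 2 * (pHat l x t * qHat l x t) = -2 * (l : ℂ) / beta l := by
  have hl0 : (l : ℂ) ≠ 0 := Complex.ofReal_ne_zero.2 (by linarith)
  have hlim : ∀ {F : Filter ℝ} {a : ℝ}, Tendsto (fun x => Real.sinh (beta l * x) / denom l x t) F (𝓝 a) →
      Tendsto (fun x => (denom l x t)⁻¹) F (𝓝 0) →
      Tendsto (fun x => pairingPrim l x t) F (𝓝 (-(l ^ 2 / beta l : ℂ) * a)) := fun h1 h2 => by
    have h1' := (Complex.continuous_ofReal.tendsto _).comp h1
    have h2' := (Complex.continuous_ofReal.tendsto _).comp h2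
    have := ((h1'.sub (h2'.const_mul (Complex.I * Real.sin (alpha l * t) / l))).const_mul
      (-(l ^ 2 / beta l : ℂ)))
    rw [Complex.ofReal_zero, mul_zero, sub_zero] at this
    exact this
  have htop := hlim (tendsto_sinh_div_denom hl t) (tendsto_denom_atTop hl t).inv_tendsto_atTop
  have hbot : Tendsto (fun x => pairingPrim l x t) atBot (𝓝 (-(l ^ 2 / beta l : ℂ) * (-l⁻¹ : ℝ))) := by
    refine hlim ?_ ?_
    · refine ((tendsto_sinh_div_denom hl t).neg.comp tendsto_neg_atBot_atTop).congr fun x => ?_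
      simp only [Function.comp]
      rw [sinh_div_denom_neg, neg_neg]
    · refine ((tendsto_denom_atTop hl t).inv_tendsto_atTop.comp tendsto_neg_atBot_atTop).congr
        fun x => ?_
      simp only [Function.comp, Pi.inv_apply]
      rw [denom_neg]
  obtain ⟨m0, m1⟩ := memLp_hat hl t
  have hi : Integrable fun x => 2 * (pHat l x t * qHat l x t) := by
    simpa only [Pi.star_apply, star_star] using (m0.integrable_mul_star m1.star).const_mul 2
  rw [integral_of_hasDerivAt_of_tendsto (fun x => hasDerivAt_pairingPrim hl x t) hi hbot htop]
  push_cast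
  field_simp
  ring

/-! ### Simplicity of `± λ₀` and the spectrum of the breather -/

/-- A square integrable solution of the spectral problem is an eigenfunction, and the eigenvalue is
algebraically simple if the pairing with an adjoint eigenfunction does not vanish. -/
theorem isEigenvector_and_algMult_eq_one {u : ℝ → ℂ} {C : ℝ} (hu : Continuous u)
    (hC : ∀ x, ‖u x‖ ≤ C) {z : ℂ} {φ ψ : ℝ → Fin 2 → ℂ} (hφ : IsZSSolution u z φ) (h0 : φ 0 ≠ 0)
    (hφ₀ : MemLp (fun x => φ x 0) 2 volume) (hφ₁ : MemLp (fun x => φ x 1) 2 volume)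
    (hψ : IsZSSolution u (-star z) ψ) (hψ₀ : MemLp (fun x => ψ x 0) 2 volume)
    (hψ₁ : MemLp (fun x => ψ x 1) 2 volume) {f g : L2}
    (hf : f =ᵐ[volume] pair (fun x => φ x 0) fun x => φ x 1)
    (hg : g =ᵐ[volume] pair (fun x => ψ x 0) fun x => -ψ x 1) (hgf : inner ℂ g f ≠ 0) :
    IsEigenvector (zsOperator u) z f ∧ algMult (zsOperator u) z = 1 := by
  have hf0 : f ≠ 0 := fun h => hgf (by rw [h, inner_zero_right])
  have he : IsEigenvector (zsOperator u) z f :=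
    ⟨hf0, zsOperator_apply_of_mem (hφ.mem_zsGraph hu hC hφ₀ hφ₁ hf)⟩
  refine ⟨he, algMult_eq_one he (fun y hy => ?_) (innerSL ℂ g).toLinearMap (fun y => ?_) hgf⟩
  · have hm := mem_zsGraph_apply y
    rw [hy] at hm
    obtain ⟨χ, hχ, hχ₀, hχ₁, hyχ⟩ := exists_isZSSolution_of_mem_zsGraph hu hm
    obtain ⟨c, rfl⟩ := hφ.exists_eq_smul hC h0 hφ₀ hφ₁ hχ hχ₀ hχ₁
    refine ⟨c, Lp.ext ?_⟩
    filter_upwards [hyχ, hf, Lp.coeFn_smul c f] with x h1 h2 h3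
    rw [h1, h3, Pi.smul_apply, h2]
    ext i
    fin_cases i <;> simp [pair]
  · change inner ℂ g (zsOperator u y) = z * inner ℂ g (y : L2)
    rw [inner_zsGraph hu hC hψ hψ₀ hψ₁ hg (mem_zsGraph_apply y), neg_neg, inner_smul_left,
      Complex.star_def, Complex.conj_conj]

theorem exists_bounded_of_finrank_ne_zero {u : ℝ → ℂ} {z : ℂ}
    (h : Module.finrank ℂ (boundedZSSolutions u z) ≠ 0) :
    ∃ φ, IsZSSolution u z φ ∧ (∃ M : ℝ, ∀ x, ‖φ x‖ ≤ M) ∧ φ ≠ 0 := by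
  have hb : boundedZSSolutions u z ≠ ⊥ := fun hb => h (by rw [hb, finrank_bot])
  obtain ⟨φ, hφ, h0⟩ := Submodule.exists_mem_ne_zero_of_ne_bot hb
  exact ⟨φ, hφ.1, hφ.2, h0⟩

/-- Outside the claimed set the resolvent has been constructed. On `iℝ ∪ [-1, 1]` a nonzero bounded
solution exists, at the endpoints `± 1` from the one-dimensional count. -/
theorem spectrum_kmb {l : ℝ} (hl : 1 < l) (t : ℝ)
    (hp : (l : ℂ) ∈ spectrum (kmbOperator l t)) (hm : (-l : ℂ) ∈ spectrum (kmbOperator l t)) :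
    spectrum (kmbOperator l t) =
      {z : ℂ | z.re = 0} ∪ Complex.ofReal '' Icc (-1) 1 ∪ {(l : ℂ), -(l : ℂ)} := by
  refine Subset.antisymm (fun z hz => ?_) ?_
  · by_contra h
    rw [mem_union, not_or, mem_insert_iff, mem_singleton_iff, not_or] at h
    exact hz (kmb_mem_resolventSet hl t h.1 (sq_sub_sq_ne_zero h.2.1 h.2.2))
  · have key : ∀ z, Module.finrank ℂ (boundedZSSolutions (fun x => kmb l x t) z) ≠ 0 →
        z ∈ spectrum (kmbOperator l t) := fun z h => by
      obtain ⟨φ, hφ, ⟨M, hM⟩, h0⟩ := exists_bounded_of_finrank_ne_zero h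
      exact mem_spectrum_of_bounded (continuous_kmb hl t) (fun x => norm_kmb_le hl x t) hφ hM h0
    have two : ∀ z ∈ {z : ℂ | z.re = 0} ∪ Complex.ofReal '' Ioo (-1) 1,
        z ∈ spectrum (kmbOperator l t) := fun z hz =>
      key z (by rw [(finrank_bounded_eq_two hl hz).2 t]; norm_num)
    have one : ∀ z ∈ ({1, -1} : Set ℂ), z ∈ spectrum (kmbOperator l t) := fun z hz =>
      key z (by rw [(finrank_bounded_eq_one hl hz).2 t]; norm_num)
    rintro z ((hz | ⟨x, hx, rfl⟩) | rfl | rfl)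
    · exact two z (.inl hz)
    · rcases hx.1.eq_or_lt with h1 | h1
      · exact one _ (.inr (by rw [← h1]; simp))
      · rcases hx.2.eq_or_lt with h2 | h2
        · exact one _ (.inl (by rw [h2]; simp))
        · exact two _ (.inr ⟨x, ⟨h1, h2⟩, rfl⟩)
    · exact hp
    · exact hm

theorem eigenfunctions_kmb {l : ℝ} (hl : 1 < l) (t : ℝ) :
    ∃ (hp : MemLp (fun x => WithLp.toLp 2 (eigenPlus l x t)) 2 (volume : Measure ℝ))
      (hm : MemLp (fun x => WithLp.toLp 2 (eigenMinus l x t)) 2 (volume : Measure ℝ))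
      (ha : MemLp (fun x => WithLp.toLp 2 (eigenAdjoint l x t)) 2 (volume : Measure ℝ)),
      algMult (kmbOperator l t) l = 1 ∧ algMult (kmbOperator l t) (-l) = 1 ∧
      IsEigenvector (kmbOperator l t) l (hp.toLp _) ∧
      IsEigenvector (kmbOperator l t) (-l) (hm.toLp _) ∧
      IsEigenvector (kmbOperator l t).adjoint l (ha.toLp _) ∧
      inner ℂ (ha.toLp _) (hp.toLp _) = -2 * (l : ℂ) / (beta l : ℂ) ∧
      -2 * (l : ℂ) / (beta l : ℂ) ≠ 0 := by
  obtain ⟨m0, m1⟩ := memLp_hat hl t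
  have hp : MemLp (fun x => WithLp.toLp 2 (eigenPlus l x t)) 2 (volume : Measure ℝ) :=
    memLp_pair m0 m1
  have hm : MemLp (fun x => WithLp.toLp 2 (eigenMinus l x t)) 2 (volume : Measure ℝ) :=
    memLp_pair m1.star m0.star.neg
  have ha : MemLp (fun x => WithLp.toLp 2 (eigenAdjoint l x t)) 2 (volume : Measure ℝ) :=
    memLp_pair m1.star m0.star
  -- The adjoint eigenfunction for `-λ₀`, obtained from the solution for `λ₀` by changing the sign
  -- of the second component.
  have hb : MemLp (pair (fun x => pHat l x t) fun x => -qHat l x t) 2 volume :=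
    memLp_pair m0 m1.neg
  have hu := continuous_kmb hl t
  have hC := fun x => norm_kmb_le hl x t
  have sp := (isLaxSolution_eigenPlus hl).1 t
  have sm := (isLaxSolution_eigenMinus hl).1 t
  have hfp : hp.toLp _ =ᵐ[volume] pair (fun x => eigenPlus l x t 0) fun x => eigenPlus l x t 1 :=
    hp.coeFn_toLp
  have hfm : hm.toLp _ =ᵐ[volume] pair (fun x => eigenMinus l x t 0)
    fun x => eigenMinus l x t 1 := hm.coeFn_toLp
  have hfa : ha.toLp _ =ᵐ[volume] pair (fun x => eigenMinus l x t 0)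
      fun x => -eigenMinus l x t 1 := by
    filter_upwards [ha.coeFn_toLp] with x hx
    rw [hx]
    ext i
    fin_cases i <;> simp [pair, eigenAdjoint, eigenMinus]
  have hfb : hb.toLp _ =ᵐ[volume] pair (fun x => eigenPlus l x t 0)
    fun x => -eigenPlus l x t 1 := hb.coeFn_toLp
  have hne : -2 * (l : ℂ) / (beta l : ℂ) ≠ 0 :=
    div_ne_zero (mul_ne_zero (by norm_num) (Complex.ofReal_ne_zero.2 (by linarith)))
      (Complex.ofReal_ne_zero.2 (beta_pos hl).ne')
  have hi : inner ℂ (ha.toLp _) (hp.toLp _) = -2 * (l : ℂ) / (beta l : ℂ) := by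
    rw [← integral_pHat_mul_qHat hl t, inner_eq_integral hfa hfp]
    refine integral_congr_ae (.of_forall fun x => ?_)
    simp only [eigenPlus, eigenMinus, Matrix.cons_val_zero, Matrix.cons_val_one, neg_neg, star_star]
    ring
  have hj : inner ℂ (hb.toLp _) (hm.toLp _) = -2 * (l : ℂ) / (beta l : ℂ) := by
    -- The pairing for `-λ₀` is the complex conjugate of the one for `λ₀`, whose value is real.
    have hr : -2 * (l : ℂ) / (beta l : ℂ) = starRingEnd ℂ (-2 * (l : ℂ) / (beta l : ℂ)) := by
      simp only [map_div₀, map_mul, map_neg, conj_two, Complex.conj_ofReal]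
    rw [hr, ← integral_pHat_mul_qHat hl t, ← integral_conj, inner_eq_integral hfb hfm]
    refine integral_congr_ae (.of_forall fun x => ?_)
    simp only [eigenPlus, eigenMinus, Matrix.cons_val_zero, Matrix.cons_val_one, star_neg,
      Complex.star_def, map_mul, conj_two]
    ring
  have hl' : -star (l : ℂ) = -l := congrArg Neg.neg (Complex.conj_ofReal l)
  have hl'' : -star (-l : ℂ) = l := by rw [star_neg, neg_neg, Complex.star_def, Complex.conj_ofReal]
  obtain ⟨ep, ap⟩ := isEigenvector_and_algMult_eq_one hu hC sp (eigenPlus_ne_zero hl 0 t) m0 m1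
    (by rwa [hl']) m1.star m0.star.neg hfp hfa (by rwa [hi])
  obtain ⟨em, am⟩ := isEigenvector_and_algMult_eq_one hu hC sm (eigenMinus_ne_zero hl 0 t) m1.star
    m0.star.neg (by rwa [hl'']) m0 m1 hfm hfb (by rwa [hj])
  refine ⟨hp, hm, ha, ap, am, ep, em, ?_, hi, hne⟩
  have := isEigenvector_adjoint hu hC sm m1.star m0.star.neg
    (fun h => hne (by rw [← hi, h, inner_zero_left])) hfa
  rwa [neg_neg] at this

end KMB

end

theorem mainTheorem3 (l : ℝ) (hl : 1 < l) :
    -- the spectrum in `L²(ℝ; ℂ²)`, at each time `t`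
    (∀ t : ℝ, KMB.spectrum (KMB.kmbOperator l t) =
      {z : ℂ | z.re = 0} ∪ Complex.ofReal '' Set.Icc (-1) 1 ∪ {(l : ℂ), -(l : ℂ)}) ∧
    -- two linearly independent bounded solutions for `z ∈ iℝ ∪ (-1, 1)`
    (∀ z ∈ {z : ℂ | z.re = 0} ∪ Complex.ofReal '' Set.Ioo (-1) 1,
      Module.finrank ℂ (KMB.boundedLaxSolutions (KMB.kmb l) z) = 2 ∧
      ∀ t : ℝ, Module.finrank ℂ (KMB.boundedZSSolutions (fun x => KMB.kmb l x t) z) = 2) ∧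
    -- only one bounded solution, up to constant multiples, for `z = ± 1`
    (∀ z ∈ ({1, -1} : Set ℂ),
      Module.finrank ℂ (KMB.boundedLaxSolutions (KMB.kmb l) z) = 1 ∧
      ∀ t : ℝ, Module.finrank ℂ (KMB.boundedZSSolutions (fun x => KMB.kmb l x t) z) = 1) ∧
    -- the algebraically simple eigenvalues `± l` and their eigenfunctions
    KMB.IsLaxSolution (KMB.kmb l) l (KMB.eigenPlus l) ∧
    KMB.IsLaxSolution (KMB.kmb l) (-l) (KMB.eigenMinus l) ∧
    ∀ t : ℝ,
      ∃ (hp : MemLp (fun x => WithLp.toLp 2 (KMB.eigenPlus l x t)) 2 (volume : Measure ℝ))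
        (hm : MemLp (fun x => WithLp.toLp 2 (KMB.eigenMinus l x t)) 2 (volume : Measure ℝ))
        (ha : MemLp (fun x => WithLp.toLp 2 (KMB.eigenAdjoint l x t)) 2 (volume : Measure ℝ)),
        KMB.algMult (KMB.kmbOperator l t) l = 1 ∧
        KMB.algMult (KMB.kmbOperator l t) (-l) = 1 ∧
        KMB.IsEigenvector (KMB.kmbOperator l t) l (hp.toLp _) ∧
        KMB.IsEigenvector (KMB.kmbOperator l t) (-l) (hm.toLp _) ∧
        -- the Fredholm pairing with the adjoint eigenfunction does not vanish
        KMB.IsEigenvector (KMB.kmbOperator l t).adjoint l (ha.toLp _) ∧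
        inner ℂ (ha.toLp _) (hp.toLp _) = -2 * (l : ℂ) / (KMB.beta l : ℂ) ∧
        -2 * (l : ℂ) / (KMB.beta l : ℂ) ≠ 0 := by
  refine ⟨fun t => ?_, fun z hz => KMB.finrank_bounded_eq_two hl hz,
    fun z hz => KMB.finrank_bounded_eq_one hl hz, KMB.isLaxSolution_eigenPlus hl,
    KMB.isLaxSolution_eigenMinus hl, KMB.eigenfunctions_kmb hl⟩
  obtain ⟨_, _, _, -, -, hp, hm, -⟩ := KMB.eigenfunctions_kmb hl t
  exact KMB.spectrum_kmb hl t hp.mem_spectrum hm.mem_spectrum
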